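/- Let $\alpha>0$ and let $k,\omega_0,\omega_1$ be real with $\cos\omega_0\neq 0$. Put $\gamma=\alpha\tan\omega_0$, $$R(\theta)=\begin{pmatrix}\cos\theta&\sin\theta\\ \sin\theta&-\cos\theta\end{pmatrix},\qquad C=\begin{pmatrix}\cos\omega_0&-\sin\omega_0\\ \sin\omega_0&\cos\omega_0\end{pmatrix},\qquad F(x)=\alpha x I+kR(\gamma x^2+\omega_1),$$ $$U(x)=(\alpha^2x^2+k^2-\alpha)I+\frac{2\alpha kx}{\cos\omega_0}R(\chi),\qquad \chi=\gamma x^2+\omega_1-\omega_0,$$ and $D=d/dx$, $A=D+F$, $\bar A=-D+F$. Let $L=-D^2+U$ be the operator in $L^2(\mathbb R;\mathbb C^2)$ obtained as the closure of its restriction to smooth compactly supported functions. Then: 1. $L$ is self-adjoint, and its spectrum is the discrete set $\{2n\alpha : n=0,1,2,\dots\}$, the same as the spectrum of the scalar harmonic oscillator $-D^2+(\alpha^2x^2-\alpha)I$. Every $\lambda=2n\alpha$ is an eigenvalue of multiplicity $2$; in particular the ground state $\lambda=0$ is two-dimensional. 2. $\bar AC$ is a raising operator: if $\psi$ is smooth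 and $-\psi''+U\psi=z\psi$ with $z\in\mathbb C$, then $\tilde\psi=\bar AC\psi$ satisfies $-\tilde\psi''+U\tilde\psi=(z+2\alpha)\tilde\psi$. For every $n\ge 0$ the eigenspace of $L$ at $\lambda=2n\alpha$ consists exactly of the functions $(\bar AC)^n\psi$, where $\psi$ runs over the smooth solutions of $A\psi=0$. 3. Let $k\ne0$ and $\gamma\neq 0$. The eigenfunctions are expressed through the Weber (parabolic cylinder) functions $D_\nu$ and $D_{\nu-1}$ with $\nu=\dfrac{ik^2}{2\gamma}$, as follows. Let $\tau\in\mathbb C$ with $\tau^2=2i\gamma$. There are polynomials $P_n,Q_n,R_n,S_n\in\mathbb C[x]$ ($n\ge0$), with $P_0=1$, $Q_0=R_0=0$, $S_0=-\frac{\nu\tau}{k}e^{-i\omega_1}$, such that for every $n$ the eigenspace of $L$ at $\lambda=2n\alpha$ consists exactly of the functions $\psi=(\psi_1,\psi_2)^{\top}$ of the form $$\psi_1+i\psi_2=e^{(-\alpha+i\gamma)x^2/2}\,(P_n u+Q_n v),\qquad \psi_1-i\psi_2=e^{(-\alpha-i\gamma)x^2/2}\,(R_n u+S_n v),$$ $$u(x)=c_1D_\nu(\tau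 x)+c_2D_\nu(-\tau x),\qquad v(x)=c_1D_{\nu-1}(\tau x)-c_2D_{\nu-1}(-\tau x),\qquad c_1,c_2\in\mathbb C.$$ -/

import Mathlib

open MeasureTheory
open scoped ContDiff

noncomputable section

namespace MatrixOscillator

/-! ### Unbounded operators in a Hilbert space -/

section Unbounded

variable {H : Type*} [NormedAddCommGroup H] [InnerProductSpace ℂ H]

/-- `z` is in the resolvent set of the unbounded operator `T` if `T - z` maps the domain of `T`
bijectively onto the whole space, with an everywhere defined bounded inverse `R`. -/
def resolventSetOf (T : H →ₗ.[ℂ] H) : Set ℂ :=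
  {z | ∃ R : H →L[ℂ] H,
    (∀ x : T.domain, R (T x - z • (x : H)) = x) ∧
    (∀ y : H, ∃ x : T.domain, (x : H) = R y ∧ T x - z • (x : H) = y)}

/-- The spectrum of an unbounded operator. -/
def spectrumOf (T : H →ₗ.[ℂ] H) : Set ℂ := (resolventSetOf T)ᶜ

/-- The eigenspace `{f ∈ dom T | T f = z f}` (which is zero if `z` is not an eigenvalue). -/
def eigenspaceOf (T : H →ₗ.[ℂ] H) (z : ℂ) : Submodule ℂ H :=
  (LinearMap.ker (T.toFun - z • T.domain.subtype)).map T.domain.subtype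

theorem mem_eigenspaceOf {T : H →ₗ.[ℂ] H} {z : ℂ} {f : H} :
    f ∈ eigenspaceOf T z ↔ ∃ h : f ∈ T.domain, T ⟨f, h⟩ = z • f := by
  simp only [eigenspaceOf, Submodule.mem_map, LinearMap.mem_ker, LinearMap.sub_apply,
    LinearMap.smul_apply, Submodule.subtype_apply, sub_eq_zero]
  constructor
  · rintro ⟨x, hx, rfl⟩
    exact ⟨x.2, hx⟩
  · rintro ⟨h, hf⟩
    exact ⟨⟨f, h⟩, hf, rfl⟩

end Unbounded

/-! ### Matrix Schrödinger operators on the line -/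

/-- The space `ℂ²` of values of the wave functions. -/
abbrev C2 : Type := EuclideanSpace ℂ (Fin 2)

/-- The Hilbert space `L²(ℝ; ℂ²)`. -/
abbrev L2 : Type := Lp C2 2 (volume : Measure ℝ)

/-- The action of a `2 × 2` matrix on `ℂ²`. -/
def act (M : Matrix (Fin 2) (Fin 2) ℂ) (v : C2) : C2 := Matrix.toEuclideanLin M v

/-- The differential expression `- ψ'' + U ψ`. -/
def schrodinger (U : ℝ → Matrix (Fin 2) (Fin 2) ℂ) (ψ : ℝ → C2) : ℝ → C2 :=
  fun x => - deriv (deriv ψ) x + act (U x) (ψ x)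

theorem schrodinger_add (U : ℝ → Matrix (Fin 2) (Fin 2) ℂ) {ψ φ : ℝ → C2}
    (hψ : ContDiff ℝ ∞ ψ) (hφ : ContDiff ℝ ∞ φ) :
    schrodinger U (ψ + φ) = schrodinger U ψ + schrodinger U φ := by
  have h1 : Differentiable ℝ ψ := hψ.differentiable (by simp)
  have h2 : Differentiable ℝ φ := hφ.differentiable (by simp)
  have h3 : Differentiable ℝ (deriv ψ) :=
    ((contDiff_infty_iff_deriv.1 hψ).2).differentiable (by simp)
  have h4 : Differentiable ℝ (deriv φ) :=
    ((contDiff_infty_iff_deriv.1 hφ).2).differentiable (by simp)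
  have h5 : deriv (ψ + φ) = deriv ψ + deriv φ := by
    funext x
    exact deriv_add (h1 x) (h2 x)
  funext x
  have h6 : deriv (deriv ψ + deriv φ) x = deriv (deriv ψ) x + deriv (deriv φ) x :=
    deriv_add (h3 x) (h4 x)
  simp only [schrodinger, Pi.add_apply, h5, h6, act, map_add]
  abel

theorem schrodinger_smul (U : ℝ → Matrix (Fin 2) (Fin 2) ℂ) (c : ℂ) {ψ : ℝ → C2}
    (hψ : ContDiff ℝ ∞ ψ) :
    schrodinger U (c • ψ) = c • schrodinger U ψ := by
  have h1 : Differentiable ℝ ψ := hψ.differentiable (by simp)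
  have h3 : Differentiable ℝ (deriv ψ) :=
    ((contDiff_infty_iff_deriv.1 hψ).2).differentiable (by simp)
  have h5 : deriv (c • ψ) = c • deriv ψ := by
    funext x
    exact deriv_const_smul c (h1 x)
  funext x
  have h6 : deriv (c • deriv ψ) x = c • deriv (deriv ψ) x := deriv_const_smul c (h3 x)
  simp only [schrodinger, Pi.smul_apply, h5, h6, act, map_smul, smul_add, smul_neg]

/-- The graph in `L²(ℝ; ℂ²)` of `- d²/dx² + U` acting on smooth compactly supported functions. -/
def minimalGraph (U : ℝ → Matrix (Fin 2) (Fin 2) ℂ) : Submodule ℂ (L2 × L2) where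
  carrier := {p | ∃ ψ : ℝ → C2, ContDiff ℝ ∞ ψ ∧ HasCompactSupport ψ ∧
    p.1 =ᵐ[volume] ψ ∧ p.2 =ᵐ[volume] schrodinger U ψ}
  add_mem' := by
    rintro p q ⟨ψ, h1, h2, h3, h4⟩ ⟨φ, k1, k2, k3, k4⟩
    refine ⟨ψ + φ, h1.add k1, h2.add k2, ?_, ?_⟩
    · exact (Lp.coeFn_add p.1 q.1).trans (h3.add k3)
    · rw [schrodinger_add U h1 k1]
      exact (Lp.coeFn_add p.2 q.2).trans (h4.add k4)
  zero_mem' := by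
    refine ⟨0, contDiff_const, HasCompactSupport.zero, Lp.coeFn_zero _ _ _, ?_⟩
    have h : schrodinger U 0 = 0 := by
      simpa using schrodinger_smul U 0 (ψ := 0) contDiff_const
    rw [h]
    exact Lp.coeFn_zero _ _ _
  smul_mem' := by
    rintro c p ⟨ψ, h1, h2, h3, h4⟩
    refine ⟨c • ψ, contDiff_const.smul h1, h2.smul_left (f := fun _ => c), ?_, ?_⟩
    · exact (Lp.coeFn_smul c p.1).trans (h3.const_smul c)
    · rw [schrodinger_smul U c h1]
      exact (Lp.coeFn_smul c p.2).trans (h4.const_smul c)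

/-- The operator `- d²/dx² + U` in `L²(ℝ; ℂ²)` with domain `C_c^∞(ℝ; ℂ²)`. -/
def minimalOperator (U : ℝ → Matrix (Fin 2) (Fin 2) ℂ) : L2 →ₗ.[ℂ] L2 :=
  (minimalGraph U).toLinearPMap

/-- The graph of `minimalOperator U` is the intended one. -/
theorem graph_minimalOperator (U : ℝ → Matrix (Fin 2) (Fin 2) ℂ) :
    (minimalOperator U).graph = minimalGraph U := by
  refine Submodule.toLinearPMap_graph_eq _ ?_
  rintro ⟨f, g⟩ ⟨ψ, h1, -, h3, h4⟩ (h0 : f = 0)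
  subst h0
  have hψ : ψ = 0 :=
    (h1.continuous.ae_eq_iff_eq volume continuous_const).1
      (h3.symm.trans (Lp.coeFn_zero _ _ _))
  have h : schrodinger U 0 = 0 := by
    simpa using schrodinger_smul U 0 (ψ := 0) contDiff_const
  rw [hψ, h] at h4
  exact Lp.ext (h4.trans (Lp.coeFn_zero _ _ _).symm)

/-- The Schrödinger operator `L = - d²/dx² + U` in `L²(ℝ; ℂ²)`: the closure of its restriction to
smooth compactly supported functions. -/
def hamiltonian (U : ℝ → Matrix (Fin 2) (Fin 2) ℂ) : L2 →ₗ.[ℂ] L2 :=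
  (minimalOperator U).closure

/-! ### The exotic oscillators -/

/-- The matrix `[[cos χ, sin χ], [sin χ, - cos χ]]`. -/
def reflection (χ : ℝ) : Matrix (Fin 2) (Fin 2) ℂ :=
  !![(Real.cos χ : ℂ), (Real.sin χ : ℂ); (Real.sin χ : ℂ), -(Real.cos χ : ℂ)]

/-- The rotation matrix `C = [[cos ω₀, - sin ω₀], [sin ω₀, cos ω₀]]`. -/
def rotation (ω₀ : ℝ) : Matrix (Fin 2) (Fin 2) ℂ :=
  !![(Real.cos ω₀ : ℂ), -(Real.sin ω₀ : ℂ); (Real.sin ω₀ : ℂ), (Real.cos ω₀ : ℂ)]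

/-- The constant `γ = α tan ω₀`. -/
def gam (α ω₀ : ℝ) : ℝ := α * Real.tan ω₀

/-- The matrix `F = α x I + k [[cos χ₁, sin χ₁], [sin χ₁, - cos χ₁]]`, `χ₁ = γ x² + ω₁`. -/
def darbouxF (α k ω₀ ω₁ : ℝ) (x : ℝ) : Matrix (Fin 2) (Fin 2) ℂ :=
  ((α * x : ℝ) : ℂ) • 1 + (k : ℂ) • reflection (gam α ω₀ * x ^ 2 + ω₁)

/-- The potential `U = (α² x² + k² - α) I + (2 α k x / cos ω₀) [[cos χ, sin χ], [sin χ, - cos χ]]`,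
`χ = γ x² + ω₁ - ω₀`. -/
def potential (α k ω₀ ω₁ : ℝ) (x : ℝ) : Matrix (Fin 2) (Fin 2) ℂ :=
  ((α ^ 2 * x ^ 2 + k ^ 2 - α : ℝ) : ℂ) • 1 +
    ((2 * α * k * x / Real.cos ω₀ : ℝ) : ℂ) • reflection (gam α ω₀ * x ^ 2 + ω₁ - ω₀)

/-- The potential `(α² x² - α) I` of the scalar harmonic oscillator acting on `ℂ²`-valued
functions. -/
def scalarPotential (α : ℝ) (x : ℝ) : Matrix (Fin 2) (Fin 2) ℂ :=
  ((α ^ 2 * x ^ 2 - α : ℝ) : ℂ) • 1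

/-- The Darboux operator `A = d/dx + F`. -/
def darbouxA (α k ω₀ ω₁ : ℝ) (ψ : ℝ → C2) : ℝ → C2 :=
  fun x => deriv ψ x + act (darbouxF α k ω₀ ω₁ x) (ψ x)

/-- The operator `Ā = - d/dx + F`. -/
def darbouxAbar (α k ω₀ ω₁ : ℝ) (ψ : ℝ → C2) : ℝ → C2 :=
  fun x => - deriv ψ x + act (darbouxF α k ω₀ ω₁ x) (ψ x)

/-- The raising operator `Ā C`. -/
def raising (α k ω₀ ω₁ : ℝ) (ψ : ℝ → C2) : ℝ → C2 :=
  darbouxAbar α k ω₀ ω₁ (fun x => act (rotation ω₀) (ψ x))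

/-! ### Weber functions -/

/-- Kummer's confluent hypergeometric function `₁F₁(a; b; z)`, for `b ≠ 0, -1, -2, …`. -/
def kummerM (a b z : ℂ) : ℂ :=
  Complex.Gamma b * Complex.regularizedHGFun {a} {b} z

/-- The Weber (parabolic cylinder) function `D_ν(z)`. The reciprocal `1 / Γ` vanishes at the poles
of `Γ`, in agreement with `Complex.Gamma (-n) = 0`. -/
def weberD (ν z : ℂ) : ℂ :=
  (2 : ℂ) ^ (ν / 2) * Complex.exp (-z ^ 2 / 4) *
    ((Real.sqrt Real.pi : ℂ) / Complex.Gamma ((1 - ν) / 2) * kummerM (-ν / 2) (1 / 2) (z ^ 2 / 2)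
      - (Real.sqrt (2 * Real.pi) : ℂ) * z / Complex.Gamma (-ν / 2) *
        kummerM ((1 - ν) / 2) (3 / 2) (z ^ 2 / 2))

/-- The combination `a D_μ(τ x) + b D_μ(- τ x)`. -/
def weberComb (μ τ a b : ℂ) (x : ℝ) : ℂ :=
  a * weberD μ (τ * x) + b * weberD μ (-(τ * x))

end MatrixOscillator

end

/-!
The operator `L` is treated by a ladder in which the matrix `C` twists the usual factorization. A
computation with the matrices `F`, `F'`, `C` gives `F² - F' = U` and `(F² + F') C = C (U + 2 α)`,
that is

  `L = Ā A`,  `A Ā C = C (L + 2 α)`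

(`schrodinger_eq`, `darbouxA_raising`). With `b = C⁻¹ A` and `b† = Ā C` this reads `L = b† b` and
`b b† = L + 2 α`, so `b†` raises the energy by `2 α`, and from the two-dimensional space of solutions
of `A ψ = 0` it produces a two-dimensional space of formal eigenfunctions at every level `2 α n`.
A solution of the first order system `A ψ = 0` is dominated by `exp (- α x² / 2 + |k| |x|)`; hence
all these eigenfunctions, with their derivatives, have Gaussian decay, and cutting them off shows
that they belong to the domain of the closure (`gaussianDecay_iterate_raising`,
`mem_closure_minimalGraph`).

What remains is that the levels are total in `L²`; self-adjointness, the spectrum and the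
eigenspaces can then be read off from a Hilbert basis of eigenvectors (`spectral_of_levels`).
Totality needs no compactness of the resolvent. A test function `φ` orthogonal to the ground states
is `b† g` for a test function `g`, by integrating a first order system (`exists_raising_eq`), and
orthogonality of `φ` to the levels below `n` becomes orthogonality of `g` to the levels below
`n - 1`. Induction on `n` gives `⟪φ, L φ⟫ ≥ 2 α n ‖φ‖²` for test functions orthogonal to the levels
below `n` (`form_bound`). This bound extends to the domain of the closure, and a vector orthogonal
to all levels is annihilated by it as `n → ∞` (`total_of_form_bound`).

For the Weber form, put `u` and `v` for the combinations of `D_ν(± τ x)` and `D_{ν - 1}(± τ x)`. The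
contiguous relations of Kummer's function give `D_ν' + (z / 2) D_ν = ν D_{ν - 1}` and
`D_{ν - 1}' - (z / 2) D_{ν - 1} = - D_ν` (`hasDerivAt_weberD`, `hasDerivAt_weberD_sub_one`), so `u`
and `v` solve a first order system. In the components `ψ₁ ± i ψ₂`, where the matrices `C` and
`R(θ)` become diagonal and antidiagonal, this system is `A ψ = 0` (`mem_groundStates_iff_weber`), and
the raising operator acts on functions `P u + Q v`, `R u + S v` through the polynomials `P`, `Q`,
`R`, `S` (`WeberCoeff.raise`).
-/

noncomputable section

namespace MatrixOscillator

/-! ### Operators with a Hilbert basis of eigenvectors -/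

section Diagonal

variable {H : Type*} [NormedAddCommGroup H] [InnerProductSpace ℂ H]

/-- A closed symmetric operator with a Hilbert basis of eigenvectors is the maximal operator acting
diagonally in this basis. -/
theorem mem_graph_iff_of_hilbertBasis {T : H →ₗ.[ℂ] H} (hc : T.IsClosed)
    (hs : ∀ p ∈ T.graph, ∀ q ∈ T.graph, inner ℂ p.2 q.1 = inner ℂ p.1 q.2)
    {ι : Type*} (e : HilbertBasis ι ℂ H) (lam : ι → ℝ)
    (he : ∀ i, (e i, (lam i : ℂ) • e i) ∈ T.graph) (x y : H) :
    (x, y) ∈ T.graph ↔ ∀ i, inner ℂ (e i) y = lam i * inner ℂ (e i) x := by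
  constructor
  · intro h i
    have := hs _ (he i) _ h
    simpa [inner_smul_left] using this.symm
  · intro h
    have hx : HasSum (fun i => inner ℂ (e i) x • e i) x := by
      simpa only [e.repr_apply_apply] using e.hasSum_repr x
    have hy : HasSum (fun i => inner ℂ (e i) y • e i) y := by
      simpa only [e.repr_apply_apply] using e.hasSum_repr y
    have hp : HasSum (fun i => inner ℂ (e i) x • (e i, (lam i : ℂ) • e i)) (x, y) := by
      convert hx.prodMk hy using 2 with i
      rw [Prod.smul_mk, h, smul_smul, mul_comm]
    exact hc.mem_of_tendsto hp (.of_forall fun s =>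
      Submodule.sum_mem _ fun i _ => T.graph.smul_mem _ (he i))

/-- The adjoint of a closed symmetric operator with a Hilbert basis of eigenvectors acts diagonally
in this basis as well, hence is no larger than the operator. -/
theorem isSelfAdjoint_of_hilbertBasis [CompleteSpace H] {T : H →ₗ.[ℂ] H} (hc : T.IsClosed)
    (hd : Dense (T.domain : Set H))
    (hs : ∀ p ∈ T.graph, ∀ q ∈ T.graph, inner ℂ p.2 q.1 = inner ℂ p.1 q.2)
    {ι : Type*} (e : HilbertBasis ι ℂ H) (lam : ι → ℝ)
    (he : ∀ i, (e i, (lam i : ℂ) • e i) ∈ T.graph) : IsSelfAdjoint T := by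
  have hf : T.IsFormalAdjoint T := fun x y => hs _ (T.mem_graph x) _ (T.mem_graph y)
  refine le_antisymm (LinearPMap.le_of_le_graph ?_) (hf.le_adjoint hd)
  rintro ⟨x, y⟩ hxy
  obtain ⟨x', rfl, rfl⟩ := (LinearPMap.mem_graph_iff _).1 hxy
  refine (mem_graph_iff_of_hilbertBasis hc hs e lam he _ _).2 fun i => ?_
  obtain ⟨v, hv, hv'⟩ := (LinearPMap.mem_graph_iff _).1 (he i)
  have := (LinearPMap.adjoint_isFormalAdjoint hd).symm v x'
  rw [hv', hv, inner_smul_left, Complex.conj_ofReal] at this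
  exact this.symm

theorem memℓp_two_of_le {ι : Type*} {f g : ι → ℂ} (hg : Memℓp g 2) (C : ℝ)
    (h : ∀ i, ‖f i‖ ≤ C * ‖g i‖) : Memℓp f 2 := by
  have hg' := hg.summable (by norm_num)
  refine memℓp_gen ?_
  simp only [ENNReal.toReal_ofNat, Real.rpow_ofNat] at hg' ⊢
  refine Summable.of_nonneg_of_le (fun i => by positivity) (fun i => ?_) (hg'.mul_left (C ^ 2))
  rw [← mul_pow]
  exact pow_le_pow_left₀ (norm_nonneg _) (h i) 2

/-- The resolvent is the diagonal operator with entries `1 / (lam i - z)`. -/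
theorem mem_resolventSetOf_of_hilbertBasis {T : H →ₗ.[ℂ] H} (hc : T.IsClosed)
    (hs : ∀ p ∈ T.graph, ∀ q ∈ T.graph, inner ℂ p.2 q.1 = inner ℂ p.1 q.2)
    {ι : Type*} (e : HilbertBasis ι ℂ H) (lam : ι → ℝ)
    (he : ∀ i, (e i, (lam i : ℂ) • e i) ∈ T.graph) {z : ℂ} {δ : ℝ} (hδ : 0 < δ)
    (hz : ∀ i, δ ≤ ‖(lam i : ℂ) - z‖) : z ∈ resolventSetOf T := by
  have hz0 : ∀ i, (lam i : ℂ) - z ≠ 0 := fun i h => by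
    have := hz i
    rw [h, norm_zero] at this
    exact absurd this (not_le.2 hδ)
  have hb : ∀ i (w : ℂ), ‖((lam i : ℂ) - z)⁻¹ * w‖ ≤ δ⁻¹ * ‖w‖ := fun i w => by
    rw [norm_mul, norm_inv]
    gcongr
    exact hz i
  let m (f : lp (fun _ : ι => ℂ) 2) : lp (fun _ : ι => ℂ) 2 :=
    ⟨fun i => ((lam i : ℂ) - z)⁻¹ * f i, memℓp_two_of_le f.2 δ⁻¹ fun i => hb i _⟩
  let R₀ : lp (fun _ : ι => ℂ) 2 →ₗ[ℂ] lp (fun _ : ι => ℂ) 2 :=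
    { toFun := m
      map_add' := fun f g => by
        ext i
        exact mul_add _ _ _
      map_smul' := fun c f => by
        ext i
        exact mul_left_comm _ _ _ }
  have hR₀ : ∀ f, ‖R₀ f‖ ≤ δ⁻¹ * ‖f‖ := fun f => by
    rw [← sq_le_sq₀ (norm_nonneg _) (by positivity), mul_pow]
    have h1 := lp.norm_rpow_eq_tsum (p := 2) (by norm_num) (R₀ f)
    have h2 := lp.norm_rpow_eq_tsum (p := 2) (by norm_num) f
    have h3 := (lp.memℓp f).summable (p := 2) (by norm_num)
    have h4 := (lp.memℓp (R₀ f)).summable (p := 2) (by norm_num)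
    simp only [ENNReal.toReal_ofNat, Real.rpow_ofNat] at h1 h2 h3 h4
    rw [h1, h2, ← tsum_mul_left]
    refine h4.tsum_le_tsum (fun i => ?_) (h3.mul_left _)
    rw [← mul_pow]
    exact pow_le_pow_left₀ (norm_nonneg _) (hb i _) 2
  let R : H →L[ℂ] H := LinearMap.mkContinuous
    (e.repr.symm.toLinearEquiv.toLinearMap ∘ₗ R₀ ∘ₗ e.repr.toLinearEquiv.toLinearMap) δ⁻¹
    fun x => by simpa using hR₀ (e.repr x)
  have hR : ∀ i y, inner ℂ (e i) (R y) = ((lam i : ℂ) - z)⁻¹ * inner ℂ (e i) y := fun i y => by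
    rw [← e.repr_apply_apply, ← e.repr_apply_apply]
    simp [R, R₀, m]
  have key : ∀ x y, (x, y) ∈ T.graph ↔ ∀ i, inner ℂ (e i) y = lam i * inner ℂ (e i) x :=
    mem_graph_iff_of_hilbertBasis hc hs e lam he
  have hext : ∀ x y : H, (∀ i, inner ℂ (e i) x = inner ℂ (e i) y) → x = y := fun x y h => by
    apply e.repr.injective
    ext i
    rw [e.repr_apply_apply, e.repr_apply_apply, h i]
  refine ⟨R, fun x => hext _ _ fun i => ?_, fun y => ?_⟩
  · rw [hR, inner_sub_right, inner_smul_right, (key _ _).1 (T.mem_graph x) i, ← sub_mul,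
      inv_mul_cancel_left₀ (hz0 i)]
  · have : (R y, y + z • R y) ∈ T.graph := (key _ _).2 fun i => by
      rw [inner_add_right, inner_smul_right, hR]
      have := hz0 i
      field_simp
      ring
    obtain ⟨x, hx, hx'⟩ := (LinearPMap.mem_graph_iff _).1 this
    exact ⟨x, hx, by rw [hx', hx]; simp⟩

/-- The set of eigenvalues is assumed closed; in general the spectrum is its closure. -/
theorem spectrumOf_eq_of_hilbertBasis {T : H →ₗ.[ℂ] H} (hc : T.IsClosed)
    (hs : ∀ p ∈ T.graph, ∀ q ∈ T.graph, inner ℂ p.2 q.1 = inner ℂ p.1 q.2)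
    {ι : Type*} (e : HilbertBasis ι ℂ H) (lam : ι → ℝ)
    (he : ∀ i, (e i, (lam i : ℂ) • e i) ∈ T.graph)
    (hcl : IsClosed (Set.range fun i => (lam i : ℂ))) :
    spectrumOf T = Set.range fun i => (lam i : ℂ) := by
  ext z
  constructor
  · intro hz
    by_contra hz'
    obtain ⟨δ, hδ, hball⟩ := Metric.isOpen_iff.1 hcl.isOpen_compl z hz'
    refine hz (mem_resolventSetOf_of_hilbertBasis hc hs e lam he hδ fun i => ?_)
    by_contra! hi
    exact hball (Metric.mem_ball.2 (by rwa [dist_eq_norm])) ⟨i, rfl⟩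
  · rintro ⟨i, rfl⟩ ⟨R, hR, -⟩
    obtain ⟨v, hv, hv'⟩ := (LinearPMap.mem_graph_iff _).1 (he i)
    have h := hR v
    rw [hv', hv] at h
    simp only [sub_self, map_zero] at h
    exact e.orthonormal.ne_zero i h.symm

theorem mem_eigenspaceOf_iff_graph {T : H →ₗ.[ℂ] H} {z : ℂ} {f : H} :
    f ∈ eigenspaceOf T z ↔ (f, z • f) ∈ T.graph := by
  rw [mem_eigenspaceOf, LinearPMap.mem_graph_iff]
  constructor
  · rintro ⟨h, hf⟩
    exact ⟨⟨f, h⟩, rfl, hf⟩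
  · rintro ⟨⟨y, hy⟩, rfl, hf⟩
    exact ⟨hy, hf⟩

end Diagonal

/-! ### Equidistant levels -/

section Levels

variable {H : Type*} [NormedAddCommGroup H] [InnerProductSpace ℂ H]

/-- The Hilbert basis obtained from a total sequence of two-dimensional levels of a symmetric
operator. -/
theorem exists_hilbertBasis_of_levels [CompleteSpace H] {T : H →ₗ.[ℂ] H}
    (hs : ∀ p ∈ T.graph, ∀ q ∈ T.graph, inner ℂ p.2 q.1 = inner ℂ p.1 q.2)
    {c : ℝ} (hc : 0 < c) (V : ℕ → Submodule ℂ H) (hV : ∀ n, Module.finrank ℂ (V n) = 2)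
    (hVT : ∀ n, ∀ v ∈ V n, (v, ((c * n : ℝ) : ℂ) • v) ∈ T.graph)
    (htot : (⨆ n, V n).topologicalClosure = ⊤) :
    ∃ e : HilbertBasis (Σ _ : ℕ, Fin 2) ℂ H, ∀ i, e i ∈ V i.1 := by
  have hfd : ∀ n, FiniteDimensional ℂ (V n) := fun n =>
    FiniteDimensional.of_finrank_pos (by rw [hV]; norm_num)
  have horth : OrthogonalFamily ℂ (fun n => V n) fun n => (V n).subtypeₗᵢ := by
    intro m n hmn v w
    have h := hs _ (hVT m v v.2) _ (hVT n w w.2)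
    simp only [inner_smul_left, inner_smul_right, Complex.conj_ofReal] at h
    have h' : ((c * m : ℝ) : ℂ) - ((c * n : ℝ) : ℂ) ≠ 0 := by
      rw [← Complex.ofReal_sub, ← mul_sub, Complex.ofReal_ne_zero]
      exact mul_ne_zero hc.ne' (sub_ne_zero.2 (Nat.cast_injective.ne hmn))
    have h'' := sub_eq_zero.2 h
    rw [← sub_mul] at h''
    exact (mul_eq_zero.1 h'').resolve_left h'
  let b : ∀ n, OrthonormalBasis (Fin 2) ℂ (V n) := fun n =>
    (stdOrthonormalBasis ℂ (V n)).reindex (finCongr (hV n))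
  have hon : Orthonormal ℂ fun i : (Σ _ : ℕ, Fin 2) => ((b i.1 i.2 : V i.1) : H) :=
    horth.orthonormal_sigma_orthonormal fun n => (b n).orthonormal
  have hspan : ∀ n, V n = Submodule.span ℂ (Set.range fun j : Fin 2 => ((b n j : V n) : H)) := by
    intro n
    have h := congrArg (Submodule.map (V n).subtype) (b n).toBasis.span_eq
    rw [Submodule.map_span, Submodule.map_top, Submodule.range_subtype, ← Set.range_comp] at h
    refine h.symm.trans ?_
    congr 2
  have hsp : ⊤ ≤ (Submodule.span ℂ (Set.range
      fun i : (Σ _ : ℕ, Fin 2) => ((b i.1 i.2 : V i.1) : H))).topologicalClosure := by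
    rw [← htot]
    refine Submodule.topologicalClosure_mono (iSup_le fun n => ?_)
    rw [hspan n, Submodule.span_le]
    rintro _ ⟨j, rfl⟩
    exact Submodule.subset_span ⟨⟨n, j⟩, rfl⟩
  refine ⟨HilbertBasis.mk hon hsp, fun i => ?_⟩
  rw [HilbertBasis.coe_mk]
  exact (b i.1 i.2).2

theorem isClosed_range_mul_natCast {c : ℝ} (hc : 0 < c) :
    IsClosed (Set.range fun n : ℕ => ((c * n : ℝ) : ℂ)) := by
  have h1 : Topology.IsClosedEmbedding (fun n : ℕ => ((c * n : ℝ) : ℂ)) :=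
    Complex.isometry_ofReal.isClosedEmbedding.comp
      ((Homeomorph.mulLeft₀ c hc.ne').isClosedEmbedding.comp Nat.isClosedEmbedding_coe_real)
  exact h1.isClosed_range

/-- A closed symmetric operator with a total sequence of two-dimensional levels `0, c, 2 c, …` is
self-adjoint, and its spectrum and eigenspaces are the evident ones. -/
theorem spectral_of_levels [CompleteSpace H] {T : H →ₗ.[ℂ] H} (hcl : T.IsClosed)
    (hd : Dense (T.domain : Set H))
    (hs : ∀ p ∈ T.graph, ∀ q ∈ T.graph, inner ℂ p.2 q.1 = inner ℂ p.1 q.2)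
    {c : ℝ} (hc : 0 < c) (V : ℕ → Submodule ℂ H) (hV : ∀ n, Module.finrank ℂ (V n) = 2)
    (hVT : ∀ n, ∀ v ∈ V n, (v, ((c * n : ℝ) : ℂ) • v) ∈ T.graph)
    (htot : (⨆ n, V n).topologicalClosure = ⊤) :
    IsSelfAdjoint T ∧ spectrumOf T = Set.range (fun n : ℕ => ((c * n : ℝ) : ℂ)) ∧
      ∀ n : ℕ, eigenspaceOf T ((c * n : ℝ) : ℂ) = V n := by
  obtain ⟨e, heV⟩ := exists_hilbertBasis_of_levels hs hc V hV hVT htot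
  have he : ∀ i, (e i, ((c * i.1 : ℝ) : ℂ) • e i) ∈ T.graph := fun i => hVT _ _ (heV i)
  have hrange : (Set.range fun i : (Σ _ : ℕ, Fin 2) => ((c * i.1 : ℝ) : ℂ)) =
      Set.range fun n : ℕ => ((c * n : ℝ) : ℂ) := by
    ext z
    constructor
    · rintro ⟨i, rfl⟩
      exact ⟨i.1, rfl⟩
    · rintro ⟨n, rfl⟩
      exact ⟨⟨n, 0⟩, rfl⟩
  refine ⟨isSelfAdjoint_of_hilbertBasis hcl hd hs e (fun i => c * i.1) he, ?_, fun n => ?_⟩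
  · rw [spectrumOf_eq_of_hilbertBasis hcl hs e (fun i => c * i.1) he, hrange]
    rw [hrange]
    exact isClosed_range_mul_natCast hc
  · refine le_antisymm (fun f hf => ?_) fun f hf => mem_eigenspaceOf_iff_graph.2 (hVT n f hf)
    have h := (mem_graph_iff_of_hilbertBasis hcl hs e (fun i => c * i.1) he _ _).1
      (mem_eigenspaceOf_iff_graph.1 hf)
    have h0 : ∀ i : (Σ _ : ℕ, Fin 2), i.1 ≠ n → inner ℂ (e i) f = 0 := fun i hi => by
      have h1 := sub_eq_zero.2 (h i)
      rw [inner_smul_right, ← sub_mul] at h1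
      refine (mul_eq_zero.1 h1).resolve_left (?_ : _ ≠ _)
      rw [← Complex.ofReal_sub, ← mul_sub, Complex.ofReal_ne_zero]
      exact mul_ne_zero hc.ne' (sub_ne_zero.2 (Nat.cast_injective.ne hi.symm))
    have hsum : HasSum (fun i => inner ℂ (e i) f • e i) f := by
      simpa only [e.repr_apply_apply] using e.hasSum_repr f
    have hfd : FiniteDimensional ℂ (V n) :=
      FiniteDimensional.of_finrank_pos (by rw [hV]; norm_num)
    refine (V n).closed_of_finiteDimensional.mem_of_tendsto hsum (.of_forall fun s =>
      Submodule.sum_mem _ fun i _ => ?_)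
    by_cases hi : i.1 = n
    · exact (V n).smul_mem _ (hi ▸ heV i)
    · rw [h0 i hi, zero_smul]
      exact (V n).zero_mem

end Levels

/-! ### Totality of the levels from a form bound on a core -/

section Totality

variable {H : Type*} [NormedAddCommGroup H] [InnerProductSpace ℂ H]

/-- Elements of a densely defined graph whose first components represent a given
finite-dimensional space. -/
theorem exists_linear_corrector {G : Submodule ℂ (H × H)}
    (hd : DenseRange fun p : G => (p : H × H).1) (W : Submodule ℂ H) [FiniteDimensional ℂ W] :
    ∃ σ : W →ₗ[ℂ] G, ∀ w, W.orthogonalProjectionOnto ((σ w : H × H).1) = w := by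
  let q : G →ₗ[ℂ] W :=
    (W.orthogonalProjectionOnto : H →ₗ[ℂ] W) ∘ₗ LinearMap.fst ℂ H H ∘ₗ G.subtype
  have hq : DenseRange q :=
    DenseRange.comp (g := W.orthogonalProjectionOnto) (f := fun p : G => (p : H × H).1)
      (fun w => subset_closure ⟨w, by simp⟩) hd W.orthogonalProjectionOnto.continuous
  have hq' : LinearMap.range q = ⊤ := by
    rw [← (LinearMap.range q).closed_of_finiteDimensional.submodule_topologicalClosure_eq]
    exact (Submodule.dense_iff_topologicalClosure_eq_top (s := LinearMap.range q)).1 hq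
  obtain ⟨σ, hσ⟩ := q.exists_rightInverse_of_surjective hq'
  exact ⟨σ, fun w => LinearMap.congr_fun hσ w⟩

/-- A lower bound of the quadratic form on the elements of a graph orthogonal to a
finite-dimensional space extends to the closure: an approximating sequence is made orthogonal to
that space by correctors from the graph. -/
theorem form_bound_of_mem_closure {G : Submodule ℂ (H × H)}
    (hd : DenseRange fun p : G => (p : H × H).1) (W : Submodule ℂ H) [FiniteDimensional ℂ W]
    {m : ℝ} (hm : ∀ p ∈ G, p.1 ∈ Wᗮ → m * ‖p.1‖ ^ 2 ≤ (inner ℂ p.1 p.2).re)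
    {p : H × H} (hp : p ∈ G.topologicalClosure) (hpW : p.1 ∈ Wᗮ) :
    m * ‖p.1‖ ^ 2 ≤ (inner ℂ p.1 p.2).re := by
  obtain ⟨σ, hσ⟩ := exists_linear_corrector hd W
  let Φ : H × H → H × H := fun r => r - (σ (W.orthogonalProjectionOnto r.1) : H × H)
  have hΦ : Continuous Φ := by
    have : Continuous fun w : W => (σ w : H × H) :=
      (G.subtype ∘ₗ σ).continuous_of_finiteDimensional
    fun_prop
  have hfix : Φ p = p := by
    simp [Φ, (Submodule.orthogonalProjectionOnto_eq_zero_iff).2 hpW]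
  have hmaps : Set.MapsTo Φ G {r | m * ‖r.1‖ ^ 2 ≤ (inner ℂ r.1 r.2).re} := by
    intro r hr
    refine hm _ (G.sub_mem hr (σ _).2) ?_
    rw [← Submodule.orthogonalProjectionOnto_eq_zero_iff]
    simp [Φ, hσ]
  have hclosed : IsClosed {r : H × H | m * ‖r.1‖ ^ 2 ≤ (inner ℂ r.1 r.2).re} :=
    isClosed_le (by fun_prop) (Complex.continuous_re.comp (by fun_prop))
  have := map_mem_closure hΦ hp hmaps
  rwa [hfix, hclosed.closure_eq] at this

/-- Eigenspaces of a symmetric operator for the eigenvalues `c n` are total as soon as the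
quadratic form is at least `c n` on the part of a core orthogonal to the first `n` of them. -/
theorem total_of_form_bound [CompleteSpace H] {T : H →ₗ.[ℂ] H} {G : Submodule ℂ (H × H)}
    (hG : T.graph = G.topologicalClosure)
    (hd : DenseRange fun p : G => (p : H × H).1)
    (hs : ∀ p ∈ T.graph, ∀ q ∈ T.graph, inner ℂ p.2 q.1 = inner ℂ p.1 q.2)
    {c : ℝ} (hc : 0 < c) (V : ℕ → Submodule ℂ H) [∀ n, FiniteDimensional ℂ (V n)]
    (hVT : ∀ n, ∀ v ∈ V n, (v, ((c * n : ℝ) : ℂ) • v) ∈ T.graph)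
    (hform : ∀ n : ℕ, ∀ p ∈ G, (∀ j < n, ∀ v ∈ V j, inner ℂ v p.1 = 0) →
      c * n * ‖p.1‖ ^ 2 ≤ (inner ℂ p.1 p.2).re) :
    (⨆ n, V n).topologicalClosure = ⊤ := by
  rw [Submodule.topologicalClosure_eq_top_iff, Submodule.eq_bot_iff]
  intro f hf
  have hbound : ∀ n : ℕ, ∀ (W : Submodule ℂ H), FiniteDimensional ℂ W → (∀ j < n, V j ≤ W) →
      ∀ p ∈ T.graph, p.1 ∈ Wᗮ → c * n * ‖p.1‖ ^ 2 ≤ (inner ℂ p.1 p.2).re := by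
    intro n W hW hVW p hp hpW
    rw [hG] at hp
    exact form_bound_of_mem_closure hd W (fun r hr hrW => hform n r hr fun j hj v hv =>
      (Submodule.mem_orthogonal W r.1).1 hrW v (hVW j hj hv)) hp hpW
  -- with `w` the projection of `p.1` to the first `n` levels, `⟪f, p.1⟫ = ⟪f, p.1 - w⟫` and
  -- `c n ‖p.1 - w‖² ≤ ⟪p.1, p.2⟫`, where the right side does not depend on `n`
  have key : ∀ p ∈ G, inner ℂ f p.1 = 0 := by
    intro p hp
    have hpT : p ∈ T.graph := by
      rw [hG]
      exact G.le_topologicalClosure hp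
    have hest : ∀ n : ℕ, c * n * ‖(inner ℂ f p.1 : ℂ)‖ ^ 2 ≤ ‖f‖ ^ 2 * (inner ℂ p.1 p.2).re := by
      intro n
      let W : Submodule ℂ H := ⨆ j ∈ Finset.range n, V j
      have hWfd : FiniteDimensional ℂ W := by
        have := Submodule.finiteDimensional_finset_sup (Finset.range n) V
        rwa [Finset.sup_eq_iSup] at this
      have hVW : ∀ j < n, V j ≤ W := fun j hj =>
        le_iSup₂_of_le (f := fun j (_ : j ∈ Finset.range n) => V j) j (Finset.mem_range.2 hj) le_rfl
      have hWT : ∀ w ∈ W, ∃ w' ∈ W, (w, w') ∈ T.graph := by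
        have : W ≤ (T.graph ⊓ Submodule.comap (LinearMap.snd ℂ H H) W).map
            (LinearMap.fst ℂ H H) :=
          iSup₂_le fun j hj v hv => ⟨(v, ((c * j : ℝ) : ℂ) • v),
            ⟨hVT j v hv, W.smul_mem _ (hVW j (Finset.mem_range.1 hj) hv)⟩, rfl⟩
        intro w hw
        obtain ⟨⟨w₁, w'⟩, ⟨h1, h2⟩, rfl⟩ := this hw
        exact ⟨w', h2, h1⟩
      let w : H := W.starProjection p.1
      have hwW : w ∈ W := W.starProjection_apply_mem _
      obtain ⟨w', hw'W, hw'⟩ := hWT w hwW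
      have hr : p.1 - w ∈ Wᗮ := W.sub_starProjection_mem_orthogonal _
      have hrT : p - (w, w') ∈ T.graph := T.graph.sub_mem hpT hw'
      have h1 := hbound n W hWfd hVW _ hrT hr
      have h0 : 0 ≤ (inner ℂ w w').re := by
        have := hbound 0 ⊥ inferInstance (by simp) _ hw' (by simp)
        simpa using this
      -- `⟪p.1 - w, p.2 - w'⟫ = ⟪p.1, p.2⟫ - ⟪w, w'⟫`, since `T` is symmetric and `T W ⊆ W`
      have h2 : inner ℂ (p.1 - w) w' = 0 := Submodule.inner_left_of_mem_orthogonal hw'W hr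
      have h3 : inner ℂ w p.2 = inner ℂ w w' := by
        have h4 : inner ℂ w' (p.1 - w) = 0 := Submodule.inner_right_of_mem_orthogonal hw'W hr
        rw [inner_sub_right, sub_eq_zero] at h4
        rw [← hs _ hw' _ hpT, h4, hs _ hw' _ hw']
      have h5 : (inner ℂ (p.1 - w) (p.2 - w')).re ≤ (inner ℂ p.1 p.2).re := by
        rw [inner_sub_right, h2, sub_zero, inner_sub_left, h3, Complex.sub_re]
        linarith
      have h6 : inner ℂ f p.1 = inner ℂ f (p.1 - w) := by
        have : inner ℂ f w = 0 := by
          refine Submodule.inner_left_of_mem_orthogonal (K := ⨆ n, V n) ?_ hf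
          exact iSup₂_le (fun j _ => le_iSup V j) hwW
        rw [inner_sub_right, this, sub_zero]
      have h7 : ‖(inner ℂ f p.1 : ℂ)‖ ^ 2 ≤ ‖f‖ ^ 2 * ‖p.1 - w‖ ^ 2 := by
        rw [h6, ← mul_pow]
        exact pow_le_pow_left₀ (norm_nonneg _) (norm_inner_le_norm _ _) 2
      have h8 : c * n * ‖p.1 - w‖ ^ 2 ≤ (inner ℂ p.1 p.2).re := h1.trans h5
      calc c * n * ‖(inner ℂ f p.1 : ℂ)‖ ^ 2 ≤ c * n * (‖f‖ ^ 2 * ‖p.1 - w‖ ^ 2) := by gcongr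
        _ = ‖f‖ ^ 2 * (c * n * ‖p.1 - w‖ ^ 2) := by ring
        _ ≤ ‖f‖ ^ 2 * (inner ℂ p.1 p.2).re := by gcongr
    by_contra hne
    have hpos : 0 < c * ‖(inner ℂ f p.1 : ℂ)‖ ^ 2 := by
      have := norm_pos_iff.2 hne
      positivity
    obtain ⟨n, hn⟩ := exists_nat_gt ((‖f‖ ^ 2 * (inner ℂ p.1 p.2).re) /
      (c * ‖(inner ℂ f p.1 : ℂ)‖ ^ 2))
    rw [div_lt_iff₀ hpos] at hn
    have := hest n
    linarith
  have : (fun x : H => inner ℂ f x) = fun _ => (0 : ℂ) :=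
    hd.equalizer (by fun_prop) (by fun_prop) (funext fun p => key _ p.2)
  exact inner_self_eq_zero.1 (congrFun this f)

end Totality

/-! ### Linear differential equations -/

section LinearODE

variable {E : Type*} [NormedAddCommGroup E] [NormedSpace ℝ E]

/-- Global existence for linear differential equations. The Picard map is a contraction for the
supremum norm with weight `1 / cosh W`, where `W` is twice a primitive of `‖G‖ + ‖f‖ + 1`. -/
theorem exists_hasDerivAt_linear [CompleteSpace E] {G : ℝ → E →L[ℝ] E} {f : ℝ → E}
    (hG : Continuous G) (hf : Continuous f) (x₀ : ℝ) (y₀ : E) :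
    ∃ y : ℝ → E, y x₀ = y₀ ∧ ∀ x, HasDerivAt y (G x (y x) + f x) x := by
  let m : ℝ → ℝ := fun x => ‖G x‖ + ‖f x‖ + 1
  have hm : Continuous m := by fun_prop
  let W : ℝ → ℝ := fun x => 2 * ∫ t in x₀..x, m t
  have hW : ∀ x, HasDerivAt W (2 * m x) x := fun x =>
    (intervalIntegral.integral_hasDerivAt_right (hm.intervalIntegrable _ _)
      (hm.stronglyMeasurableAtFilter _ _) hm.continuousAt).const_mul 2
  have hWc : Continuous W := continuous_iff_continuousAt.2 fun x => (hW x).continuousAt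
  let w : ℝ → ℝ := fun x => Real.cosh (W x)
  have hw : Continuous w := Real.continuous_cosh.comp hWc
  have hw1 : ∀ x, 1 ≤ w x := fun x => Real.one_le_cosh _
  have hw0 : ∀ x, 0 < w x := fun x => zero_lt_one.trans_le (hw1 x)
  have hint : ∀ x, |∫ t in x₀..x, m t * w t| ≤ w x / 2 := by
    intro x
    have h1 : ∀ t ∈ Set.uIcc x₀ x, HasDerivAt (fun t => Real.sinh (W t) / 2) (m t * w t) t := by
      intro t _
      convert! ((hW t).sinh).div_const 2 using 1
      simp only [w]
      ring
    rw [intervalIntegral.integral_eq_sub_of_hasDerivAt h1 ((hm.mul hw).intervalIntegrable _ _)]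
    have h2 : W x₀ = 0 := by simp [W]
    rw [h2, Real.sinh_zero, zero_div, sub_zero, abs_div, abs_two]
    gcongr
    rw [abs_le]
    have h3 := Real.cosh_sq (W x)
    constructor <;> nlinarith [hw0 x]
  -- a bound of the integrand by `K m w` is inherited by the weighted integral
  have hest : ∀ (g : ℝ → E) (K : ℝ), 0 ≤ K → (∀ t, ‖g t‖ ≤ K * (m t * w t)) → ∀ x,
      ‖(w x)⁻¹ • ∫ t in x₀..x, g t‖ ≤ K / 2 := by
    intro g K hK hg x
    have h1 : ‖∫ t in x₀..x, g t‖ ≤ |∫ t in x₀..x, K * (m t * w t)| :=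
      intervalIntegral.norm_integral_le_abs_of_norm_le (.of_forall fun t => hg t)
        (((hm.mul hw).const_mul K).intervalIntegrable _ _)
    rw [intervalIntegral.integral_const_mul, abs_mul, abs_of_nonneg hK] at h1
    rw [norm_smul, norm_inv, Real.norm_of_nonneg (hw0 x).le, inv_mul_le_iff₀ (hw0 x)]
    calc _ ≤ K * (w x / 2) := h1.trans (by gcongr; exact hint x)
      _ = w x * (K / 2) := by ring
  let g : (BoundedContinuousFunction ℝ E) → ℝ → E := fun z t => G t (w t • z t) + f t
  have hgc : ∀ z, Continuous (g z) := fun z => by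
    have : Continuous fun t => w t • z t := hw.smul z.continuous
    exact (hG.clm_apply this).add hf
  have hIc : ∀ z, Continuous fun x => ∫ t in x₀..x, g z t := fun z =>
    intervalIntegral.continuous_primitive (fun a b => (hgc z).intervalIntegrable a b) x₀
  have hgb : ∀ z t, ‖g z t‖ ≤ (‖z‖ + 1) * (m t * w t) := by
    intro z t
    have h1 : ‖G t (w t • z t)‖ ≤ ‖G t‖ * (w t * ‖z‖) := by
      refine (G t).le_opNorm_of_le ?_
      rw [norm_smul, Real.norm_of_nonneg (hw0 t).le]
      exact mul_le_mul_of_nonneg_left (z.norm_coe_le_norm t) (hw0 t).le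
    have h2 : ‖f t‖ ≤ ‖f t‖ * w t := le_mul_of_one_le_right (norm_nonneg _) (hw1 t)
    have h3 := norm_add_le (G t (w t • z t)) (f t)
    have h4 := norm_nonneg z
    have h5 := hw0 t
    have h6 : 0 ≤ ‖G t‖ := norm_nonneg _
    have h7 : 0 ≤ ‖f t‖ := norm_nonneg _
    calc ‖g z t‖ ≤ ‖G t‖ * (w t * ‖z‖) + ‖f t‖ * w t := h3.trans (add_le_add h1 h2)
      _ ≤ (‖G t‖ * (w t * ‖z‖) + ‖f t‖ * w t) + (‖G t‖ * w t + ‖f t‖ * (w t * ‖z‖)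
          + w t * (‖z‖ + 1)) := le_add_of_nonneg_right (by positivity)
      _ = _ := by simp only [m]; ring
  let Φ : (BoundedContinuousFunction ℝ E) → (BoundedContinuousFunction ℝ E) := fun z =>
    BoundedContinuousFunction.ofNormedAddCommGroup
      (fun x => (w x)⁻¹ • (y₀ + ∫ t in x₀..x, g z t))
      ((hw.inv₀ fun x => (hw0 x).ne').smul (continuous_const.add (hIc z)))
      (‖y₀‖ + (‖z‖ + 1) / 2) fun x => by
        rw [smul_add]
        refine (norm_add_le _ _).trans (add_le_add ?_ (hest _ _ (by positivity) (hgb z) x))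
        rw [norm_smul, norm_inv, Real.norm_of_nonneg (hw0 x).le]
        exact mul_le_of_le_one_left (norm_nonneg _) (inv_le_one_of_one_le₀ (hw1 x))
  have hΦ : ∀ z x, Φ z x = (w x)⁻¹ • (y₀ + ∫ t in x₀..x, g z t) := fun _ _ => rfl
  have hcontr : ContractingWith (1 / 2) Φ := by
    refine ⟨by rw [← NNReal.coe_lt_coe]; norm_num, LipschitzWith.of_dist_le_mul fun z z' => ?_⟩
    rw [dist_eq_norm, dist_eq_norm, BoundedContinuousFunction.norm_le (by positivity)]
    intro x
    rw [BoundedContinuousFunction.sub_apply, hΦ, hΦ, ← smul_sub, add_sub_add_left_eq_sub,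
      ← intervalIntegral.integral_sub ((hgc z).intervalIntegrable _ _)
        ((hgc z').intervalIntegrable _ _)]
    refine (hest _ ‖z - z'‖ (norm_nonneg _) (fun t => ?_) x).trans_eq (by push_cast; ring)
    have h1 : g z t - g z' t = G t (w t • (z - z') t) := by
      simp only [g, add_sub_add_right_eq_sub, ← map_sub, ← smul_sub,
        BoundedContinuousFunction.sub_apply]
    rw [h1]
    have h2 : ‖G t (w t • (z - z') t)‖ ≤ ‖G t‖ * (w t * ‖z - z'‖) := by
      refine (G t).le_opNorm_of_le ?_
      rw [norm_smul, Real.norm_of_nonneg (hw0 t).le]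
      exact mul_le_mul_of_nonneg_left ((z - z').norm_coe_le_norm t) (hw0 t).le
    have h3 : ‖G t‖ ≤ m t := by
      simp only [m]
      have := norm_nonneg (f t)
      linarith
    calc _ ≤ m t * (w t * ‖z - z'‖) :=
          h2.trans (mul_le_mul_of_nonneg_right h3 (mul_nonneg (hw0 t).le (norm_nonneg _)))
      _ = _ := by ring
  let z := ContractingWith.fixedPoint Φ hcontr
  have hz : Φ z = z := hcontr.fixedPoint_isFixedPt
  have hy : ∀ x, w x • z x = y₀ + ∫ t in x₀..x, g z t := fun x => by
    conv_lhs => rw [← hz, hΦ, smul_inv_smul₀ (hw0 x).ne']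
  refine ⟨fun x => w x • z x, by simp [hy], fun x => ?_⟩
  have h1 : HasDerivAt (fun x => y₀ + ∫ t in x₀..x, g z t) (g z x) x :=
    (intervalIntegral.integral_hasDerivAt_right ((hgc z).intervalIntegrable _ _)
      ((hgc z).stronglyMeasurableAtFilter _ _) (hgc z).continuousAt).const_add y₀
  simpa only [← hy, g] using h1

/-- Uniqueness for linear differential equations, on any interval. -/
theorem linear_ode_unique {G : ℝ → E →L[ℝ] E} {f : ℝ → E} (hG : Continuous G) {y z : ℝ → E}
    {a b x₀ : ℝ} (hx₀ : x₀ ∈ Set.Ioo a b)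
    (hy : ∀ x ∈ Set.Ioo a b, HasDerivAt y (G x (y x) + f x) x)
    (hz : ∀ x ∈ Set.Ioo a b, HasDerivAt z (G x (z x) + f x) x) (h : y x₀ = z x₀) :
    Set.EqOn y z (Set.Ioo a b) := by
  obtain ⟨C, hC⟩ := isCompact_Icc.exists_bound_of_continuousOn (s := Set.Icc a b) hG.continuousOn
  refine ODE_solution_unique_of_mem_Ioo (v := fun x u => G x u + f x) (s := fun _ => Set.univ)
    (K := C.toNNReal) (fun t ht => ?_) hx₀ (fun t ht => ⟨hy t ht, trivial⟩)
    (fun t ht => ⟨hz t ht, trivial⟩) h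
  refine (LipschitzWith.of_dist_le_mul fun u v => ?_).lipschitzOnWith
  rw [dist_add_right, dist_eq_norm, dist_eq_norm, ← map_sub]
  refine (G t).le_of_opNorm_le ((hC t (Set.Ioo_subset_Icc_self ht)).trans ?_) _
  exact Real.le_coe_toNNReal C

theorem linear_ode_unique_univ {G : ℝ → E →L[ℝ] E} {f : ℝ → E} (hG : Continuous G) {y z : ℝ → E}
    (x₀ : ℝ) (hy : ∀ x, HasDerivAt y (G x (y x) + f x) x)
    (hz : ∀ x, HasDerivAt z (G x (z x) + f x) x) (h : y x₀ = z x₀) : y = z := by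
  funext x
  refine linear_ode_unique hG (a := min x x₀ - 1) (b := max x x₀ + 1) (x₀ := x₀) ?_
    (fun t _ => hy t) (fun t _ => hz t) h ?_ <;> grind

/-- Solutions of linear differential equations with smooth coefficients are smooth. -/
theorem contDiff_of_linear_ode {G : ℝ → E →L[ℝ] E} {f : ℝ → E} (hG : ContDiff ℝ ∞ G)
    (hf : ContDiff ℝ ∞ f) {y : ℝ → E} (hy : ∀ x, HasDerivAt y (G x (y x) + f x) x) :
    ContDiff ℝ ∞ y := by
  have hd : deriv y = fun x => G x (y x) + f x := funext fun x => (hy x).deriv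
  refine contDiff_infty.2 fun n => ?_
  induction n with
  | zero => exact contDiff_zero.2 (continuous_iff_continuousAt.2 fun x => (hy x).continuousAt)
  | succ n ih =>
    rw [Nat.cast_add, Nat.cast_one]
    refine contDiff_succ_iff_deriv.2 ⟨fun x => (hy x).differentiableAt, fun h => ?_, ?_⟩
    · exact absurd h (WithTop.coe_ne_top (a := (n : ℕ∞)))
    rw [hd]
    exact ((contDiff_infty.1 hG n).clm_apply ih).add (contDiff_infty.1 hf n)

end LinearODE

/-! ### Matrix-valued coefficients -/

section Act

theorem act_apply_zero (M : Matrix (Fin 2) (Fin 2) ℂ) (v : C2) :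
    act M v 0 = M 0 0 * v 0 + M 0 1 * v 1 := by
  simp [act, Matrix.toLpLin_apply]

theorem act_apply_one (M : Matrix (Fin 2) (Fin 2) ℂ) (v : C2) :
    act M v 1 = M 1 0 * v 0 + M 1 1 * v 1 := by
  simp [act, Matrix.toLpLin_apply]

theorem act_add (M : Matrix (Fin 2) (Fin 2) ℂ) (v w : C2) : act M (v + w) = act M v + act M w :=
  map_add _ _ _

theorem act_neg (M : Matrix (Fin 2) (Fin 2) ℂ) (v : C2) : act M (-v) = -act M v :=
  map_neg _ _

theorem act_zero (M : Matrix (Fin 2) (Fin 2) ℂ) : act M 0 = 0 :=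
  map_zero _

theorem act_smul (M : Matrix (Fin 2) (Fin 2) ℂ) (c : ℂ) (v : C2) : act M (c • v) = c • act M v :=
  map_smul _ _ _

theorem act_mul (M N : Matrix (Fin 2) (Fin 2) ℂ) (v : C2) : act (M * N) v = act M (act N v) := by
  simp [act]

theorem add_act (M N : Matrix (Fin 2) (Fin 2) ℂ) (v : C2) : act (M + N) v = act M v + act N v := by
  simp [act]

theorem sub_act (M N : Matrix (Fin 2) (Fin 2) ℂ) (v : C2) : act (M - N) v = act M v - act N v := by
  simp [act]

theorem smul_act (c : ℂ) (M : Matrix (Fin 2) (Fin 2) ℂ) (v : C2) : act (c • M) v = c • act M v := by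
  simp [act]

theorem one_act (v : C2) : act 1 v = v := by
  simp [act]

theorem inner_act (M : Matrix (Fin 2) (Fin 2) ℂ) (v w : C2) :
    inner ℂ (act M v) w = inner ℂ v (act M.conjTranspose w) := by
  simp only [PiLp.inner_apply, Fin.sum_univ_two, act_apply_zero, act_apply_one,
    RCLike.inner_apply, map_add, map_mul, Matrix.conjTranspose_apply, RCLike.star_def]
  ring

theorem C2_ext {v w : C2} (h0 : v 0 = w 0) (h1 : v 1 = w 1) : v = w := by
  ext i
  fin_cases i
  · exact h0
  · exact h1

theorem hasDerivAt_C2 {f : ℝ → C2} {f' : C2} {x : ℝ} :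
    HasDerivAt f f' x ↔ ∀ i, HasDerivAt (fun x => f x i) (f' i) x := by
  constructor
  · intro h i
    exact ((PiLp.hasFDerivAt_apply (𝕜 := ℝ) 2 (f x) i).comp_hasDerivAt x h)
  · intro h
    exact ((PiLp.hasFDerivAt_toLp (𝕜 := ℝ) 2 (fun i => f x i)).comp_hasDerivAt x
      (hasDerivAt_pi.2 h))

theorem HasDerivAt.act {M : ℝ → Matrix (Fin 2) (Fin 2) ℂ} {M' : Matrix (Fin 2) (Fin 2) ℂ}
    {ψ : ℝ → C2} {ψ' : C2} {x : ℝ} (hM : ∀ i j, HasDerivAt (fun x => M x i j) (M' i j) x)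
    (hψ : HasDerivAt ψ ψ' x) :
    HasDerivAt (fun x => MatrixOscillator.act (M x) (ψ x))
      (MatrixOscillator.act M' (ψ x) + MatrixOscillator.act (M x) ψ') x := by
  have hψ := hasDerivAt_C2.1 hψ
  refine hasDerivAt_C2.2 fun i => ?_
  fin_cases i
  · simp only [Fin.zero_eta, act_apply_zero, PiLp.add_apply]
    convert! ((hM 0 0).mul (hψ 0)).add ((hM 0 1).mul (hψ 1)) using 1
    ring
  · simp only [Fin.mk_one, act_apply_one, PiLp.add_apply]
    convert! ((hM 1 0).mul (hψ 0)).add ((hM 1 1).mul (hψ 1)) using 1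
    ring

theorem HasDerivAt.const_act (M : Matrix (Fin 2) (Fin 2) ℂ)
    {ψ : ℝ → C2} {ψ' : C2} {x : ℝ} (hψ : HasDerivAt ψ ψ' x) :
    HasDerivAt (fun x => MatrixOscillator.act M (ψ x)) (MatrixOscillator.act M ψ') x := by
  have := HasDerivAt.act (M := fun _ => M) (M' := 0) (fun i j => hasDerivAt_const x (M i j)) hψ
  simpa [MatrixOscillator.act] using this

/-- The action of a matrix as a real-linear continuous map. -/
def actR (M : Matrix (Fin 2) (Fin 2) ℂ) : C2 →L[ℝ] C2 :=
  (Matrix.toEuclideanCLM (𝕜 := ℂ) M).restrictScalars ℝ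

theorem actR_apply (M : Matrix (Fin 2) (Fin 2) ℂ) (v : C2) : actR M v = act M v := rfl

theorem contDiff_C2 {f : ℝ → C2} (h : ∀ i, ContDiff ℝ ∞ fun x => f x i) : ContDiff ℝ ∞ f :=
  contDiff_piLp' 2 h

theorem contDiff_actR {M : ℝ → Matrix (Fin 2) (Fin 2) ℂ}
    (hM : ∀ i j, ContDiff ℝ ∞ fun x => M x i j) : ContDiff ℝ ∞ fun x => actR (M x) := by
  refine contDiff_clm_apply_iff.2 fun v => contDiff_C2 fun i => ?_
  fin_cases i
  · simp only [actR_apply, Fin.zero_eta, act_apply_zero]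
    exact ((hM 0 0).mul contDiff_const).add ((hM 0 1).mul contDiff_const)
  · simp only [actR_apply, Fin.mk_one, act_apply_one]
    exact ((hM 1 0).mul contDiff_const).add ((hM 1 1).mul contDiff_const)

theorem ContDiff.act {M : ℝ → Matrix (Fin 2) (Fin 2) ℂ} {ψ : ℝ → C2}
    (hM : ∀ i j, ContDiff ℝ ∞ fun x => M x i j) (hψ : ContDiff ℝ ∞ ψ) :
    ContDiff ℝ ∞ fun x => MatrixOscillator.act (M x) (ψ x) :=
  (contDiff_actR hM).clm_apply hψ

theorem ContDiff.const_act (M : Matrix (Fin 2) (Fin 2) ℂ) {ψ : ℝ → C2} (hψ : ContDiff ℝ ∞ ψ) :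
    ContDiff ℝ ∞ fun x => MatrixOscillator.act M (ψ x) :=
  ContDiff.act (M := fun _ => M) (fun _ _ => contDiff_const) hψ

theorem hasDerivAt_of_smooth {ψ : ℝ → C2} (hψ : ContDiff ℝ ∞ ψ) (x : ℝ) :
    HasDerivAt ψ (deriv ψ x) x :=
  (hψ.differentiable (by simp) x).hasDerivAt

theorem contDiff_deriv {ψ : ℝ → C2} (hψ : ContDiff ℝ ∞ ψ) : ContDiff ℝ ∞ (deriv ψ) :=
  (contDiff_infty_iff_deriv.1 hψ).2

end Act

/-! ### The factorization of the Schrödinger operator -/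

section Factorization

variable (α k ω₀ ω₁ : ℝ)

theorem conjTranspose_reflection (θ : ℝ) : (reflection θ).conjTranspose = reflection θ := by
  ext i j
  fin_cases i <;> fin_cases j <;>
    simp [reflection, Matrix.conjTranspose_apply, -Complex.ofReal_cos, -Complex.ofReal_sin]

theorem conjTranspose_darbouxF (x : ℝ) :
    (darbouxF α k ω₀ ω₁ x).conjTranspose = darbouxF α k ω₀ ω₁ x := by
  simp [darbouxF, conjTranspose_reflection, Matrix.conjTranspose_smul]

theorem conjTranspose_rotation_mul : (rotation ω₀).conjTranspose * rotation ω₀ = 1 := by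
  have h : (Real.cos ω₀ : ℂ) ^ 2 + (Real.sin ω₀ : ℂ) ^ 2 = 1 := by
    exact_mod_cast Real.cos_sq_add_sin_sq ω₀
  ext i j
  fin_cases i <;> fin_cases j <;>
    simp [rotation, Matrix.mul_apply, Fin.sum_univ_two, Matrix.conjTranspose_apply,
      -Complex.ofReal_cos, -Complex.ofReal_sin] <;> first | linear_combination h | ring

theorem inner_rotation (v w : C2) :
    inner ℂ (act (rotation ω₀) v) (act (rotation ω₀) w) = inner ℂ v w := by
  rw [inner_act, ← act_mul, conjTranspose_rotation_mul, one_act]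

theorem norm_rotation (v : C2) : ‖act (rotation ω₀) v‖ = ‖v‖ := by
  rw [← sq_eq_sq₀ (norm_nonneg _) (norm_nonneg _), ← Complex.ofReal_inj]
  push_cast
  have := inner_rotation ω₀ v v
  rwa [inner_self_eq_norm_sq_to_K, inner_self_eq_norm_sq_to_K] at this

theorem inner_darbouxF (x : ℝ) (v w : C2) :
    inner ℂ (act (darbouxF α k ω₀ ω₁ x) v) w = inner ℂ v (act (darbouxF α k ω₀ ω₁ x) w) := by
  rw [inner_act, conjTranspose_darbouxF]

/-- The derivative of the matrix `darbouxF`; differentiation of a reflection adds `π / 2` to its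
angle. -/
def darbouxF' (x : ℝ) : Matrix (Fin 2) (Fin 2) ℂ :=
  (α : ℂ) • 1 + ((2 * k * gam α ω₀ * x : ℝ) : ℂ) •
    reflection (gam α ω₀ * x ^ 2 + ω₁ + Real.pi / 2)

theorem hasDerivAt_reflection {θ : ℝ → ℝ} {θ' x : ℝ} (hθ : HasDerivAt θ θ' x) (i j : Fin 2) :
    HasDerivAt (fun x => reflection (θ x) i j)
      ((θ' : ℂ) * reflection (θ x + Real.pi / 2) i j) x := by
  have hc := hθ.cos.ofReal_comp
  have hs := hθ.sin.ofReal_comp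
  fin_cases i <;> fin_cases j
  · convert! hc using 1
    simp [reflection, Real.cos_add_pi_div_two, -Complex.ofReal_cos, -Complex.ofReal_sin]
    ring
  · convert! hs using 1
    simp [reflection, Real.sin_add_pi_div_two, -Complex.ofReal_cos, -Complex.ofReal_sin]
    ring
  · convert! hs using 1
    simp [reflection, Real.sin_add_pi_div_two, -Complex.ofReal_cos, -Complex.ofReal_sin]
    ring
  · convert! hc.neg using 1
    simp [reflection, Real.cos_add_pi_div_two, -Complex.ofReal_cos, -Complex.ofReal_sin]
    ring

theorem hasDerivAt_darbouxF (x : ℝ) (i j : Fin 2) :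
    HasDerivAt (fun x => darbouxF α k ω₀ ω₁ x i j) (darbouxF' α k ω₀ ω₁ x i j) x := by
  have hθ : HasDerivAt (fun x : ℝ => gam α ω₀ * x ^ 2 + ω₁) (gam α ω₀ * (2 * x)) x := by
    simpa using ((hasDerivAt_pow 2 x).const_mul (gam α ω₀)).add_const ω₁
  have h1 : HasDerivAt (fun x : ℝ => ((α * x : ℝ) : ℂ)) (α : ℂ) x := by
    simpa using ((hasDerivAt_id x).const_mul α).ofReal_comp
  have h := (h1.mul_const ((1 : Matrix (Fin 2) (Fin 2) ℂ) i j)).add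
    ((hasDerivAt_reflection hθ i j).const_mul (k : ℂ))
  simp only [darbouxF, darbouxF', Matrix.add_apply, Matrix.smul_apply, smul_eq_mul]
  convert! h using 1
  push_cast
  ring

theorem contDiff_reflection {θ : ℝ → ℝ} (hθ : ContDiff ℝ ∞ θ) (i j : Fin 2) :
    ContDiff ℝ ∞ fun x => reflection (θ x) i j := by
  have hc : ContDiff ℝ ∞ fun x => ((Real.cos (θ x) : ℝ) : ℂ) :=
    Complex.ofRealCLM.contDiff.comp hθ.cos
  have hs : ContDiff ℝ ∞ fun x => ((Real.sin (θ x) : ℝ) : ℂ) :=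
    Complex.ofRealCLM.contDiff.comp hθ.sin
  fin_cases i <;> fin_cases j
  · exact hc
  · exact hs
  · exact hs
  · exact hc.neg

theorem contDiff_darbouxF (i j : Fin 2) : ContDiff ℝ ∞ fun x => darbouxF α k ω₀ ω₁ x i j := by
  have h1 : ContDiff ℝ ∞ fun x : ℝ => ((α * x : ℝ) : ℂ) :=
    Complex.ofRealCLM.contDiff.comp (contDiff_const.mul contDiff_id)
  exact (h1.mul contDiff_const).add
    (contDiff_const.mul (contDiff_reflection (by fun_prop) i j))

theorem contDiff_potential (i j : Fin 2) : ContDiff ℝ ∞ fun x => potential α k ω₀ ω₁ x i j := by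
  have h1' : ContDiff ℝ ∞ fun x : ℝ => α ^ 2 * x ^ 2 + k ^ 2 - α := by fun_prop
  have h2' : ContDiff ℝ ∞ fun x : ℝ => 2 * α * k * x / Real.cos ω₀ := by fun_prop
  have h1 : ContDiff ℝ ∞ fun x : ℝ => ((α ^ 2 * x ^ 2 + k ^ 2 - α : ℝ) : ℂ) :=
    Complex.ofRealCLM.contDiff.comp h1'
  have h2 : ContDiff ℝ ∞ fun x : ℝ => ((2 * α * k * x / Real.cos ω₀ : ℝ) : ℂ) :=
    Complex.ofRealCLM.contDiff.comp h2'
  exact (h1.mul contDiff_const).add (h2.mul (contDiff_reflection (by fun_prop) i j))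

theorem contDiff_darbouxA {ψ : ℝ → C2} (hψ : ContDiff ℝ ∞ ψ) :
    ContDiff ℝ ∞ (darbouxA α k ω₀ ω₁ ψ) :=
  (contDiff_deriv hψ).add (ContDiff.act (contDiff_darbouxF α k ω₀ ω₁) hψ)

theorem contDiff_darbouxAbar {ψ : ℝ → C2} (hψ : ContDiff ℝ ∞ ψ) :
    ContDiff ℝ ∞ (darbouxAbar α k ω₀ ω₁ ψ) :=
  (contDiff_deriv hψ).neg.add (ContDiff.act (contDiff_darbouxF α k ω₀ ω₁) hψ)

theorem contDiff_raising {ψ : ℝ → C2} (hψ : ContDiff ℝ ∞ ψ) :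
    ContDiff ℝ ∞ (raising α k ω₀ ω₁ ψ) :=
  contDiff_darbouxAbar α k ω₀ ω₁ (ContDiff.const_act _ hψ)

theorem contDiff_iterate_raising {ψ : ℝ → C2} (hψ : ContDiff ℝ ∞ ψ) (n : ℕ) :
    ContDiff ℝ ∞ ((raising α k ω₀ ω₁)^[n] ψ) := by
  induction n with
  | zero => exact hψ
  | succ n ih =>
    rw [Function.iterate_succ_apply']
    exact contDiff_raising α k ω₀ ω₁ ih

theorem contDiff_schrodinger {ψ : ℝ → C2} (hψ : ContDiff ℝ ∞ ψ) :
    ContDiff ℝ ∞ (schrodinger (potential α k ω₀ ω₁) ψ) :=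
  (contDiff_deriv (contDiff_deriv hψ)).neg.add (ContDiff.act (contDiff_potential α k ω₀ ω₁) hψ)

/-- The identity `F² - F' = U`. -/
theorem darbouxF_sq_sub (hω₀ : Real.cos ω₀ ≠ 0) (x : ℝ) :
    darbouxF α k ω₀ ω₁ x * darbouxF α k ω₀ ω₁ x - darbouxF' α k ω₀ ω₁ x =
      potential α k ω₀ ω₁ x := by
  have hg : gam α ω₀ = α * Real.sin ω₀ * (Real.cos ω₀)⁻¹ := by
    rw [gam, Real.tan_eq_sin_div_cos, div_eq_mul_inv, mul_assoc]
  rw [darbouxF, darbouxF', potential]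
  generalize hθ : gam α ω₀ * x ^ 2 + ω₁ = θ
  have h3 : (Real.cos θ : ℂ) ^ 2 + (Real.sin θ : ℂ) ^ 2 = 1 := by
    exact_mod_cast Real.cos_sq_add_sin_sq θ
  have hi : (Real.cos ω₀ : ℂ) * (Real.cos ω₀ : ℂ)⁻¹ = 1 :=
    mul_inv_cancel₀ (Complex.ofReal_ne_zero.2 hω₀)
  simp only [reflection, Real.cos_add_pi_div_two, Real.sin_add_pi_div_two, Real.cos_sub,
    Real.sin_sub]
  ext i j
  fin_cases i <;> fin_cases j <;>
    simp [Matrix.mul_apply, Fin.sum_univ_two, hg, div_eq_mul_inv, -Complex.ofReal_cos,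
      -Complex.ofReal_sin]
  · linear_combination (k : ℂ) ^ 2 * h3 - 2 * α * k * x * Real.cos θ * hi
  · linear_combination -2 * α * k * x * Real.sin θ * hi
  · linear_combination -2 * α * k * x * Real.sin θ * hi
  · linear_combination (k : ℂ) ^ 2 * h3 + 2 * α * k * x * Real.cos θ * hi

/-- The identity `(F² + F') C = C (U + 2 α)`. Conjugation by `C` turns the reflection with angle
`χ + 2 ω₀` in `F² + F'` into the one with angle `χ` in `U`; this is where `γ = α tan ω₀` enters. -/
theorem darbouxF_sq_add_mul_rotation (hω₀ : Real.cos ω₀ ≠ 0) (x : ℝ) :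
    (darbouxF α k ω₀ ω₁ x * darbouxF α k ω₀ ω₁ x + darbouxF' α k ω₀ ω₁ x) * rotation ω₀ =
      rotation ω₀ * (potential α k ω₀ ω₁ x + (2 * α : ℂ) • 1) := by
  have hg : gam α ω₀ = α * Real.sin ω₀ * (Real.cos ω₀)⁻¹ := by
    rw [gam, Real.tan_eq_sin_div_cos, div_eq_mul_inv, mul_assoc]
  rw [darbouxF, darbouxF', potential]
  generalize hθ : gam α ω₀ * x ^ 2 + ω₁ = θ
  have h3 : (Real.cos θ : ℂ) ^ 2 + (Real.sin θ : ℂ) ^ 2 = 1 := by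
    exact_mod_cast Real.cos_sq_add_sin_sq θ
  have hi : (Real.cos ω₀ : ℂ) * (Real.cos ω₀ : ℂ)⁻¹ = 1 :=
    mul_inv_cancel₀ (Complex.ofReal_ne_zero.2 hω₀)
  simp only [reflection, Real.cos_add_pi_div_two, Real.sin_add_pi_div_two, Real.cos_sub,
    Real.sin_sub]
  ext i j
  fin_cases i <;> fin_cases j <;>
    simp [rotation, Matrix.mul_apply, Fin.sum_univ_two, hg, div_eq_mul_inv,
      -Complex.ofReal_cos, -Complex.ofReal_sin]
  · linear_combination (k : ℂ) ^ 2 * Real.cos ω₀ * h3 -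
      2 * α * k * x * (Real.cos θ * Real.cos ω₀ + Real.sin θ * Real.sin ω₀) * hi
  · linear_combination -(k : ℂ) ^ 2 * Real.sin ω₀ * h3 -
      2 * α * k * x * (Real.sin θ * Real.cos ω₀ - Real.cos θ * Real.sin ω₀) * hi
  · linear_combination (k : ℂ) ^ 2 * Real.sin ω₀ * h3 -
      2 * α * k * x * (Real.sin θ * Real.cos ω₀ - Real.cos θ * Real.sin ω₀) * hi
  · linear_combination (k : ℂ) ^ 2 * Real.cos ω₀ * h3 +
      2 * α * k * x * (Real.cos θ * Real.cos ω₀ + Real.sin θ * Real.sin ω₀) * hi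

/-- The factorization `L = Ā A`. -/
theorem schrodinger_eq (hω₀ : Real.cos ω₀ ≠ 0) {ψ : ℝ → C2} (hψ : ContDiff ℝ ∞ ψ) :
    schrodinger (potential α k ω₀ ω₁) ψ = darbouxAbar α k ω₀ ω₁ (darbouxA α k ω₀ ω₁ ψ) := by
  funext x
  have h : HasDerivAt (darbouxA α k ω₀ ω₁ ψ) _ x :=
    (hasDerivAt_of_smooth (contDiff_deriv hψ) x).add
      (HasDerivAt.act (hasDerivAt_darbouxF α k ω₀ ω₁ x) (hasDerivAt_of_smooth hψ x))
  simp only [darbouxAbar, h.deriv, schrodinger, ← darbouxF_sq_sub α k ω₀ ω₁ hω₀ x, sub_act,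
    act_mul, darbouxA, act_add]
  abel

/-- The commutation relation: `A Ā C = C (L + 2 α)`. -/
theorem darbouxA_raising (hω₀ : Real.cos ω₀ ≠ 0) {ψ : ℝ → C2} (hψ : ContDiff ℝ ∞ ψ) (x : ℝ) :
    darbouxA α k ω₀ ω₁ (raising α k ω₀ ω₁ ψ) x =
      act (rotation ω₀) (schrodinger (potential α k ω₀ ω₁) ψ x + (2 * α : ℂ) • ψ x) := by
  have h0 : ∀ x, HasDerivAt (fun x => act (rotation ω₀) (ψ x))
      (act (rotation ω₀) (deriv ψ x)) x := fun x =>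
    HasDerivAt.const_act _ (hasDerivAt_of_smooth hψ x)
  have h1 : raising α k ω₀ ω₁ ψ = fun x => -act (rotation ω₀) (deriv ψ x) +
      act (darbouxF α k ω₀ ω₁ x) (act (rotation ω₀) (ψ x)) := by
    funext x
    rw [raising, darbouxAbar, (h0 x).deriv]
  have h : HasDerivAt (raising α k ω₀ ω₁ ψ) (-act (rotation ω₀) (deriv (deriv ψ) x) +
      (act (darbouxF' α k ω₀ ω₁ x) (act (rotation ω₀) (ψ x)) +
        act (darbouxF α k ω₀ ω₁ x) (act (rotation ω₀) (deriv ψ x)))) x := by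
    rw [h1]
    exact (HasDerivAt.const_act (rotation ω₀)
      (hasDerivAt_of_smooth (contDiff_deriv hψ) x)).neg.add
        (HasDerivAt.act (hasDerivAt_darbouxF α k ω₀ ω₁ x) (h0 x))
  have h2 : act ((darbouxF α k ω₀ ω₁ x * darbouxF α k ω₀ ω₁ x + darbouxF' α k ω₀ ω₁ x) *
      rotation ω₀) (ψ x) =
      act (rotation ω₀ * (potential α k ω₀ ω₁ x + (2 * α : ℂ) • 1)) (ψ x) := by
    rw [darbouxF_sq_add_mul_rotation α k ω₀ ω₁ hω₀ x]
  simp only [act_mul, add_act, smul_act, one_act] at h2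
  rw [darbouxA, h.deriv, h1, schrodinger, add_assoc (-deriv (deriv ψ) x),
    act_add (rotation ω₀), ← h2]
  simp only [act_add, act_neg]
  abel

end Factorization

/-! ### Linearity and the ladder -/

section Ladder

variable (α k ω₀ ω₁ : ℝ)

theorem darbouxA_add {ψ φ : ℝ → C2} (hψ : ContDiff ℝ ∞ ψ) (hφ : ContDiff ℝ ∞ φ) :
    darbouxA α k ω₀ ω₁ (ψ + φ) = darbouxA α k ω₀ ω₁ ψ + darbouxA α k ω₀ ω₁ φ := by
  funext x
  have h : deriv (ψ + φ) x = deriv ψ x + deriv φ x :=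
    deriv_add (hψ.differentiable (by simp) x) (hφ.differentiable (by simp) x)
  simp only [darbouxA, h, Pi.add_apply, act_add]
  abel

theorem darbouxA_smul (c : ℂ) {ψ : ℝ → C2} (hψ : ContDiff ℝ ∞ ψ) :
    darbouxA α k ω₀ ω₁ (c • ψ) = c • darbouxA α k ω₀ ω₁ ψ := by
  funext x
  have h : deriv (c • ψ) x = c • deriv ψ x :=
    deriv_const_smul c (hψ.differentiable (by simp) x)
  simp only [darbouxA, h, Pi.smul_apply, act_smul, smul_add]

theorem raising_apply {ψ : ℝ → C2} (hψ : ContDiff ℝ ∞ ψ) (x : ℝ) :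
    raising α k ω₀ ω₁ ψ x = -act (rotation ω₀) (deriv ψ x) +
      act (darbouxF α k ω₀ ω₁ x) (act (rotation ω₀) (ψ x)) := by
  rw [raising, darbouxAbar, (HasDerivAt.const_act _ (hasDerivAt_of_smooth hψ x)).deriv]

theorem raising_add {ψ φ : ℝ → C2} (hψ : ContDiff ℝ ∞ ψ) (hφ : ContDiff ℝ ∞ φ) :
    raising α k ω₀ ω₁ (ψ + φ) = raising α k ω₀ ω₁ ψ + raising α k ω₀ ω₁ φ := by
  funext x
  have h : deriv (ψ + φ) x = deriv ψ x + deriv φ x :=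
    deriv_add (hψ.differentiable (by simp) x) (hφ.differentiable (by simp) x)
  have hs : ContDiff ℝ ∞ (ψ + φ) := hψ.add hφ
  rw [Pi.add_apply, raising_apply α k ω₀ ω₁ hs, raising_apply α k ω₀ ω₁ hψ,
    raising_apply α k ω₀ ω₁ hφ]
  simp only [h, Pi.add_apply, act_add]
  abel

theorem raising_smul (c : ℂ) {ψ : ℝ → C2} (hψ : ContDiff ℝ ∞ ψ) :
    raising α k ω₀ ω₁ (c • ψ) = c • raising α k ω₀ ω₁ ψ := by
  funext x
  have h : deriv (c • ψ) x = c • deriv ψ x :=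
    deriv_const_smul c (hψ.differentiable (by simp) x)
  have hs : ContDiff ℝ ∞ (c • ψ) := contDiff_const.smul hψ
  rw [Pi.smul_apply, raising_apply α k ω₀ ω₁ hs,
    raising_apply α k ω₀ ω₁ hψ]
  simp only [h, Pi.smul_apply, act_smul, smul_add, smul_neg]

theorem schrodinger_raising (hω₀ : Real.cos ω₀ ≠ 0) (z : ℂ) {ψ : ℝ → C2}
    (hψ : ContDiff ℝ ∞ ψ) (h : ∀ x, schrodinger (potential α k ω₀ ω₁) ψ x = z • ψ x) (x : ℝ) :
    schrodinger (potential α k ω₀ ω₁) (raising α k ω₀ ω₁ ψ) x =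
      (z + 2 * α) • raising α k ω₀ ω₁ ψ x := by
  have h1 : darbouxA α k ω₀ ω₁ (raising α k ω₀ ω₁ ψ) =
      fun x => act (rotation ω₀) (((z + 2 * α) • ψ) x) := by
    funext x
    rw [darbouxA_raising α k ω₀ ω₁ hω₀ hψ, h, Pi.smul_apply, add_smul]
  rw [schrodinger_eq α k ω₀ ω₁ hω₀ (contDiff_raising α k ω₀ ω₁ hψ), h1]
  exact congrFun (raising_smul α k ω₀ ω₁ (z + 2 * α) hψ) x

theorem schrodinger_iterate_raising (hω₀ : Real.cos ω₀ ≠ 0) {ψ : ℝ → C2}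
    (hψ : ContDiff ℝ ∞ ψ) (h0 : ∀ x, darbouxA α k ω₀ ω₁ ψ x = 0) (n : ℕ) (x : ℝ) :
    schrodinger (potential α k ω₀ ω₁) ((raising α k ω₀ ω₁)^[n] ψ) x =
      ((2 * α * n : ℝ) : ℂ) • (raising α k ω₀ ω₁)^[n] ψ x := by
  induction n generalizing x with
  | zero =>
    have h1 : darbouxA α k ω₀ ω₁ ψ = fun _ => 0 := funext h0
    simp [schrodinger_eq α k ω₀ ω₁ hω₀ hψ, h1, darbouxAbar, act_zero]
  | succ n ih =>
    rw [Function.iterate_succ_apply', schrodinger_raising α k ω₀ ω₁ hω₀ _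
      (contDiff_iterate_raising α k ω₀ ω₁ hψ n) ih]
    congr 1
    push_cast
    ring

/-- The operator `C⁻¹ A` lowers the level. -/
theorem darbouxA_iterate_raising (hω₀ : Real.cos ω₀ ≠ 0) {ψ : ℝ → C2}
    (hψ : ContDiff ℝ ∞ ψ) (h0 : ∀ x, darbouxA α k ω₀ ω₁ ψ x = 0) (n : ℕ) (x : ℝ) :
    darbouxA α k ω₀ ω₁ ((raising α k ω₀ ω₁)^[n + 1] ψ) x =
      ((2 * α * (n + 1 : ℕ) : ℝ) : ℂ) • act (rotation ω₀) ((raising α k ω₀ ω₁)^[n] ψ x) := by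
  rw [Function.iterate_succ_apply', darbouxA_raising α k ω₀ ω₁ hω₀
    (contDiff_iterate_raising α k ω₀ ω₁ hψ n),
    schrodinger_iterate_raising α k ω₀ ω₁ hω₀ hψ h0, ← add_smul, act_smul]
  congr 1
  push_cast
  ring

theorem exists_groundState (x₀ : ℝ) (y₀ : C2) : ∃ ψ : ℝ → C2, ContDiff ℝ ∞ ψ ∧
    (∀ x, darbouxA α k ω₀ ω₁ ψ x = 0) ∧ ψ x₀ = y₀ := by
  have hG := (contDiff_actR (contDiff_darbouxF α k ω₀ ω₁)).neg
  obtain ⟨ψ, h0, hψ⟩ := exists_hasDerivAt_linear hG.continuous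
    (continuous_const (y := (0 : C2))) x₀ y₀
  refine ⟨ψ, contDiff_of_linear_ode hG contDiff_const hψ, fun x => ?_, h0⟩
  rw [darbouxA, (hψ x).deriv]
  simp [actR_apply]

end Ladder

/-! ### Integration by parts and quadratic forms -/

section Forms

variable (α k ω₀ ω₁ : ℝ)

theorem hasCompactSupport_inner {u v : ℝ → C2} (hv : HasCompactSupport v) :
    HasCompactSupport fun x => (inner ℂ (u x) (v x) : ℂ) :=
  hv.mono fun x hx h => hx (by simp [h])

theorem hasCompactSupport_act {M : ℝ → Matrix (Fin 2) (Fin 2) ℂ} {v : ℝ → C2}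
    (hv : HasCompactSupport v) : HasCompactSupport fun x => act (M x) (v x) :=
  hv.mono fun x hx h => hx (by simp [h, act_zero])

theorem hasCompactSupport_darbouxA {v : ℝ → C2} (hv : HasCompactSupport v) :
    HasCompactSupport (darbouxA α k ω₀ ω₁ v) :=
  hv.deriv.add (hasCompactSupport_act hv)

theorem integrable_inner {u v : ℝ → C2} (hu : Continuous u) (hv : Continuous v)
    (hc : HasCompactSupport v) : Integrable fun x => (inner ℂ (u x) (v x) : ℂ) :=
  (hu.inner hv).integrable_of_hasCompactSupport (hasCompactSupport_inner hc)

/-- `Ā` is the formal adjoint of `A`, because `F` is Hermitian. -/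
theorem integral_inner_darbouxA {u v : ℝ → C2} (hu : ContDiff ℝ ∞ u) (hv : ContDiff ℝ ∞ v)
    (hc : HasCompactSupport v) :
    ∫ x, (inner ℂ (darbouxA α k ω₀ ω₁ u x) (v x) : ℂ) =
      ∫ x, inner ℂ (u x) (darbouxAbar α k ω₀ ω₁ v x) := by
  have hd : ∀ x, HasDerivAt (fun x => (inner ℂ (u x) (v x) : ℂ))
      (inner ℂ (u x) (deriv v x) + inner ℂ (deriv u x) (v x)) x := fun x =>
    (hasDerivAt_of_smooth hu x).inner ℂ (hasDerivAt_of_smooth hv x)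
  have h1 := integrable_inner hu.continuous (contDiff_deriv hv).continuous hc.deriv
  have h2 := integrable_inner (contDiff_deriv hu).continuous hv.continuous hc
  have h3 := integrable_inner hu.continuous hv.continuous hc
  have h4 := integrable_inner hu.continuous
    (ContDiff.act (contDiff_darbouxF α k ω₀ ω₁) hv).continuous (hasCompactSupport_act hc)
  have h5 := integral_eq_zero_of_hasDerivAt_of_integrable hd (h1.add h2) h3
  rw [integral_add h1 h2] at h5
  simp only [darbouxA, darbouxAbar, inner_add_left, inner_add_right, inner_neg_right,
    inner_darbouxF]
  have h1' : Integrable fun x => -(inner ℂ (u x) (deriv v x) : ℂ) := h1.neg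
  rw [integral_add h2 h4, integral_add h1' h4, integral_neg]
  linear_combination h5

theorem integral_inner_raising {u v : ℝ → C2} (hu : ContDiff ℝ ∞ u) (hv : ContDiff ℝ ∞ v)
    (hc : HasCompactSupport v) :
    ∫ x, (inner ℂ (u x) (raising α k ω₀ ω₁ v x) : ℂ) =
      ∫ x, inner ℂ (darbouxA α k ω₀ ω₁ u x) (act (rotation ω₀) (v x)) :=
  (integral_inner_darbouxA α k ω₀ ω₁ hu (ContDiff.const_act _ hv)
    (hasCompactSupport_act (M := fun _ => rotation ω₀) hc)).symm

theorem integral_inner_schrodinger (hω₀ : Real.cos ω₀ ≠ 0) {u v : ℝ → C2}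
    (hu : ContDiff ℝ ∞ u) (hv : ContDiff ℝ ∞ v) (hc : HasCompactSupport v) :
    ∫ x, (inner ℂ (u x) (schrodinger (potential α k ω₀ ω₁) v x) : ℂ) =
      ∫ x, inner ℂ (darbouxA α k ω₀ ω₁ u x) (darbouxA α k ω₀ ω₁ v x) := by
  rw [schrodinger_eq α k ω₀ ω₁ hω₀ hv, integral_inner_darbouxA α k ω₀ ω₁ hu
    (contDiff_darbouxA α k ω₀ ω₁ hv) (hasCompactSupport_darbouxA α k ω₀ ω₁ hc)]

theorem integral_inner_symm (u v : ℝ → C2) :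
    ∫ x, (inner ℂ (u x) (v x) : ℂ) = (starRingEnd ℂ) (∫ x, inner ℂ (v x) (u x)) := by
  rw [← integral_conj]
  simp only [inner_conj_symm]

theorem integral_inner_self (u : ℝ → C2) :
    ∫ x, (inner ℂ (u x) (u x) : ℂ) = ((∫ x, ‖u x‖ ^ 2 : ℝ) : ℂ) := by
  refine Eq.trans ?_ integral_ofReal
  congr 1
  funext x
  rw [inner_self_eq_norm_sq_to_K]
  norm_cast

theorem inner_eq_integral {p q : L2} {u v : ℝ → C2} (hp : p =ᵐ[volume] u)
    (hq : q =ᵐ[volume] v) : inner ℂ p q = ∫ x, (inner ℂ (u x) (v x) : ℂ) := by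
  rw [L2.inner_def]
  refine integral_congr_ae ?_
  filter_upwards [hp, hq] with x h1 h2
  rw [h1, h2]

theorem norm_sq_eq_integral {p : L2} {u : ℝ → C2} (hp : p =ᵐ[volume] u) :
    ‖p‖ ^ 2 = ∫ x, ‖u x‖ ^ 2 := by
  rw [← Complex.ofReal_inj, ← integral_inner_self, ← inner_eq_integral hp hp,
    inner_self_eq_norm_sq_to_K]
  push_cast
  rfl

theorem norm_integral_inner_sq_le {u v : ℝ → C2} (hu : Continuous u) (hv : Continuous v)
    (hcu : HasCompactSupport u) (hcv : HasCompactSupport v) :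
    ‖∫ x, (inner ℂ (u x) (v x) : ℂ)‖ ^ 2 ≤ (∫ x, ‖u x‖ ^ 2) * ∫ x, ‖v x‖ ^ 2 := by
  have hu' : MemLp u 2 volume := hu.memLp_of_hasCompactSupport hcu
  have hv' : MemLp v 2 volume := hv.memLp_of_hasCompactSupport hcv
  rw [← inner_eq_integral hu'.coeFn_toLp hv'.coeFn_toLp, ← norm_sq_eq_integral hu'.coeFn_toLp,
    ← norm_sq_eq_integral hv'.coeFn_toLp, ← mul_pow]
  exact pow_le_pow_left₀ (norm_nonneg _) (norm_inner_le_norm _ _) 2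

/-- The identity `‖Ā C g‖² = ‖A g‖² + 2 α ‖g‖²`. -/
theorem integral_norm_raising_sq (hω₀ : Real.cos ω₀ ≠ 0) {g : ℝ → C2} (hg : ContDiff ℝ ∞ g)
    (hc : HasCompactSupport g) :
    ∫ x, ‖raising α k ω₀ ω₁ g x‖ ^ 2 =
      (∫ x, ‖darbouxA α k ω₀ ω₁ g x‖ ^ 2) + 2 * α * ∫ x, ‖g x‖ ^ 2 := by
  have hL := contDiff_schrodinger α k ω₀ ω₁ hg
  rw [← Complex.ofReal_inj, ← integral_inner_self,
    integral_inner_raising α k ω₀ ω₁ (contDiff_raising α k ω₀ ω₁ hg) hg hc]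
  simp only [darbouxA_raising α k ω₀ ω₁ hω₀ hg, inner_rotation, inner_add_left, inner_smul_left]
  rw [integral_add (integrable_inner hL.continuous hg.continuous hc)
    ((integrable_inner hg.continuous hg.continuous hc).const_mul _), integral_const_mul,
    integral_inner_symm, integral_inner_schrodinger α k ω₀ ω₁ hω₀ hg hg hc, integral_inner_self,
    integral_inner_self]
  simp [map_ofNat (starRingEnd ℂ) 2]

/-- A test function orthogonal to all ground states lies in the range of the raising operator on
test functions: the solution of `-h' + F h = φ` which vanishes to the left of the support of `φ`
also vanishes to the right of it, because `⟪ψ, h⟫' = -⟪ψ, φ⟫` for every ground state `ψ`. -/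
theorem exists_raising_eq {φ : ℝ → C2} (hφ : ContDiff ℝ ∞ φ) (hc : HasCompactSupport φ)
    (horth : ∀ ψ : ℝ → C2, ContDiff ℝ ∞ ψ → (∀ x, darbouxA α k ω₀ ω₁ ψ x = 0) →
      ∫ x, (inner ℂ (ψ x) (φ x) : ℂ) = 0) :
    ∃ g : ℝ → C2, ContDiff ℝ ∞ g ∧ HasCompactSupport g ∧ raising α k ω₀ ω₁ g = φ := by
  obtain ⟨r, hr⟩ : ∃ r : ℝ, ∀ x, r < |x| → φ x = 0 := by
    obtain ⟨r, hr⟩ := hc.isCompact.isBounded.subset_closedBall 0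
    refine ⟨r, fun x hx => image_eq_zero_of_notMem_tsupport fun h => ?_⟩
    have := hr h
    rw [mem_closedBall_zero_iff, Real.norm_eq_abs] at this
    exact absurd this (not_le.2 hx)
  have hG := contDiff_actR (contDiff_darbouxF α k ω₀ ω₁)
  obtain ⟨h, h0, hh⟩ := exists_hasDerivAt_linear hG.continuous hφ.continuous.neg (-|r| - 1) 0
  have hsm : ContDiff ℝ ∞ h := contDiff_of_linear_ode hG hφ.neg hh
  have hleft : ∀ x < -|r|, h x = 0 := by
    intro x hx
    refine linear_ode_unique (z := fun _ => 0) (f := fun x => -φ x) hG.continuous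
      (a := min x (-|r| - 1) - 1) (b := -|r|) (x₀ := -|r| - 1) ?_ (fun t _ => hh t)
      (fun t ht => ?_) h0 ?_
    · exact ⟨by linarith [min_le_right x (-|r| - 1)], by linarith⟩
    · have : φ t = 0 := hr t (by
        have h1 := ht.2
        have h2 := le_abs_self r
        have h3 := neg_le_abs t
        linarith)
      simpa [this] using hasDerivAt_const t (0 : C2)
    · exact ⟨by linarith [min_le_left x (-|r| - 1)], hx⟩
  have hright : ∀ x, |r| < x → h x = 0 := by
    intro x hx
    obtain ⟨ψ, hψ, hψA, hψx⟩ := exists_groundState α k ω₀ ω₁ x (h x)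
    have hd : ∀ t, HasDerivAt (fun t => (inner ℂ (ψ t) (h t) : ℂ)) (-inner ℂ (ψ t) (φ t)) t := by
      intro t
      have h1 := (hasDerivAt_of_smooth hψ t).inner ℂ (hh t)
      have h2 : deriv ψ t = -act (darbouxF α k ω₀ ω₁ t) (ψ t) :=
        eq_neg_of_add_eq_zero_left (hψA t)
      rw [h2, inner_neg_left, inner_darbouxF, actR_apply, inner_add_right,
        Pi.neg_apply, inner_neg_right] at h1
      convert! h1 using 1
      ring
    have hi := intervalIntegral.integral_eq_sub_of_hasDerivAt (a := -|r| - 1) (b := x)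
      (fun t _ => hd t) ((hψ.continuous.inner hφ.continuous).neg.intervalIntegrable _ _)
    rw [intervalIntegral.integral_neg, intervalIntegral.integral_eq_integral_of_support_subset,
      horth ψ hψ hψA, h0, hψx] at hi
    · simpa using hi.symm
    · intro t ht
      have h1 : φ t ≠ 0 := fun h => ht (by simp [h])
      have h2 : |t| ≤ r := by
        by_contra! h3
        exact h1 (hr t h3)
      have h3 := abs_le.1 (h2.trans (le_abs_self r))
      exact ⟨by linarith [h3.1], by linarith [h3.2]⟩
  have hsupp : HasCompactSupport h := by
    refine HasCompactSupport.intro (isCompact_Icc (a := -|r|) (b := |r|)) fun x hx => ?_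
    by_contra h1
    exact hx ⟨not_lt.1 fun h2 => h1 (hleft x h2), not_lt.1 fun h2 => h1 (hright x h2)⟩
  refine ⟨fun x => act (rotation ω₀).conjTranspose (h x), ContDiff.const_act _ hsm,
    hasCompactSupport_act (M := fun _ => (rotation ω₀).conjTranspose) hsupp, ?_⟩
  have h1 : (fun x => act (rotation ω₀) (act (rotation ω₀).conjTranspose (h x))) = h := by
    funext x
    rw [← act_mul, mul_eq_one_comm.1 (conjTranspose_rotation_mul ω₀), one_act]
  funext x
  rw [raising, h1, darbouxAbar, (hh x).deriv, actR_apply, Pi.neg_apply]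
  abel

/-- On test functions orthogonal to the levels below `n` the quadratic form `‖A φ‖²` is at least
`2 α n ‖φ‖²`. By induction: such a function is `Ā C g`, where `g` is orthogonal to the levels below
`n - 1`; then `‖φ‖² = ‖A g‖² + 2 α ‖g‖² ≥ 2 α n ‖g‖²`, while `‖φ‖² = ⟪A φ, C g⟫ ≤ ‖A φ‖ ‖g‖`. -/
theorem form_bound (hα : 0 < α) (hω₀ : Real.cos ω₀ ≠ 0) (n : ℕ) {φ : ℝ → C2}
    (hφ : ContDiff ℝ ∞ φ) (hc : HasCompactSupport φ)
    (horth : ∀ j < n, ∀ ψ : ℝ → C2, ContDiff ℝ ∞ ψ → (∀ x, darbouxA α k ω₀ ω₁ ψ x = 0) →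
      ∫ x, (inner ℂ ((raising α k ω₀ ω₁)^[j] ψ x) (φ x) : ℂ) = 0) :
    2 * α * n * ∫ x, ‖φ x‖ ^ 2 ≤ ∫ x, ‖darbouxA α k ω₀ ω₁ φ x‖ ^ 2 := by
  induction n generalizing φ with
  | zero =>
    simp only [Nat.cast_zero, mul_zero, zero_mul]
    positivity
  | succ n ih =>
    obtain ⟨g, hg, hcg, rfl⟩ := exists_raising_eq α k ω₀ ω₁ hφ hc (horth 0 n.succ_pos)
    have hgn := ih hg hcg fun j hj ψ hψ h0 => by
      have h1 := horth (j + 1) (Nat.succ_lt_succ hj) ψ hψ h0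
      rw [integral_inner_raising α k ω₀ ω₁ (contDiff_iterate_raising α k ω₀ ω₁ hψ _) hg hcg] at h1
      simp only [darbouxA_iterate_raising α k ω₀ ω₁ hω₀ hψ h0, inner_smul_left,
        inner_rotation] at h1
      rw [integral_const_mul] at h1
      refine (mul_eq_zero.1 h1).resolve_left (?_ : _ ≠ _)
      rw [Complex.conj_ofReal, Complex.ofReal_ne_zero]
      positivity
    have h1 := integral_norm_raising_sq α k ω₀ ω₁ hω₀ hg hcg
    have h2 := integral_inner_raising α k ω₀ ω₁ hφ hg hcg
    have h3 := norm_integral_inner_sq_le (contDiff_darbouxA α k ω₀ ω₁ hφ).continuous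
      (ContDiff.const_act (rotation ω₀) hg).continuous (hasCompactSupport_darbouxA α k ω₀ ω₁ hc)
      (hasCompactSupport_act (M := fun _ => rotation ω₀) hcg)
    simp only [norm_rotation] at h3
    rw [← h2, integral_inner_self, Complex.norm_real, Real.norm_eq_abs, sq_abs] at h3
    set N := ∫ x, ‖raising α k ω₀ ω₁ g x‖ ^ 2
    set B := ∫ x, ‖darbouxA α k ω₀ ω₁ (raising α k ω₀ ω₁ g) x‖ ^ 2
    set K := ∫ x, ‖g x‖ ^ 2
    have hN : 0 ≤ N := by positivity
    have hB : 0 ≤ B := by positivity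
    have h4 : 2 * α * (n + 1 : ℕ) * K ≤ N := by
      push_cast
      linarith
    rcases hN.eq_or_lt with h5 | h5
    · rw [← h5, mul_zero]
      exact hB
    · refine le_of_mul_le_mul_right ?_ h5
      calc 2 * α * (n + 1 : ℕ) * N * N = 2 * α * (n + 1 : ℕ) * N ^ 2 := by ring
        _ ≤ 2 * α * (n + 1 : ℕ) * (B * K) := by gcongr
        _ = B * (2 * α * (n + 1 : ℕ) * K) := by ring
        _ ≤ B * N := by gcongr

end Forms

/-! ### Gaussian decay -/

section Decay

variable {E : Type*} [NormedAddCommGroup E]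

/-- `f` is bounded by a multiple of `exp (- c x²)` for some `c > 0`. -/
def GaussianDecay (f : ℝ → E) : Prop :=
  ∃ c > 0, ∃ K, ∀ x, ‖f x‖ ≤ K * Real.exp (-c * x ^ 2)

theorem GaussianDecay.of_le {F : Type*} [NormedAddCommGroup F] {f : ℝ → E} {g : ℝ → F}
    (hf : GaussianDecay f) {M : ℝ} (hM : 0 ≤ M) (h : ∀ x, ‖g x‖ ≤ M * ‖f x‖) :
    GaussianDecay g := by
  obtain ⟨c, hc, K, hK⟩ := hf
  refine ⟨c, hc, M * K, fun x => (h x).trans ?_⟩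
  rw [mul_assoc]
  exact mul_le_mul_of_nonneg_left (hK x) hM

theorem GaussianDecay.add {f g : ℝ → E} (hf : GaussianDecay f) (hg : GaussianDecay g) :
    GaussianDecay fun x => f x + g x := by
  obtain ⟨c, hc, K, hK⟩ := hf
  obtain ⟨d, hd, M, hM⟩ := hg
  have hK0 : 0 ≤ K := by simpa using (norm_nonneg _).trans (hK 0)
  have hM0 : 0 ≤ M := by simpa using (norm_nonneg _).trans (hM 0)
  refine ⟨min c d, lt_min hc hd, K + M, fun x => (norm_add_le _ _).trans ?_⟩
  rw [add_mul]
  refine add_le_add ((hK x).trans ?_) ((hM x).trans ?_) <;> gcongr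
  · exact min_le_left _ _
  · exact min_le_right _ _

theorem GaussianDecay.one_add_abs_mul {f : ℝ → E} (hf : GaussianDecay f) :
    GaussianDecay fun x => (1 + |x|) * ‖f x‖ := by
  obtain ⟨c, hc, K, hK⟩ := hf
  have hK0 : 0 ≤ K := by simpa using (norm_nonneg _).trans (hK 0)
  refine ⟨c / 2, half_pos hc, (2 + 2 / c) * K, fun x => ?_⟩
  rw [Real.norm_of_nonneg (by positivity)]
  have h1 : 1 + |x| ≤ (2 + 2 / c) * Real.exp (c / 2 * x ^ 2) := by
    have h2 : c / 2 * x ^ 2 + 1 ≤ Real.exp (c / 2 * x ^ 2) := Real.add_one_le_exp _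
    have h3 : |x| ≤ 1 + x ^ 2 := by
      nlinarith [sq_abs x, sq_nonneg (|x| - 1), abs_nonneg x]
    calc 1 + |x| ≤ 2 + x ^ 2 := by linarith
      _ ≤ (2 + 2 / c) * (c / 2 * x ^ 2 + 1) := by
        have h4 : (2 + 2 / c) * (c / 2 * x ^ 2 + 1) = 2 + x ^ 2 + (c * x ^ 2 + 2 / c) := by
          field_simp
          ring
        rw [h4]
        exact le_add_of_nonneg_right (by positivity)
      _ ≤ _ := by gcongr
  calc (1 + |x|) * ‖f x‖ ≤
        ((2 + 2 / c) * Real.exp (c / 2 * x ^ 2)) * (K * Real.exp (-c * x ^ 2)) := by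
        gcongr
        exact hK x
    _ = (2 + 2 / c) * K * (Real.exp (c / 2 * x ^ 2) * Real.exp (-c * x ^ 2)) := by ring
    _ = _ := by
      rw [← Real.exp_add]
      congr 2
      ring

theorem memLp_gaussian {c : ℝ} (hc : 0 < c) :
    MemLp (fun x : ℝ => Real.exp (-c * x ^ 2)) 2 volume := by
  rw [memLp_two_iff_integrable_sq (by fun_prop)]
  refine (integrable_exp_neg_mul_sq (b := 2 * c) (by positivity)).congr (.of_forall fun x => ?_)
  simp only [← Real.exp_nat_mul]
  congr 1
  push_cast
  ring

theorem GaussianDecay.memLp {f : ℝ → E} (hf : GaussianDecay f) (hc : Continuous f) :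
    MemLp f 2 volume := by
  obtain ⟨c, hc0, K, hK⟩ := hf
  refine (memLp_gaussian hc0).of_le_mul (c := K) hc.aestronglyMeasurable (.of_forall fun x => ?_)
  rw [Real.norm_of_nonneg (Real.exp_pos _).le]
  exact hK x

end Decay

/-! ### Decay of the eigenfunctions -/

section EigenDecay

variable (α k ω₀ ω₁ : ℝ)

theorem norm_reflection (θ : ℝ) (v : C2) : ‖act (reflection θ) v‖ = ‖v‖ := by
  have h : (Real.cos θ : ℂ) ^ 2 + (Real.sin θ : ℂ) ^ 2 = 1 := by
    exact_mod_cast Real.cos_sq_add_sin_sq θ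
  have h1 : (reflection θ).conjTranspose * reflection θ = 1 := by
    rw [conjTranspose_reflection]
    ext i j
    fin_cases i <;> fin_cases j <;>
      simp [reflection, Matrix.mul_apply, Fin.sum_univ_two, -Complex.ofReal_cos,
        -Complex.ofReal_sin] <;> first | linear_combination h | ring
  have h2 : inner ℂ (act (reflection θ) v) (act (reflection θ) v) = inner ℂ v v := by
    rw [inner_act, ← act_mul, h1, one_act]
  rw [← sq_eq_sq₀ (norm_nonneg _) (norm_nonneg _), ← Complex.ofReal_inj]
  push_cast
  rwa [inner_self_eq_norm_sq_to_K, inner_self_eq_norm_sq_to_K] at h2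

theorem norm_darbouxF_le (x : ℝ) (v : C2) :
    ‖act (darbouxF α k ω₀ ω₁ x) v‖ ≤ (|α| + |k|) * ((1 + |x|) * ‖v‖) := by
  rw [darbouxF, add_act, smul_act, smul_act, one_act]
  refine (norm_add_le _ _).trans ?_
  rw [norm_smul, norm_smul, norm_reflection, Complex.norm_real, Complex.norm_real,
    Real.norm_eq_abs, Real.norm_eq_abs, abs_mul]
  have h : 0 ≤ |α| * ‖v‖ + |k| * |x| * ‖v‖ := by positivity
  linarith

variable {α k ω₀ ω₁}

theorem GaussianDecay.act_darbouxF {f : ℝ → C2} (hf : GaussianDecay f) :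
    GaussianDecay fun x => act (darbouxF α k ω₀ ω₁ x) (f x) :=
  hf.one_add_abs_mul.of_le (M := |α| + |k|) (by positivity) fun x => by
    rw [Real.norm_of_nonneg (by positivity)]
    exact norm_darbouxF_le α k ω₀ ω₁ x (f x)

theorem GaussianDecay.act_rotation {f : ℝ → C2} (hf : GaussianDecay f) :
    GaussianDecay fun x => act (rotation ω₀) (f x) :=
  hf.of_le zero_le_one fun x => by rw [norm_rotation, one_mul]

theorem GaussianDecay.neg {f : ℝ → C2} (hf : GaussianDecay f) : GaussianDecay fun x => -f x :=
  hf.of_le zero_le_one fun x => by rw [norm_neg, one_mul]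

/-- Ground states decay like `exp (- α x² / 2 + |k| |x|)`, since `‖ψ‖² exp (α x² - 2 |k| x)` is
nonincreasing and `‖ψ‖² exp (α x² + 2 |k| x)` is nondecreasing. -/
theorem gaussianDecay_groundState (hα : 0 < α) {ψ : ℝ → C2} (hψ : ContDiff ℝ ∞ ψ)
    (h0 : ∀ x, darbouxA α k ω₀ ω₁ ψ x = 0) : GaussianDecay ψ := by
  let ρ : ℝ → ℝ := fun x => (inner ℂ (ψ x) (act (reflection (gam α ω₀ * x ^ 2 + ω₁)) (ψ x))).re
  have hρ : ∀ x, |k * ρ x| ≤ |k| * ‖ψ x‖ ^ 2 := by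
    intro x
    rw [abs_mul]
    gcongr
    refine (Complex.abs_re_le_norm _).trans ((norm_inner_le_norm _ _).trans ?_)
    rw [norm_reflection, sq]
  have hN : ∀ x, HasDerivAt (fun x => ‖ψ x‖ ^ 2) (-2 * α * x * ‖ψ x‖ ^ 2 - 2 * (k * ρ x)) x := by
    intro x
    have h1 := (hasDerivAt_of_smooth hψ x).inner ℂ (hasDerivAt_of_smooth hψ x)
    have h2 : deriv ψ x = -act (darbouxF α k ω₀ ω₁ x) (ψ x) :=
      eq_neg_of_add_eq_zero_left (h0 x)
    rw [h2, inner_neg_left, inner_darbouxF, inner_neg_right] at h1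
    have h3 := Complex.reCLM.hasFDerivAt.comp_hasDerivAt x h1
    have h4 : ∀ v : C2, ‖v‖ ^ 2 = (inner ℂ v v : ℂ).re := fun v => by
      rw [inner_self_eq_norm_sq_to_K]
      norm_cast
    simp only [h4]
    convert! h3 using 1
    simp only [darbouxF, add_act, smul_act, one_act, inner_add_right, inner_smul_right, ρ,
      Complex.reCLM_apply, Complex.add_re, Complex.neg_re, Complex.re_ofReal_mul]
    ring
  have hE : ∀ (s x : ℝ), HasDerivAt (fun x => ‖ψ x‖ ^ 2 * Real.exp (α * x ^ 2 + s * x))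
      ((s * ‖ψ x‖ ^ 2 - 2 * (k * ρ x)) * Real.exp (α * x ^ 2 + s * x)) x := by
    intro s x
    have h1 : HasDerivAt (fun x : ℝ => α * x ^ 2 + s * x) (α * (2 * x) + s) x := by
      convert! ((hasDerivAt_pow 2 x).const_mul α).add ((hasDerivAt_id x).const_mul s) using 1
      simp
    convert! (hN x).mul h1.exp using 1
    ring
  have hd : ∀ s, Differentiable ℝ fun x => ‖ψ x‖ ^ 2 * Real.exp (α * x ^ 2 + s * x) :=
    fun s x => (hE s x).differentiableAt
  have hanti : Antitone fun x => ‖ψ x‖ ^ 2 * Real.exp (α * x ^ 2 + -(2 * |k|) * x) := by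
    refine antitone_of_deriv_nonpos (hd _) fun x => ?_
    rw [(hE _ x).deriv]
    refine mul_nonpos_of_nonpos_of_nonneg ?_ (Real.exp_pos _).le
    have := (abs_le.1 (hρ x)).1
    linarith
  have hmono : Monotone fun x => ‖ψ x‖ ^ 2 * Real.exp (α * x ^ 2 + (2 * |k|) * x) := by
    refine monotone_of_deriv_nonneg (hd _) fun x => ?_
    rw [(hE _ x).deriv]
    refine mul_nonneg ?_ (Real.exp_pos _).le
    have := (abs_le.1 (hρ x)).2
    linarith
  have hmain : ∀ x, ‖ψ x‖ ^ 2 * Real.exp (α * x ^ 2 - 2 * |k| * |x|) ≤ ‖ψ 0‖ ^ 2 := by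
    intro x
    rcases le_total 0 x with hx | hx
    · have := hanti hx
      simpa [abs_of_nonneg hx, sub_eq_add_neg] using this
    · have := hmono hx
      simpa [abs_of_nonpos hx] using this
  refine ⟨α / 4, by positivity, ‖ψ 0‖ * Real.exp (k ^ 2 / α), fun x => ?_⟩
  rw [← sq_le_sq₀ (norm_nonneg _) (by positivity)]
  have h1 : 2 * |k| * |x| ≤ α * x ^ 2 / 2 + 2 * (k ^ 2 / α) := by
    have h2 : 0 ≤ (α * |x| - 2 * |k|) ^ 2 / (2 * α) := by positivity
    have h3 : (α * |x| - 2 * |k|) ^ 2 / (2 * α) =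
        α * |x| ^ 2 / 2 + 2 * (|k| ^ 2 / α) - 2 * |k| * |x| := by
      field_simp
      ring
    rw [h3, sq_abs, sq_abs] at h2
    linarith
  calc ‖ψ x‖ ^ 2 = ‖ψ x‖ ^ 2 * Real.exp (α * x ^ 2 - 2 * |k| * |x|) *
        Real.exp (-(α * x ^ 2 - 2 * |k| * |x|)) := by
        rw [mul_assoc, ← Real.exp_add, add_neg_cancel, Real.exp_zero, mul_one]
    _ ≤ ‖ψ 0‖ ^ 2 * Real.exp (2 * (k ^ 2 / α) + 2 * (-(α / 4) * x ^ 2)) := by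
      gcongr
      · exact hmain x
      · linarith
    _ = _ := by
      rw [Real.exp_add, mul_pow, mul_pow, ← Real.exp_nat_mul, ← Real.exp_nat_mul]
      push_cast
      ring

/-- The decay of the derivative at level `n + 1` follows from that of the functions themselves at
the levels `n` and `n + 1`, since `A` maps level `n + 1` to level `n`. -/
theorem gaussianDecay_iterate_raising (hα : 0 < α) (hω₀ : Real.cos ω₀ ≠ 0) {ψ : ℝ → C2}
    (hψ : ContDiff ℝ ∞ ψ) (h0 : ∀ x, darbouxA α k ω₀ ω₁ ψ x = 0) (n : ℕ) :
    GaussianDecay ((raising α k ω₀ ω₁)^[n] ψ) ∧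
      GaussianDecay (deriv ((raising α k ω₀ ω₁)^[n] ψ)) := by
  induction n with
  | zero =>
    have h1 := gaussianDecay_groundState hα hψ h0
    have h2 : deriv ψ = fun x => -act (darbouxF α k ω₀ ω₁ x) (ψ x) :=
      funext fun x => eq_neg_of_add_eq_zero_left (h0 x)
    refine ⟨h1, ?_⟩
    rw [Function.iterate_zero, id, h2]
    exact h1.act_darbouxF.neg
  | succ n ih =>
    have h1 : GaussianDecay ((raising α k ω₀ ω₁)^[n + 1] ψ) := by
      have h2 : (raising α k ω₀ ω₁)^[n + 1] ψ = fun x =>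
          -act (rotation ω₀) (deriv ((raising α k ω₀ ω₁)^[n] ψ) x) +
          act (darbouxF α k ω₀ ω₁ x) (act (rotation ω₀) ((raising α k ω₀ ω₁)^[n] ψ x)) := by
        funext x
        rw [Function.iterate_succ_apply',
          raising_apply α k ω₀ ω₁ (contDiff_iterate_raising α k ω₀ ω₁ hψ n)]
      rw [h2]
      exact ih.2.act_rotation.neg.add ih.1.act_rotation.act_darbouxF
    refine ⟨h1, ?_⟩
    have h2 : deriv ((raising α k ω₀ ω₁)^[n + 1] ψ) = fun x =>
        ((2 * α * (n + 1 : ℕ) : ℝ) : ℂ) • act (rotation ω₀) ((raising α k ω₀ ω₁)^[n] ψ x) +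
          -act (darbouxF α k ω₀ ω₁ x) ((raising α k ω₀ ω₁)^[n + 1] ψ x) := by
      funext x
      rw [← darbouxA_iterate_raising α k ω₀ ω₁ hω₀ hψ h0, darbouxA]
      abel
    rw [h2]
    exact (ih.1.act_rotation.of_le (norm_nonneg _) fun x => (norm_smul _ _).le).add
      h1.act_darbouxF.neg

end EigenDecay

/-! ### Decaying eigenfunctions belong to the domain of the closure -/

section Cutoff

/-- A smooth decaying solution of `-f'' + U f = z f` is approximated, in the graph norm, by its
products with the cutoffs `χ (s x)`, `s → 0`. -/
theorem mem_closure_minimalGraph {U : ℝ → Matrix (Fin 2) (Fin 2) ℂ}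
    (hU : ∀ i j, ContDiff ℝ ∞ fun x => U x i j) {f : ℝ → C2} {z : ℂ} (hf : ContDiff ℝ ∞ f)
    (hd : GaussianDecay f) (hd' : GaussianDecay (deriv f))
    (hz : ∀ x, schrodinger U f x = z • f x) {p : L2} (hp : p =ᵐ[volume] f) :
    (p, z • p) ∈ (minimalGraph U).topologicalClosure := by
  let χ : ContDiffBump (0 : ℝ) := ⟨1, 2, one_pos, one_lt_two⟩
  have hχ : ContDiff ℝ ∞ χ := χ.contDiff
  have hχ' : ContDiff ℝ ∞ (deriv χ) := (contDiff_infty_iff_deriv.1 hχ).2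
  have hχ'' : ContDiff ℝ ∞ (deriv (deriv χ)) := (contDiff_infty_iff_deriv.1 hχ').2
  obtain ⟨M₁, hM₁⟩ := χ.hasCompactSupport.deriv.exists_bound_of_continuous hχ'.continuous
  obtain ⟨M₂, hM₂⟩ := χ.hasCompactSupport.deriv.deriv.exists_bound_of_continuous hχ''.continuous
  have hM₁0 : 0 ≤ M₁ := (norm_nonneg _).trans (hM₁ 0)
  have hM₂0 : 0 ≤ M₂ := (norm_nonneg _).trans (hM₂ 0)
  have hχb : ∀ t : ℝ, |χ t - 1| ≤ |t| := by
    intro t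
    rcases le_or_gt |t| 1 with ht | ht
    · rw [χ.one_of_mem_closedBall (by simpa using ht), sub_self, abs_zero]
      exact abs_nonneg t
    · have h1 := χ.nonneg (x := t)
      have h2 := χ.le_one (x := t)
      rw [abs_le]
      constructor <;> linarith
  let φ : ℝ → ℝ → C2 := fun s x => χ (s * x) • f x
  have hscale : ∀ s x : ℝ, HasDerivAt (fun x : ℝ => s * x) s x := fun s x => by
    simpa using (hasDerivAt_id x).const_mul s
  have hφ : ∀ s, ContDiff ℝ ∞ (φ s) := fun s =>
    (hχ.comp (contDiff_const.mul contDiff_id)).smul hf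
  have hφ1 : ∀ s, deriv (φ s) = fun x => χ (s * x) • deriv f x + (deriv χ (s * x) * s) • f x :=
    fun s => funext fun x => (((hχ.differentiable (by simp) (s * x)).hasDerivAt.comp x
      (hscale s x)).smul (hasDerivAt_of_smooth hf x)).deriv
  have hφ2 : ∀ s x, deriv (deriv (φ s)) x =
      (χ (s * x) • deriv (deriv f) x + (deriv χ (s * x) * s) • deriv f x) +
        ((deriv χ (s * x) * s) • deriv f x + (deriv (deriv χ) (s * x) * s * s) • f x) := by
    intro s x
    rw [hφ1]
    exact ((((hχ.differentiable (by simp) (s * x)).hasDerivAt.comp x (hscale s x)).smul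
      (hasDerivAt_of_smooth (contDiff_deriv hf) x)).add
      ((((hχ'.differentiable (by simp) (s * x)).hasDerivAt.comp x (hscale s x)).mul_const s).smul
        (hasDerivAt_of_smooth hf x))).deriv
  have hLφ : ∀ s x, schrodinger U (φ s) x - z • f x = (χ (s * x) - 1) • z • f x -
      (2 * s * deriv χ (s * x)) • deriv f x - (s * s * deriv (deriv χ) (s * x)) • f x := by
    intro s x
    have h1 : act (U x) (φ s x) = χ (s * x) • act (U x) (f x) := (actR (U x)).map_smul _ _
    have h2 : act (U x) (f x) = z • f x + deriv (deriv f) x := by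
      rw [← hz x, schrodinger]
      abel
    rw [schrodinger, hφ2, h1, h2]
    module
  have hsupp : ∀ s, 0 < s → HasCompactSupport (φ s) := fun s hs =>
    (χ.hasCompactSupport.comp_homeomorph (Homeomorph.mulLeft₀ s hs.ne')).smul_right
  obtain ⟨c, hc, K, hK⟩ : GaussianDecay fun x => (1 + |x|) * ‖‖f x‖ + ‖deriv f x‖‖ :=
    ((hd.of_le (g := fun x => ‖f x‖) zero_le_one fun x => by simp).add
      (hd'.of_le (g := fun x => ‖deriv f x‖) zero_le_one fun x => by simp)).one_add_abs_mul
  replace hK : ∀ x, (1 + |x|) * (‖f x‖ + ‖deriv f x‖) ≤ K * Real.exp (-c * x ^ 2) := fun x => by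
    have := hK x
    simp only [] at this
    rwa [Real.norm_of_nonneg (by positivity), Real.norm_of_nonneg (by positivity)] at this
  have hK1 : ∀ x, |x| * ‖f x‖ ≤ K * Real.exp (-c * x ^ 2) := fun x => by
    refine le_trans ?_ (hK x)
    have : 0 ≤ ‖f x‖ + (1 + |x|) * ‖deriv f x‖ := by positivity
    linarith
  have hK2 : ∀ x, ‖f x‖ ≤ K * Real.exp (-c * x ^ 2) := fun x => by
    refine le_trans ?_ (hK x)
    have : 0 ≤ |x| * ‖f x‖ + (1 + |x|) * ‖deriv f x‖ := by positivity
    linarith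
  have hK3 : ∀ x, ‖deriv f x‖ ≤ K * Real.exp (-c * x ^ 2) := fun x => by
    refine le_trans ?_ (hK x)
    have : 0 ≤ |x| * ‖deriv f x‖ + (1 + |x|) * ‖f x‖ := by positivity
    linarith
  have hχs : ∀ s x : ℝ, 0 < s → ‖(χ (s * x) - 1) • f x‖ ≤ s * (K * Real.exp (-c * x ^ 2)) := by
    intro s x hs
    rw [norm_smul, Real.norm_eq_abs]
    calc |χ (s * x) - 1| * ‖f x‖ ≤ |s * x| * ‖f x‖ :=
          mul_le_mul_of_nonneg_right (hχb _) (norm_nonneg _)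
      _ = s * (|x| * ‖f x‖) := by rw [abs_mul, abs_of_pos hs, mul_assoc]
      _ ≤ _ := mul_le_mul_of_nonneg_left (hK1 x) hs.le
  have hb1 : ∀ s x : ℝ, 0 < s → ‖φ s x - f x‖ ≤ s * K * ‖Real.exp (-c * x ^ 2)‖ := by
    intro s x hs
    rw [Real.norm_of_nonneg (Real.exp_pos _).le, mul_assoc]
    have : φ s x - f x = (χ (s * x) - 1) • f x := by
      simp only [φ, sub_smul, one_smul]
    rw [this]
    exact hχs s x hs
  have hb2 : ∀ s x : ℝ, 0 < s → s ≤ 1 → ‖schrodinger U (φ s) x - z • f x‖ ≤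
      s * ((‖z‖ + 2 * M₁ + M₂) * K) * ‖Real.exp (-c * x ^ 2)‖ := by
    intro s x hs hs1
    rw [hLφ, Real.norm_of_nonneg (Real.exp_pos _).le]
    refine (norm_sub_le _ _).trans ((add_le_add (norm_sub_le _ _) le_rfl).trans ?_)
    have h1 : ‖(χ (s * x) - 1) • z • f x‖ ≤ ‖z‖ * (s * (K * Real.exp (-c * x ^ 2))) := by
      rw [smul_comm, norm_smul]
      gcongr
      exact hχs s x hs
    have h2 : ‖(2 * s * deriv χ (s * x)) • deriv f x‖ ≤
        2 * s * M₁ * (K * Real.exp (-c * x ^ 2)) := by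
      rw [norm_smul, norm_mul, Real.norm_of_nonneg (by positivity : 0 ≤ 2 * s)]
      gcongr
      · exact hM₁ _
      · exact hK3 x
    have h3 : ‖(s * s * deriv (deriv χ) (s * x)) • f x‖ ≤
        s * M₂ * (K * Real.exp (-c * x ^ 2)) := by
      rw [norm_smul, norm_mul, Real.norm_of_nonneg (by positivity : 0 ≤ s * s)]
      gcongr
      · exact mul_le_of_le_one_left hs.le hs1
      · exact hM₂ _
      · exact hK2 x
    linarith
  have hfl : MemLp f 2 volume := hd.memLp hf.continuous
  have hgauss := memLp_gaussian hc
  -- the approximants, for `s = 1 / (n + 1)`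
  let s : ℕ → ℝ := fun n => 1 / ((n : ℝ) + 1)
  have hs0 : ∀ n, 0 < s n := fun n => by positivity
  have hs1 : ∀ n, s n ≤ 1 := fun n => by
    simp only [s]
    rw [div_le_one (by positivity)]
    linarith [n.cast_nonneg (α := ℝ)]
  have hs : Filter.Tendsto s Filter.atTop (nhds 0) := tendsto_one_div_add_atTop_nhds_zero_nat
  have hLs : ∀ n, ContDiff ℝ ∞ (schrodinger U (φ (s n))) := fun n =>
    (contDiff_deriv (contDiff_deriv (hφ _))).neg.add (ContDiff.act hU (hφ _))
  have hLc : ∀ n, HasCompactSupport (schrodinger U (φ (s n))) := fun n =>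
    (hsupp _ (hs0 n)).deriv.deriv.neg.add (hasCompactSupport_act (hsupp _ (hs0 n)))
  have hm1 : ∀ n, MemLp (φ (s n)) 2 volume := fun n =>
    (hφ _).continuous.memLp_of_hasCompactSupport (hsupp _ (hs0 n))
  have hm2 : ∀ n, MemLp (schrodinger U (φ (s n))) 2 volume := fun n =>
    (hLs n).continuous.memLp_of_hasCompactSupport (hLc n)
  have htend : ∀ (q : L2) (g : ℝ → C2) (u : ℕ → ℝ → C2) (hu : ∀ n, MemLp (u n) 2 volume)
      (_ : q =ᵐ[volume] g) (M : ℝ)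
      (_ : ∀ n x, ‖u n x - g x‖ ≤ s n * M * ‖Real.exp (-c * x ^ 2)‖),
      Filter.Tendsto (fun n => (hu n).toLp (u n)) Filter.atTop (nhds q) := by
    intro q g u hu hq M hb
    rw [tendsto_iff_norm_sub_tendsto_zero]
    refine squeeze_zero (fun _ => norm_nonneg _) (g := fun n => s n * M * ‖hgauss.toLp _‖)
      (fun n => ?_) (by simpa using (hs.mul_const M).mul_const ‖hgauss.toLp _‖)
    refine Lp.norm_le_mul_norm_of_ae_le_mul ?_
    filter_upwards [Lp.coeFn_sub ((hu n).toLp (u n)) q, (hu n).coeFn_toLp, hq,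
      hgauss.coeFn_toLp] with x h1 h2 h3 h4
    rw [h1, Pi.sub_apply, h2, h3, h4]
    exact hb n x
  refine mem_closure_of_tendsto (f := fun n => ((hm1 n).toLp _, (hm2 n).toLp _)) (b := Filter.atTop)
    ((htend p f _ hm1 hp K fun n x => hb1 _ x (hs0 n)).prodMk_nhds
      (htend (z • p) (z • f) _ hm2 ?_ _ fun n x => hb2 _ x (hs0 n) (hs1 n)))
    (.of_forall fun n => ?_)
  · filter_upwards [Lp.coeFn_smul z p, hp] with x h1 h2
    rw [h1, Pi.smul_apply, Pi.smul_apply, h2]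
  · exact ⟨φ (s n), hφ _, hsupp _ (hs0 n), (hm1 n).coeFn_toLp, (hm2 n).coeFn_toLp⟩

end Cutoff

/-! ### The levels of the oscillator -/

section LevelSpaces

variable (α k ω₀ ω₁ : ℝ)

/-- The space of smooth solutions of `A ψ = 0`. -/
def groundStates : Submodule ℂ (ℝ → C2) where
  carrier := {ψ | ContDiff ℝ ∞ ψ ∧ ∀ x, darbouxA α k ω₀ ω₁ ψ x = 0}
  add_mem' := by
    rintro ψ φ ⟨h1, h2⟩ ⟨h3, h4⟩
    refine ⟨h1.add h3, fun x => ?_⟩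
    rw [darbouxA_add α k ω₀ ω₁ h1 h3, Pi.add_apply, h2, h4, add_zero]
  zero_mem' := ⟨contDiff_const, fun x => by
    have : deriv (0 : ℝ → C2) x = 0 := deriv_const x (0 : C2)
    simp [darbouxA, this, act_zero]⟩
  smul_mem' := by
    rintro c ψ ⟨h1, h2⟩
    refine ⟨contDiff_const.smul h1, fun x => ?_⟩
    rw [darbouxA_smul α k ω₀ ω₁ c h1, Pi.smul_apply, h2, smul_zero]

theorem groundState_unique {ψ φ : ℝ → C2} (hψ : ContDiff ℝ ∞ ψ) (hφ : ContDiff ℝ ∞ φ)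
    (h1 : ∀ x, darbouxA α k ω₀ ω₁ ψ x = 0) (h2 : ∀ x, darbouxA α k ω₀ ω₁ φ x = 0) {x₀ : ℝ}
    (h : ψ x₀ = φ x₀) : ψ = φ := by
  have key : ∀ {ψ : ℝ → C2}, ContDiff ℝ ∞ ψ → (∀ x, darbouxA α k ω₀ ω₁ ψ x = 0) → ∀ x,
      HasDerivAt ψ ((-actR (darbouxF α k ω₀ ω₁ x)) (ψ x) + 0) x := by
    intro ψ hψ h x
    convert! hasDerivAt_of_smooth hψ x using 1
    rw [eq_neg_of_add_eq_zero_left (h x), add_zero]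
    rfl
  exact linear_ode_unique_univ (f := fun _ => 0)
    (contDiff_actR (contDiff_darbouxF α k ω₀ ω₁)).neg.continuous x₀ (key hψ h1) (key hφ h2) h

/-- Evaluation at the origin identifies the ground states with `ℂ²`. -/
theorem finrank_groundStates : Module.finrank ℂ (groundStates α k ω₀ ω₁) = 2 := by
  let ev : groundStates α k ω₀ ω₁ →ₗ[ℂ] C2 :=
    LinearMap.proj (R := ℂ) (φ := fun _ : ℝ => C2) 0 ∘ₗ (groundStates α k ω₀ ω₁).subtype
  have hev : Function.Bijective ev := by
    constructor
    · intro ψ φ h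
      exact Subtype.ext (groundState_unique α k ω₀ ω₁ ψ.2.1 φ.2.1 ψ.2.2 φ.2.2 h)
    · intro y
      obtain ⟨ψ, h1, h2, h3⟩ := exists_groundState α k ω₀ ω₁ 0 y
      exact ⟨⟨ψ, h1, h2⟩, h3⟩
  rw [(LinearEquiv.ofBijective ev hev).finrank_eq]
  simp

theorem iterate_raising_add {ψ φ : ℝ → C2} (hψ : ContDiff ℝ ∞ ψ) (hφ : ContDiff ℝ ∞ φ) (n : ℕ) :
    (raising α k ω₀ ω₁)^[n] (ψ + φ) =
      (raising α k ω₀ ω₁)^[n] ψ + (raising α k ω₀ ω₁)^[n] φ := by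
  induction n with
  | zero => rfl
  | succ n ih =>
    simp only [Function.iterate_succ_apply']
    rw [ih, raising_add α k ω₀ ω₁ (contDiff_iterate_raising α k ω₀ ω₁ hψ n)
      (contDiff_iterate_raising α k ω₀ ω₁ hφ n)]

theorem iterate_raising_smul (c : ℂ) {ψ : ℝ → C2} (hψ : ContDiff ℝ ∞ ψ) (n : ℕ) :
    (raising α k ω₀ ω₁)^[n] (c • ψ) = c • (raising α k ω₀ ω₁)^[n] ψ := by
  induction n with
  | zero => rfl
  | succ n ih =>
    simp only [Function.iterate_succ_apply']
    rw [ih, raising_smul α k ω₀ ω₁ c (contDiff_iterate_raising α k ω₀ ω₁ hψ n)]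

variable {α k ω₀ ω₁}

theorem memLp_iterate_raising (hα : 0 < α) (hω₀ : Real.cos ω₀ ≠ 0) {ψ : ℝ → C2}
    (hψ : ψ ∈ groundStates α k ω₀ ω₁) (n : ℕ) :
    MemLp ((raising α k ω₀ ω₁)^[n] ψ) 2 volume :=
  (gaussianDecay_iterate_raising hα hω₀ hψ.1 hψ.2 n).1.memLp
    (contDiff_iterate_raising α k ω₀ ω₁ hψ.1 n).continuous

/-- The map `ψ ↦ (Ā C)ⁿ ψ` from the ground states to `L²`. -/
def raisingLp (hα : 0 < α) (hω₀ : Real.cos ω₀ ≠ 0) (n : ℕ) :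
    groundStates α k ω₀ ω₁ →ₗ[ℂ] L2 where
  toFun ψ := (memLp_iterate_raising hα hω₀ ψ.2 n).toLp _
  map_add' ψ φ := by
    rw [← MemLp.toLp_add]
    refine MemLp.toLp_congr _ _ (.of_forall fun x => congrFun ?_ x)
    exact iterate_raising_add α k ω₀ ω₁ ψ.2.1 φ.2.1 n
  map_smul' c ψ := by
    rw [RingHom.id_apply, ← MemLp.toLp_const_smul]
    refine MemLp.toLp_congr _ _ (.of_forall fun x => congrFun ?_ x)
    exact iterate_raising_smul α k ω₀ ω₁ c ψ.2.1 n

theorem coeFn_raisingLp (hα : 0 < α) (hω₀ : Real.cos ω₀ ≠ 0) (n : ℕ)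
    (ψ : groundStates α k ω₀ ω₁) :
    raisingLp hα hω₀ n ψ =ᵐ[volume] (raising α k ω₀ ω₁)^[n] ψ :=
  (memLp_iterate_raising hα hω₀ ψ.2 n).coeFn_toLp

theorem eq_zero_of_iterate_raising_eq_zero (hα : 0 < α) (hω₀ : Real.cos ω₀ ≠ 0) {ψ : ℝ → C2}
    (hψ : ψ ∈ groundStates α k ω₀ ω₁) (n : ℕ) (h : (raising α k ω₀ ω₁)^[n] ψ = 0) : ψ = 0 := by
  induction n with
  | zero => exact h
  | succ n ih =>
    refine ih (funext fun x => ?_)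
    have h1 := darbouxA_iterate_raising α k ω₀ ω₁ hω₀ hψ.1 hψ.2 n x
    rw [h, (groundStates α k ω₀ ω₁).zero_mem.2 x] at h1
    have h2 : ((2 * α * (n + 1 : ℕ) : ℝ) : ℂ) ≠ 0 := by
      rw [Complex.ofReal_ne_zero]
      positivity
    have h3 := (smul_eq_zero.1 h1.symm).resolve_left h2
    rw [← norm_eq_zero, norm_rotation, norm_eq_zero] at h3
    exact h3

theorem raisingLp_injective (hα : 0 < α) (hω₀ : Real.cos ω₀ ≠ 0) (n : ℕ) :
    Function.Injective (raisingLp (k := k) (ω₁ := ω₁) hα hω₀ n) := by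
  rw [← LinearMap.ker_eq_bot, LinearMap.ker_eq_bot']
  intro ψ h
  have h1 := coeFn_raisingLp hα hω₀ n ψ
  rw [h] at h1
  refine Subtype.ext (eq_zero_of_iterate_raising_eq_zero hα hω₀ ψ.2 n ?_)
  exact ((contDiff_iterate_raising α k ω₀ ω₁ ψ.2.1 n).continuous.ae_eq_iff_eq volume
    continuous_const).1 (h1.symm.trans (Lp.coeFn_zero _ _ _))

end LevelSpaces

/-! ### The spectrum of the oscillator -/

section Spectrum

theorem symmetric_topologicalClosure {H : Type*} [NormedAddCommGroup H] [InnerProductSpace ℂ H]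
    {G : Submodule ℂ (H × H)} (hs : ∀ p ∈ G, ∀ q ∈ G, inner ℂ p.2 q.1 = inner ℂ p.1 q.2) :
    ∀ p ∈ G.topologicalClosure, ∀ q ∈ G.topologicalClosure,
      inner ℂ p.2 q.1 = inner ℂ p.1 q.2 := by
  have h1 : ∀ p ∈ G.topologicalClosure, ∀ q ∈ G, inner ℂ p.2 q.1 = inner ℂ p.1 q.2 := by
    intro p hp q hq
    have hcl : IsClosed {p : H × H | (inner ℂ p.2 q.1 : ℂ) = inner ℂ p.1 q.2} :=
      isClosed_eq (by fun_prop) (by fun_prop)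
    exact closure_minimal (fun p hp => hs p hp q hq) hcl hp
  intro p hp q hq
  have hcl : IsClosed {q : H × H | (inner ℂ p.2 q.1 : ℂ) = inner ℂ p.1 q.2} :=
    isClosed_eq (by fun_prop) (by fun_prop)
  exact closure_minimal (fun q hq => h1 p hp q hq) hcl hq

/-- A densely defined symmetric operator is closable. -/
theorem isClosable_of_symmetric {H : Type*} [NormedAddCommGroup H] [InnerProductSpace ℂ H]
    {T : H →ₗ.[ℂ] H} (hd : DenseRange fun p : T.graph => (p : H × H).1)
    (hs : ∀ p ∈ T.graph, ∀ q ∈ T.graph, inner ℂ p.2 q.1 = inner ℂ p.1 q.2) : T.IsClosable := by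
  refine ⟨T.graph.topologicalClosure.toLinearPMap, (Submodule.toLinearPMap_graph_eq _ ?_).symm⟩
  rintro ⟨x, y⟩ hxy (rfl : x = 0)
  have h : (fun z : H => (inner ℂ y z : ℂ)) = fun _ => 0 :=
    hd.equalizer (by fun_prop) (by fun_prop) (funext fun q => by
      simpa using symmetric_topologicalClosure hs _ hxy _ (T.graph.le_topologicalClosure q.2))
  exact inner_self_eq_zero.1 (congrFun h y)

variable {α k ω₀ ω₁ : ℝ}

theorem memLp_schrodinger_of_hasCompactSupport {φ : ℝ → C2} (hφ : ContDiff ℝ ∞ φ)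
    (hc : HasCompactSupport φ) :
    MemLp (schrodinger (potential α k ω₀ ω₁) φ) 2 volume :=
  (contDiff_schrodinger α k ω₀ ω₁ hφ).continuous.memLp_of_hasCompactSupport
    (hc.deriv.deriv.neg.add (hasCompactSupport_act hc))

theorem denseRange_minimalGraph :
    DenseRange fun p : minimalGraph (potential α k ω₀ ω₁) => (p : L2 × L2).1 := by
  refine (Lp.dense_hasCompactSupport_contDiff (E := ℝ) (F := C2) (μ := volume) (p := 2)
    (by simp)).mono ?_
  rintro f ⟨g, hf, hc, hg⟩
  have hm := memLp_schrodinger_of_hasCompactSupport (α := α) (k := k) (ω₀ := ω₀) (ω₁ := ω₁) hg hc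
  exact ⟨⟨(f, hm.toLp _), g, hg, hc, hf, hm.coeFn_toLp⟩, rfl⟩

/-- The quadratic form of the minimal operator: `⟪ψ, L φ⟫ = ⟪A ψ, A φ⟫`. Only `φ` needs to have
compact support. -/
theorem inner_minimalGraph (hω₀ : Real.cos ω₀ ≠ 0) {p : L2 × L2} {φ : ℝ → C2}
    (hφ : ContDiff ℝ ∞ φ) (hc : HasCompactSupport φ)
    (h2 : p.2 =ᵐ[volume] schrodinger (potential α k ω₀ ω₁) φ) {q : L2} {ψ : ℝ → C2}
    (hψ : ContDiff ℝ ∞ ψ) (hq : q =ᵐ[volume] ψ) :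
    inner ℂ q p.2 = ∫ x, inner ℂ (darbouxA α k ω₀ ω₁ ψ x) (darbouxA α k ω₀ ω₁ φ x) := by
  rw [inner_eq_integral hq h2, integral_inner_schrodinger α k ω₀ ω₁ hω₀ hψ hφ hc]

theorem symmetric_minimalGraph (hω₀ : Real.cos ω₀ ≠ 0) :
    ∀ p ∈ minimalGraph (potential α k ω₀ ω₁), ∀ q ∈ minimalGraph (potential α k ω₀ ω₁),
      inner ℂ p.2 q.1 = inner ℂ p.1 q.2 := by
  rintro p ⟨ψ, h1, h2, h3, h4⟩ q ⟨φ, k1, k2, k3, k4⟩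
  rw [← inner_conj_symm, inner_minimalGraph hω₀ h1 h2 h4 k1 k3, ← integral_inner_symm,
    inner_minimalGraph hω₀ k1 k2 k4 h1 h3]

theorem isClosable_minimalOperator (hω₀ : Real.cos ω₀ ≠ 0) :
    (minimalOperator (potential α k ω₀ ω₁)).IsClosable := by
  refine isClosable_of_symmetric ?_ ?_ <;> rw [graph_minimalOperator]
  · exact denseRange_minimalGraph
  · exact symmetric_minimalGraph hω₀

theorem graph_hamiltonian (hω₀ : Real.cos ω₀ ≠ 0) :
    (hamiltonian (potential α k ω₀ ω₁)).graph =
      (minimalGraph (potential α k ω₀ ω₁)).topologicalClosure := by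
  rw [hamiltonian, ← (isClosable_minimalOperator hω₀).graph_closure_eq_closure_graph,
    graph_minimalOperator]

/-- The spectral description of the oscillator: its levels are the images of the ground states
under the powers of the raising operator. -/
theorem spectral_hamiltonian (hα : 0 < α) (hω₀ : Real.cos ω₀ ≠ 0) :
    IsSelfAdjoint (hamiltonian (potential α k ω₀ ω₁)) ∧
      spectrumOf (hamiltonian (potential α k ω₀ ω₁)) =
        Set.range (fun n : ℕ => ((2 * α * n : ℝ) : ℂ)) ∧
      ∀ n : ℕ, eigenspaceOf (hamiltonian (potential α k ω₀ ω₁)) ((2 * α * n : ℝ) : ℂ) =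
        LinearMap.range (raisingLp (k := k) (ω₁ := ω₁) hα hω₀ n) := by
  have hG := graph_hamiltonian (α := α) (k := k) (ω₁ := ω₁) hω₀
  have hs : ∀ p ∈ (hamiltonian (potential α k ω₀ ω₁)).graph,
      ∀ q ∈ (hamiltonian (potential α k ω₀ ω₁)).graph, inner ℂ p.2 q.1 = inner ℂ p.1 q.2 := by
    rw [hG]
    exact symmetric_topologicalClosure (symmetric_minimalGraph hω₀)
  have hdim : ∀ n, Module.finrank ℂ
      (LinearMap.range (raisingLp (k := k) (ω₁ := ω₁) hα hω₀ n)) = 2 := fun n => by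
    rw [LinearMap.finrank_range_of_inj (raisingLp_injective hα hω₀ n), finrank_groundStates]
  have hfd : ∀ n, FiniteDimensional ℂ
      (LinearMap.range (raisingLp (k := k) (ω₁ := ω₁) hα hω₀ n)) := fun n =>
    FiniteDimensional.of_finrank_pos (by rw [hdim]; norm_num)
  have hVT : ∀ n, ∀ v ∈ LinearMap.range (raisingLp (k := k) (ω₁ := ω₁) hα hω₀ n),
      (v, ((2 * α * n : ℝ) : ℂ) • v) ∈ (hamiltonian (potential α k ω₀ ω₁)).graph := by
    rintro n _ ⟨ψ, rfl⟩
    rw [hG]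
    obtain ⟨h1, h2⟩ := gaussianDecay_iterate_raising hα hω₀ ψ.2.1 ψ.2.2 n
    exact mem_closure_minimalGraph (contDiff_potential α k ω₀ ω₁)
      (contDiff_iterate_raising α k ω₀ ω₁ ψ.2.1 n) h1 h2
      (schrodinger_iterate_raising α k ω₀ ω₁ hω₀ ψ.2.1 ψ.2.2 n) (coeFn_raisingLp hα hω₀ n ψ)
  have hdense := denseRange_minimalGraph (α := α) (k := k) (ω₀ := ω₀) (ω₁ := ω₁)
  refine spectral_of_levels ((isClosable_minimalOperator hω₀).closure_isClosed) ?_ hs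
    (by positivity) _ hdim hVT ?_
  · refine Dense.mono ?_ hdense
    rintro _ ⟨p, rfl⟩
    have hp : ((p : L2 × L2).1, (p : L2 × L2).2) ∈ (hamiltonian (potential α k ω₀ ω₁)).graph := by
      rw [hG]
      exact Submodule.le_topologicalClosure _ p.2
    exact LinearPMap.mem_domain_of_mem_graph hp
  · refine total_of_form_bound hG hdense hs (c := 2 * α) (by positivity) _ hVT ?_
    rintro n p ⟨φ, h1, h2, h3, h4⟩ horth
    rw [inner_minimalGraph hω₀ h1 h2 h4 h1 h3, integral_inner_self, Complex.ofReal_re,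
      norm_sq_eq_integral h3]
    refine form_bound α k ω₀ ω₁ hα hω₀ n h1 h2 fun j hj ψ hψ h0 => ?_
    rw [← inner_eq_integral (coeFn_raisingLp hα hω₀ j ⟨ψ, hψ, h0⟩) h3]
    exact horth j hj _ ⟨_, rfl⟩

end Spectrum

/-! ### Contiguous relations for Kummer and Weber functions -/

theorem hasSum_of_forall_eq {f g : ℕ → ℂ} {s : ℂ} (h : HasSum f s) (e : ∀ n, f n = g n) :
    HasSum g s :=
  (funext e : f = g) ▸ h

theorem regularizedHGFunCoeff_singleton (a b : ℂ) (n : ℕ) :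
    Complex.regularizedHGFunCoeff {a} {b} n =
      (ascPochhammer ℂ n).eval a / (n.factorial * Complex.Gamma (b + n)) := by
  simp [Complex.regularizedHGFunCoeff]

theorem hasFPowerSeriesOnBall_regularizedHGFun (a b : ℂ) :
    HasFPowerSeriesOnBall (Complex.regularizedHGFun {a} {b})
      (Complex.regularizedHGFunSeries {a} {b}) 0 ⊤ := by
  have h : (Complex.regularizedHGFunSeries {a} {b}).radius = ⊤ :=
    Complex.radius_regularizedHGFunSeries_eq_top (by simp)
  have := FormalMultilinearSeries.hasFPowerSeriesOnBall (Complex.regularizedHGFunSeries {a} {b})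
    (by rw [h]; exact ENNReal.zero_lt_top)
  rwa [h] at this

theorem hasSum_regularizedHGFun (a b z : ℂ) :
    HasSum (fun n => Complex.regularizedHGFunCoeff {a} {b} n * z ^ n)
      (Complex.regularizedHGFun {a} {b} z) := by
  have h := (hasFPowerSeriesOnBall_regularizedHGFun a b).hasSum (y := z) (by simp)
  simpa [FormalMultilinearSeries.apply_eq_pow_smul_coeff, mul_comm] using h

theorem differentiable_regularizedHGFun (a b : ℂ) :
    Differentiable ℂ (Complex.regularizedHGFun {a} {b}) := by
  have h := (hasFPowerSeriesOnBall_regularizedHGFun a b).differentiableOn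
  intro z
  exact (h z (by simp)).differentiableAt (by simp)

theorem hasSum_deriv_regularizedHGFun (a b z : ℂ) :
    HasSum (fun n : ℕ => (n + 1) * Complex.regularizedHGFunCoeff {a} {b} (n + 1) * z ^ n)
      (deriv (Complex.regularizedHGFun {a} {b}) z) := by
  have h := (hasFPowerSeriesOnBall_regularizedHGFun a b).fderiv.hasSum (y := z) (by simp)
  have h2 := (ContinuousLinearMap.apply ℂ ℂ (1 : ℂ)).hasSum h
  simp only [ContinuousLinearMap.apply_apply, zero_add, fderiv_apply_one_eq_deriv] at h2
  refine hasSum_of_forall_eq h2 fun n => ?_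
  rw [FormalMultilinearSeries.apply_eq_pow_smul_coeff, smul_apply,
    FormalMultilinearSeries.derivSeries_coeff_one, Complex.regularizedHGFunSeries_coeff]
  simp only [nsmul_eq_mul, smul_eq_mul]
  push_cast
  ring

/-- The operator `z d/dz` multiplies the `n`-th coefficient by `n`. -/
theorem hasSum_mul_deriv_regularizedHGFun (a b z : ℂ) :
    HasSum (fun n : ℕ => n * Complex.regularizedHGFunCoeff {a} {b} n * z ^ n)
      (z * deriv (Complex.regularizedHGFun {a} {b}) z) := by
  rw [← hasSum_nat_add_iff' 1]
  have h := (hasSum_deriv_regularizedHGFun a b z).mul_left z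
  simp only [Finset.range_one, Finset.sum_singleton, Nat.cast_zero, zero_mul, sub_zero]
  refine hasSum_of_forall_eq h fun n => ?_
  push_cast
  ring

/-- For Kummer's function itself, `(b - 1) M(a, b - 1, z) = (b - 1) M(a, b, z) + z M'(a, b, z)`. -/
theorem regularizedHGFun_sub_one_right {a b : ℂ} (hb : ∀ n : ℕ, b - 1 + n ≠ 0) (z : ℂ) :
    Complex.regularizedHGFun {a} {b - 1} z =
      (b - 1) * Complex.regularizedHGFun {a} {b} z +
        z * deriv (Complex.regularizedHGFun {a} {b}) z := by
  refine (hasSum_regularizedHGFun a (b - 1) z).unique ?_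
  refine hasSum_of_forall_eq (((hasSum_regularizedHGFun a b z).mul_left (b - 1)).add
    (hasSum_mul_deriv_regularizedHGFun a b z)) fun n => ?_
  have hG : Complex.Gamma (b + n) = (b - 1 + n) * Complex.Gamma (b - 1 + n) := by
    rw [← Complex.Gamma_add_one _ (hb n)]
    congr 1
    ring
  have hG0 : Complex.Gamma (b - 1 + n) ≠ 0 := by
    refine Complex.Gamma_ne_zero fun m hm => hb (n + m) ?_
    push_cast
    linear_combination hm
  have h0 := hb n
  have hf : (n.factorial : ℂ) ≠ 0 := by exact_mod_cast n.factorial_ne_zero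
  rw [regularizedHGFunCoeff_singleton, regularizedHGFunCoeff_singleton, hG]
  field_simp

theorem deriv_regularizedHGFun_sub {a b : ℂ} (hb : ∀ n : ℕ, b + n ≠ 0) (z : ℂ) :
    deriv (Complex.regularizedHGFun {a} {b}) z - Complex.regularizedHGFun {a} {b} z =
      (a - b) * Complex.regularizedHGFun {a} {b + 1} z := by
  refine ((hasSum_deriv_regularizedHGFun a b z).sub (hasSum_regularizedHGFun a b z)).unique ?_
  refine hasSum_of_forall_eq ((hasSum_regularizedHGFun a (b + 1) z).mul_left (a - b)) fun n => ?_
  have hG : Complex.Gamma (b + 1 + n) = (b + n) * Complex.Gamma (b + n) := by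
    rw [← Complex.Gamma_add_one _ (hb n)]
    congr 1
    ring
  have hG' : Complex.Gamma (b + (n + 1 : ℕ)) = (b + n) * Complex.Gamma (b + n) := by
    rw [← hG]
    congr 1
    push_cast
    ring
  have hG0 : Complex.Gamma (b + n) ≠ 0 := by
    refine Complex.Gamma_ne_zero fun m hm => hb (n + m) ?_
    push_cast
    linear_combination hm
  have h0 := hb n
  have hf : (n.factorial : ℂ) ≠ 0 := by exact_mod_cast n.factorial_ne_zero
  have hn : (n : ℂ) + 1 ≠ 0 := by exact_mod_cast n.succ_ne_zero
  rw [regularizedHGFunCoeff_singleton, regularizedHGFunCoeff_singleton,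
    regularizedHGFunCoeff_singleton, hG, hG', ascPochhammer_succ_eval, Nat.factorial_succ]
  push_cast
  field_simp
  ring

/-- For Kummer's function itself,
`(b - 1) M(a - 1, b - 1, z) = (b - 1 - z) M(a, b, z) + z M'(a, b, z)`. -/
theorem regularizedHGFun_sub_one_sub_one {a b : ℂ} (hb : ∀ n : ℕ, b - 1 + n ≠ 0) (z : ℂ) :
    Complex.regularizedHGFun {a - 1} {b - 1} z =
      (b - 1 - z) * Complex.regularizedHGFun {a} {b} z +
        z * deriv (Complex.regularizedHGFun {a} {b}) z := by
  have key := regularizedHGFun_sub_one_right (a := a) hb z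
  suffices h : Complex.regularizedHGFun {a - 1} {b - 1} z =
      Complex.regularizedHGFun {a} {b - 1} z - z * Complex.regularizedHGFun {a} {b} z by
    rw [h, key]
    ring
  have h0 : Complex.regularizedHGFunCoeff {a - 1} {b - 1} 0 =
      Complex.regularizedHGFunCoeff {a} {b - 1} 0 := by
    simp [regularizedHGFunCoeff_singleton]
  refine (hasSum_regularizedHGFun (a - 1) (b - 1) z).unique ?_
  rw [← hasSum_nat_add_iff' 1]
  have hs := ((hasSum_nat_add_iff' 1).2 (hasSum_regularizedHGFun a (b - 1) z)).sub
    ((hasSum_regularizedHGFun a b z).mul_left z)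
  simp only [Finset.range_one, Finset.sum_singleton] at hs ⊢
  rw [h0, sub_right_comm]
  refine hasSum_of_forall_eq hs fun n => ?_
  have hG : Complex.Gamma (b - 1 + (n + 1 : ℕ)) = Complex.Gamma (b + n) := by
    congr 1
    push_cast
    ring
  have hG0 : Complex.Gamma (b + n) ≠ 0 := by
    refine Complex.Gamma_ne_zero fun m hm => hb (n + m + 1) ?_
    push_cast
    linear_combination hm
  have hf : (n.factorial : ℂ) ≠ 0 := by exact_mod_cast n.factorial_ne_zero
  have hn : (n : ℂ) + 1 ≠ 0 := by exact_mod_cast n.succ_ne_zero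
  have hp : (ascPochhammer ℂ (n + 1)).eval (a - 1) = (a - 1) * (ascPochhammer ℂ n).eval a := by
    rw [ascPochhammer_succ_left]
    simp [Polynomial.eval_comp]
  simp only [regularizedHGFunCoeff_singleton, hG, hp]
  rw [ascPochhammer_succ_eval, Nat.factorial_succ]
  push_cast
  field_simp
  ring

theorem deriv_regularizedHGFun (a b z : ℂ) :
    deriv (Complex.regularizedHGFun {a} {b}) z =
      a * Complex.regularizedHGFun {a + 1} {b + 1} z := by
  refine (hasSum_deriv_regularizedHGFun a b z).unique ?_
  refine hasSum_of_forall_eq ((hasSum_regularizedHGFun (a + 1) (b + 1) z).mul_left a) fun n => ?_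
  have hG : Complex.Gamma (b + (n + 1 : ℕ)) = Complex.Gamma (b + 1 + n) := by
    congr 1
    push_cast
    ring
  have hf : (n.factorial : ℂ) ≠ 0 := by exact_mod_cast n.factorial_ne_zero
  have hn : (n : ℂ) + 1 ≠ 0 := by exact_mod_cast n.succ_ne_zero
  have hp : (ascPochhammer ℂ (n + 1)).eval a = a * (ascPochhammer ℂ n).eval (a + 1) := by
    rw [ascPochhammer_succ_left]
    simp [Polynomial.eval_comp]
  simp only [regularizedHGFunCoeff_singleton, hG, hp]
  rw [Nat.factorial_succ]
  push_cast
  field_simp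

theorem ofReal_sqrt_mul_self {r : ℝ} (hr : 0 ≤ r) :
    ((Real.sqrt r : ℝ) : ℂ) * (Real.sqrt r : ℝ) = r := by
  rw [← Complex.ofReal_mul, Real.mul_self_sqrt hr]

/-- In terms of regularized Kummer functions the two terms of `D_ν` have the same form, and no
separate values of `Γ(1/2)` and `Γ(3/2)` occur. -/
theorem weberD_eq (ν z : ℂ) :
    weberD ν z = Real.pi * (2 : ℂ) ^ (ν / 2) * Complex.exp (-z ^ 2 / 4) *
      ((Complex.Gamma ((1 - ν) / 2))⁻¹ * Complex.regularizedHGFun {-ν / 2} {1 / 2} (z ^ 2 / 2) -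
        (Real.sqrt 2 : ℂ)⁻¹ * (Complex.Gamma (-ν / 2))⁻¹ *
          (z * Complex.regularizedHGFun {(1 - ν) / 2} {3 / 2} (z ^ 2 / 2))) := by
  have hp := ofReal_sqrt_mul_self Real.pi_pos.le
  have h2 := ofReal_sqrt_mul_self (r := 2) (by norm_num)
  have h20 : ((Real.sqrt 2 : ℝ) : ℂ) ≠ 0 := by
    exact_mod_cast (Real.sqrt_pos.2 (by norm_num : (0 : ℝ) < 2)).ne'
  have hG1 : Complex.Gamma (1 / 2) = (Real.sqrt Real.pi : ℝ) := by
    rw [← Real.Gamma_one_half_eq, ← Complex.Gamma_ofReal]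
    norm_num
  have hG3 : Complex.Gamma (3 / 2) = (Real.sqrt Real.pi : ℝ) / 2 := by
    rw [show (3 / 2 : ℂ) = 1 / 2 + 1 by norm_num, Complex.Gamma_add_one _ (by norm_num), hG1]
    ring
  have hs : ((Real.sqrt (2 * Real.pi) : ℝ) : ℂ) = Real.sqrt 2 * Real.sqrt Real.pi := by
    rw [Real.sqrt_mul (by norm_num), Complex.ofReal_mul]
  have hi : ((Real.sqrt 2 : ℝ) : ℂ)⁻¹ = Real.sqrt 2 / 2 := by
    rw [inv_eq_iff_eq_inv, inv_div, eq_div_iff h20, h2]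
    norm_num
  rw [weberD, kummerM, kummerM, hG1, hG3, hs, hi, ← hp]
  simp only [div_eq_mul_inv]
  ring

/-- The derivative of a function of the form taken by `D_ν`. -/
theorem hasDerivAt_weber_form (c p q a a' b b' z : ℂ) :
    HasDerivAt (fun z => c * Complex.exp (-z ^ 2 / 4) *
        (p * Complex.regularizedHGFun {a} {b} (z ^ 2 / 2) -
          q * (z * Complex.regularizedHGFun {a'} {b'} (z ^ 2 / 2))))
      (c * Complex.exp (-z ^ 2 / 4) *
        (p * (z * deriv (Complex.regularizedHGFun {a} {b}) (z ^ 2 / 2)) -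
          q * (Complex.regularizedHGFun {a'} {b'} (z ^ 2 / 2) +
            z ^ 2 * deriv (Complex.regularizedHGFun {a'} {b'}) (z ^ 2 / 2))) -
        z / 2 * (c * Complex.exp (-z ^ 2 / 4) *
          (p * Complex.regularizedHGFun {a} {b} (z ^ 2 / 2) -
            q * (z * Complex.regularizedHGFun {a'} {b'} (z ^ 2 / 2))))) z := by
  have hsq : HasDerivAt (fun z : ℂ => z ^ 2 / 2) z z := by
    refine ((hasDerivAt_pow 2 z).div_const 2).congr_deriv ?_
    norm_num
  have hX := (differentiable_regularizedHGFun a b (z ^ 2 / 2)).hasDerivAt.comp z hsq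
  have hY := (differentiable_regularizedHGFun a' b' (z ^ 2 / 2)).hasDerivAt.comp z hsq
  have he : HasDerivAt (fun z : ℂ => Complex.exp (-z ^ 2 / 4))
      (Complex.exp (-z ^ 2 / 4) * (-z / 2)) z := by
    refine (((hasDerivAt_pow 2 z).neg.div_const 4).cexp).congr_deriv ?_
    norm_num
    ring
  refine ((he.const_mul c).mul ((hX.const_mul p).sub
    (((hasDerivAt_id z).mul hY).const_mul q))).congr_deriv ?_
  simp only [Function.comp_apply, Pi.mul_apply, Pi.sub_apply, id_eq]
  ring

theorem two_cpow_sub_one_div_two (ν : ℂ) :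
    (2 : ℂ) ^ ((ν - 1) / 2) = 2 ^ (ν / 2) * (Real.sqrt 2 : ℂ)⁻¹ := by
  rw [sub_div, Complex.cpow_sub _ _ two_ne_zero, div_eq_mul_inv]
  congr 2
  rw [Real.sqrt_eq_rpow, Complex.ofReal_cpow (by norm_num)]
  norm_num

/-- `D_ν' + (z / 2) D_ν = ν D_{ν - 1}`. -/
theorem hasDerivAt_weberD {ν : ℂ} (hν : ν ≠ 0) (z : ℂ) :
    HasDerivAt (weberD ν) (-(z / 2) * weberD ν z + ν * weberD (ν - 1) z) z := by
  have hG : Complex.Gamma ((1 - (ν - 1)) / 2) = -ν / 2 * Complex.Gamma (-ν / 2) := by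
    rw [← Complex.Gamma_add_one _ (by simpa using hν)]
    congr 1
    ring
  have hr : ((Real.sqrt 2 : ℝ) : ℂ)⁻¹ * (Real.sqrt 2 : ℂ)⁻¹ = 1 / 2 := by
    rw [← mul_inv, ofReal_sqrt_mul_self (by norm_num)]
    norm_num
  have hC := regularizedHGFun_sub_one_right (a := (1 - ν) / 2) (b := 3 / 2)
    (fun n h => by
      have h' : ((1 + 2 * n : ℕ) : ℂ) = 0 := by
        push_cast
        linear_combination 2 * h
      have := Nat.cast_eq_zero.1 h'
      omega) (z ^ 2 / 2)
  rw [show (3 / 2 : ℂ) - 1 = 1 / 2 by norm_num] at hC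
  have h := hasDerivAt_weber_form (Real.pi * (2 : ℂ) ^ (ν / 2)) (Complex.Gamma ((1 - ν) / 2))⁻¹
    ((Real.sqrt 2 : ℂ)⁻¹ * (Complex.Gamma (-ν / 2))⁻¹) (-ν / 2) ((1 - ν) / 2) (1 / 2) (3 / 2) z
  rw [funext (weberD_eq ν)]
  refine h.congr_deriv ?_
  beta_reduce
  rw [deriv_regularizedHGFun (-ν / 2), weberD_eq (ν - 1), two_cpow_sub_one_div_two, hG,
    show -(ν - 1) / 2 = (1 - ν) / 2 by ring, hC,
    show (1 - (ν - 1)) / 2 = -ν / 2 + 1 by ring, show (1 / 2 : ℂ) + 1 = 3 / 2 by norm_num,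
    mul_inv]
  generalize (Complex.Gamma (-ν / 2))⁻¹ = g, (Complex.Gamma ((1 - ν) / 2))⁻¹ = g',
    (Real.sqrt 2 : ℂ)⁻¹ = r, Complex.exp (-z ^ 2 / 4) = e, (2 : ℂ) ^ (ν / 2) = c,
    (Real.pi : ℂ) = p, Complex.regularizedHGFun {-ν / 2} {1 / 2} (z ^ 2 / 2) = X,
    Complex.regularizedHGFun {(1 - ν) / 2} {3 / 2} (z ^ 2 / 2) = Y,
    deriv (Complex.regularizedHGFun {(1 - ν) / 2} {3 / 2}) (z ^ 2 / 2) = Y',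
    Complex.regularizedHGFun {-ν / 2 + 1} {3 / 2} (z ^ 2 / 2) = Z at hr ⊢
  have hν' : ν * (-ν / 2)⁻¹ = -2 := by field_simp
  linear_combination p * c * e * ν * z * g' * Z * hr -
    p * c * e * r * g * (Y + z ^ 2 * Y') / 2 * hν'

/-- `D_{ν - 1}' - (z / 2) D_{ν - 1} = - D_ν`. -/
theorem hasDerivAt_weberD_sub_one {ν : ℂ} (hν : ν ≠ 0) (z : ℂ) :
    HasDerivAt (weberD (ν - 1)) (z / 2 * weberD (ν - 1) z - weberD ν z) z := by
  have hG : Complex.Gamma ((1 - (ν - 1)) / 2) = -ν / 2 * Complex.Gamma (-ν / 2) := by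
    rw [← Complex.Gamma_add_one _ (by simpa using hν)]
    congr 1
    ring
  have hr : ((Real.sqrt 2 : ℝ) : ℂ)⁻¹ * (Real.sqrt 2 : ℂ)⁻¹ = 1 / 2 := by
    rw [← mul_inv, ofReal_sqrt_mul_self (by norm_num)]
    norm_num
  have hb (n : ℕ) : (1 / 2 : ℂ) + n ≠ 0 := fun h => by
    have h' : ((1 + 2 * n : ℕ) : ℂ) = 0 := by
      push_cast
      linear_combination 2 * h
    have := Nat.cast_eq_zero.1 h'
    omega
  have hC := regularizedHGFun_sub_one_sub_one (a := -ν / 2 + 1) (b := 3 / 2)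
    (fun n => by rw [show (3 / 2 : ℂ) - 1 = 1 / 2 by norm_num]; exact hb n) (z ^ 2 / 2)
  rw [show (3 / 2 : ℂ) - 1 = 1 / 2 by norm_num, add_sub_cancel_right] at hC
  have hC2 := deriv_regularizedHGFun_sub (a := (1 - ν) / 2) hb (z ^ 2 / 2)
  rw [sub_eq_iff_eq_add] at hC2
  have h := hasDerivAt_weber_form (Real.pi * (2 : ℂ) ^ ((ν - 1) / 2))
    (Complex.Gamma ((1 - (ν - 1)) / 2))⁻¹
    ((Real.sqrt 2 : ℂ)⁻¹ * (Complex.Gamma (-(ν - 1) / 2))⁻¹) (-(ν - 1) / 2)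
    ((1 - (ν - 1)) / 2) (1 / 2) (3 / 2) z
  rw [funext (weberD_eq (ν - 1))]
  refine h.congr_deriv ?_
  beta_reduce
  rw [weberD_eq ν, two_cpow_sub_one_div_two, hG,
    show -(ν - 1) / 2 = (1 - ν) / 2 by ring, hC2, hC,
    show (1 - (ν - 1)) / 2 = -ν / 2 + 1 by ring, show (1 / 2 : ℂ) + 1 = 3 / 2 by norm_num,
    mul_inv]
  generalize (Complex.Gamma (-ν / 2))⁻¹ = g, (Complex.Gamma ((1 - ν) / 2))⁻¹ = g',
    (Real.sqrt 2 : ℂ)⁻¹ = r, Complex.exp (-z ^ 2 / 4) = e, (2 : ℂ) ^ (ν / 2) = c,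
    (Real.pi : ℂ) = p, Complex.regularizedHGFun {(1 - ν) / 2} {1 / 2} (z ^ 2 / 2) = X,
    Complex.regularizedHGFun {(1 - ν) / 2} {3 / 2} (z ^ 2 / 2) = Y,
    Complex.regularizedHGFun {-ν / 2 + 1} {3 / 2} (z ^ 2 / 2) = Z,
    deriv (Complex.regularizedHGFun {-ν / 2 + 1} {3 / 2}) (z ^ 2 / 2) = Z' at hr ⊢
  have hν' : ν * (-ν / 2)⁻¹ = -2 := by field_simp
  linear_combination -p * c * e * g' * (Z * (1 - z ^ 2) + z ^ 2 * Z') * hr -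
    p * c * e * r * g * z * Y / 2 * hν'

/-- `D_ν(0) = 2^{ν / 2} √π / Γ((1 - ν) / 2)` is nonzero unless `ν` is an odd positive integer. -/
theorem weberD_zero_ne_zero {ν : ℂ} (hν : ∀ m : ℕ, (1 - ν) / 2 ≠ -m) : weberD ν 0 ≠ 0 := by
  have h0 : Complex.regularizedHGFun {-ν / 2} {1 / 2} (0 ^ 2 / 2) ≠ 0 := by
    have h := hasSum_regularizedHGFun (-ν / 2) (1 / 2) 0
    have h' := hasSum_single (f := fun n =>
      Complex.regularizedHGFunCoeff {-ν / 2} {1 / 2} n * (0 : ℂ) ^ n) 0 (fun n hn => by simp [hn])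
    rw [show (0 ^ 2 / 2 : ℂ) = 0 by norm_num, h.unique h', regularizedHGFunCoeff_singleton]
    have : Complex.Gamma (1 / 2) ≠ 0 := Complex.Gamma_ne_zero_of_re_pos (by norm_num)
    simpa using this
  have hG := Complex.Gamma_ne_zero hν
  have hp : (Real.pi : ℂ) ≠ 0 := by exact_mod_cast Real.pi_ne_zero
  have h2 : (2 : ℂ) ^ (ν / 2) ≠ 0 := by
    rw [Complex.cpow_def_of_ne_zero two_ne_zero]
    exact Complex.exp_ne_zero _
  rw [weberD_eq]
  simp only [zero_mul, mul_zero, sub_zero]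
  exact mul_ne_zero (mul_ne_zero (mul_ne_zero hp h2) (Complex.exp_ne_zero _))
    (mul_ne_zero (inv_ne_zero hG) h0)

/-- The functions `u = c₁ D_ν(τ x) + c₂ D_ν(- τ x)` and
`v = c₁ D_{ν - 1}(τ x) - c₂ D_{ν - 1}(- τ x)` satisfy `u' = - (τ² / 2) x u + τ ν v`; the opposite
signs of `c₂` absorb the sign of the inner derivative of `D_ν(- τ x)`. -/
theorem hasDerivAt_weberComb {ν : ℂ} (hν : ν ≠ 0) (τ c₁ c₂ : ℂ) (x : ℝ) :
    HasDerivAt (weberComb ν τ c₁ c₂)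
      (-(τ ^ 2 / 2 * x) * weberComb ν τ c₁ c₂ x + τ * ν * weberComb (ν - 1) τ c₁ (-c₂) x) x := by
  have h1 : HasDerivAt (fun y : ℝ => τ * (y : ℂ)) τ x := by
    simpa using (Complex.ofRealCLM.hasDerivAt (x := x)).const_mul τ
  have h2 := ((hasDerivAt_weberD hν (τ * x)).comp x h1).const_mul c₁
  have h3 := ((hasDerivAt_weberD hν (-(τ * x))).comp x h1.neg).const_mul c₂
  refine (h2.add h3).congr_deriv ?_
  simp only [weberComb]
  ring

theorem hasDerivAt_weberComb_sub_one {ν : ℂ} (hν : ν ≠ 0) (τ c₁ c₂ : ℂ) (x : ℝ) :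
    HasDerivAt (weberComb (ν - 1) τ c₁ (-c₂))
      (τ ^ 2 / 2 * x * weberComb (ν - 1) τ c₁ (-c₂) x - τ * weberComb ν τ c₁ c₂ x) x := by
  have h1 : HasDerivAt (fun y : ℝ => τ * (y : ℂ)) τ x := by
    simpa using (Complex.ofRealCLM.hasDerivAt (x := x)).const_mul τ
  have h2 := ((hasDerivAt_weberD_sub_one hν (τ * x)).comp x h1).const_mul c₁
  have h3 := ((hasDerivAt_weberD_sub_one hν (-(τ * x))).comp x h1.neg).const_mul (-c₂)
  refine (h2.add h3).congr_deriv ?_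
  simp only [weberComb]
  ring

theorem weberComb_zero (μ τ c₁ c₂ : ℂ) :
    weberComb μ τ c₁ c₂ 0 = (c₁ + c₂) * weberD μ 0 := by
  simp [weberComb]
  ring

/-! ### The components `ψ₁ ± i ψ₂` -/

theorem reflection_act_plus (χ : ℝ) (v : C2) :
    act (reflection χ) v 0 + Complex.I * act (reflection χ) v 1 =
      Complex.exp (Complex.I * χ) * (v 0 - Complex.I * v 1) := by
  rw [mul_comm Complex.I (χ : ℂ), Complex.exp_mul_I, act_apply_zero, act_apply_one]
  simp only [reflection, Complex.ofReal_cos, Complex.ofReal_sin, Matrix.of_apply, Matrix.cons_val',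
    Matrix.cons_val_zero, Matrix.cons_val_one, Matrix.cons_val_fin_one]
  linear_combination Complex.sin χ * v 1 * Complex.I_sq

theorem reflection_act_minus (χ : ℝ) (v : C2) :
    act (reflection χ) v 0 - Complex.I * act (reflection χ) v 1 =
      Complex.exp (-(Complex.I * χ)) * (v 0 + Complex.I * v 1) := by
  rw [← mul_neg, mul_comm Complex.I (-(χ : ℂ)), Complex.exp_mul_I, act_apply_zero, act_apply_one]
  simp only [reflection, Complex.ofReal_cos, Complex.ofReal_sin, Matrix.of_apply, Matrix.cons_val',
    Matrix.cons_val_zero, Matrix.cons_val_one, Matrix.cons_val_fin_one, Complex.cos_neg,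
    Complex.sin_neg]
  linear_combination Complex.sin χ * v 1 * Complex.I_sq

theorem rotation_act_plus (θ : ℝ) (v : C2) :
    act (rotation θ) v 0 + Complex.I * act (rotation θ) v 1 =
      Complex.exp (Complex.I * θ) * (v 0 + Complex.I * v 1) := by
  rw [mul_comm Complex.I (θ : ℂ), Complex.exp_mul_I, act_apply_zero, act_apply_one]
  simp only [rotation, Complex.ofReal_cos, Complex.ofReal_sin, Matrix.of_apply, Matrix.cons_val',
    Matrix.cons_val_zero, Matrix.cons_val_one, Matrix.cons_val_fin_one]
  linear_combination -Complex.sin θ * v 1 * Complex.I_sq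

theorem rotation_act_minus (θ : ℝ) (v : C2) :
    act (rotation θ) v 0 - Complex.I * act (rotation θ) v 1 =
      Complex.exp (-(Complex.I * θ)) * (v 0 - Complex.I * v 1) := by
  rw [← mul_neg, mul_comm Complex.I (-(θ : ℂ)), Complex.exp_mul_I, act_apply_zero, act_apply_one]
  simp only [rotation, Complex.ofReal_cos, Complex.ofReal_sin, Matrix.of_apply, Matrix.cons_val',
    Matrix.cons_val_zero, Matrix.cons_val_one, Matrix.cons_val_fin_one, Complex.cos_neg,
    Complex.sin_neg]
  linear_combination -Complex.sin θ * v 1 * Complex.I_sq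

theorem C2_ext_plus_minus {v w : C2} (hp : v 0 + Complex.I * v 1 = w 0 + Complex.I * w 1)
    (hm : v 0 - Complex.I * v 1 = w 0 - Complex.I * w 1) : v = w := by
  refine C2_ext ?_ ?_
  · linear_combination (hp + hm) / 2
  · linear_combination (-Complex.I / 2) * (hp - hm) + (v 1 - w 1) * Complex.I_sq

/-- The vector with prescribed components `ψ₁ + i ψ₂ = p` and `ψ₁ - i ψ₂ = q`. -/
def ofPlusMinus (p q : ℂ) : C2 := !₂[(p + q) / 2, -Complex.I * (p - q) / 2]

theorem ofPlusMinus_plus (p q : ℂ) :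
    ofPlusMinus p q 0 + Complex.I * ofPlusMinus p q 1 = p := by
  simp only [ofPlusMinus, PiLp.toLp_apply, Matrix.cons_val_zero, Matrix.cons_val_one,
    Matrix.cons_val_fin_one]
  linear_combination -(p - q) / 2 * Complex.I_sq

theorem ofPlusMinus_minus (p q : ℂ) :
    ofPlusMinus p q 0 - Complex.I * ofPlusMinus p q 1 = q := by
  simp only [ofPlusMinus, PiLp.toLp_apply, Matrix.cons_val_zero, Matrix.cons_val_one,
    Matrix.cons_val_fin_one]
  linear_combination (p - q) / 2 * Complex.I_sq

theorem hasDerivAt_ofPlusMinus {p q : ℝ → ℂ} {p' q' : ℂ} {x : ℝ} (hp : HasDerivAt p p' x)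
    (hq : HasDerivAt q q' x) :
    HasDerivAt (fun x => ofPlusMinus (p x) (q x)) (ofPlusMinus p' q') x := by
  rw [hasDerivAt_C2]
  intro i
  fin_cases i
  · exact (hp.add hq).div_const 2
  · exact ((hp.sub hq).const_mul (-Complex.I)).div_const 2

section Components

variable (α k ω₀ ω₁ : ℝ)

theorem darbouxF_act_plus (x : ℝ) (v : C2) :
    act (darbouxF α k ω₀ ω₁ x) v 0 + Complex.I * act (darbouxF α k ω₀ ω₁ x) v 1 =
      α * x * (v 0 + Complex.I * v 1) +
        k * Complex.exp (Complex.I * (gam α ω₀ * x ^ 2 + ω₁)) * (v 0 - Complex.I * v 1) := by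
  have h := reflection_act_plus (gam α ω₀ * x ^ 2 + ω₁) v
  push_cast at h
  rw [mul_assoc (k : ℂ), ← h]
  simp only [darbouxF, add_act, smul_act, one_act, PiLp.add_apply, PiLp.smul_apply, smul_eq_mul]
  push_cast
  ring

theorem darbouxF_act_minus (x : ℝ) (v : C2) :
    act (darbouxF α k ω₀ ω₁ x) v 0 - Complex.I * act (darbouxF α k ω₀ ω₁ x) v 1 =
      α * x * (v 0 - Complex.I * v 1) +
        k * Complex.exp (-(Complex.I * (gam α ω₀ * x ^ 2 + ω₁))) * (v 0 + Complex.I * v 1) := by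
  have h := reflection_act_minus (gam α ω₀ * x ^ 2 + ω₁) v
  push_cast at h
  rw [mul_assoc (k : ℂ), ← h]
  simp only [darbouxF, add_act, smul_act, one_act, PiLp.add_apply, PiLp.smul_apply, smul_eq_mul]
  push_cast
  ring

/-- The chirped Gaussians `exp ((- α ± i γ) x² / 2)` absorb the phase of the reflection in `F`. -/
theorem exp_mul_chirp (γ θ x : ℂ) (a : ℂ) :
    Complex.exp (Complex.I * (γ * x ^ 2 + θ)) * Complex.exp ((-a - Complex.I * γ) * x ^ 2 / 2) =
      Complex.exp (Complex.I * θ) * Complex.exp ((-a + Complex.I * γ) * x ^ 2 / 2) := by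
  rw [← Complex.exp_add, ← Complex.exp_add]
  congr 1
  ring

theorem exp_neg_mul_chirp (γ θ x : ℂ) (a : ℂ) :
    Complex.exp (-(Complex.I * (γ * x ^ 2 + θ))) *
        Complex.exp ((-a + Complex.I * γ) * x ^ 2 / 2) =
      Complex.exp (-(Complex.I * θ)) * Complex.exp ((-a - Complex.I * γ) * x ^ 2 / 2) := by
  rw [← Complex.exp_add, ← Complex.exp_add]
  congr 1
  ring

theorem hasDerivAt_exp_mul {g : ℝ → ℂ} {g' : ℂ} {x : ℝ} (c : ℂ) (hg : HasDerivAt g g' x) :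
    HasDerivAt (fun x : ℝ => Complex.exp (c * x ^ 2 / 2) * g x)
      (Complex.exp (c * x ^ 2 / 2) * (c * x * g x + g')) x := by
  have h1 : HasDerivAt (fun y : ℝ => (y : ℂ)) 1 x := Complex.ofRealCLM.hasDerivAt
  have h2 := ((((h1.pow 2).const_mul c).div_const 2).cexp).mul hg
  refine h2.congr_deriv ?_
  simp only [Pi.pow_apply]
  push_cast
  ring

/-! ### Weber form of the eigenfunctions -/

/-- Coefficients `P, Q, R, S` of a wave function whose components `ψ₁ + i ψ₂` and `ψ₁ - i ψ₂` are,
up to the factors `exp ((- α ± i γ) x² / 2)`, the functions `P u + Q v` and `R u + S v`. -/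
structure WeberCoeff where
  P : Polynomial ℂ
  Q : Polynomial ℂ
  R : Polynomial ℂ
  S : Polynomial ℂ

/-- The wave function `ψ` has the form described by the coefficients `c` with respect to the pair
`u`, `v`. -/
def WeberCoeff.Represents (α γ : ℝ) (u v : ℝ → ℂ) (c : WeberCoeff) (ψ : ℝ → C2) (x : ℝ) : Prop :=
  ψ x 0 + Complex.I * ψ x 1 = Complex.exp ((-α + Complex.I * γ) * x ^ 2 / 2) *
      (c.P.eval (x : ℂ) * u x + c.Q.eval (x : ℂ) * v x) ∧
    ψ x 0 - Complex.I * ψ x 1 = Complex.exp ((-α - Complex.I * γ) * x ^ 2 / 2) *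
      (c.R.eval (x : ℂ) * u x + c.S.eval (x : ℂ) * v x)

open Polynomial in
/-- The effect of the raising operator on the coefficients, when `u' = - i γ x u + τ ν v` and
`v' = i γ x v - τ u`. -/
def WeberCoeff.raise (α k ω₀ ω₁ : ℝ) (ν τ : ℂ) (c : WeberCoeff) : WeberCoeff where
  P := C (Complex.exp (Complex.I * ω₀)) *
      (-derivative c.P + C (2 * α : ℂ) * X * c.P + C τ * c.Q) +
    C (k * Complex.exp (Complex.I * (ω₁ - ω₀))) * c.R
  Q := C (Complex.exp (Complex.I * ω₀)) *
      (-derivative c.Q - C (τ * ν) * c.P + C (2 * α - 2 * Complex.I * gam α ω₀) * X * c.Q) +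
    C (k * Complex.exp (Complex.I * (ω₁ - ω₀))) * c.S
  R := C (Complex.exp (-(Complex.I * ω₀))) *
      (-derivative c.R + C (2 * α + 2 * Complex.I * gam α ω₀) * X * c.R + C τ * c.S) +
    C (k * Complex.exp (-(Complex.I * (ω₁ - ω₀)))) * c.P
  S := C (Complex.exp (-(Complex.I * ω₀))) *
      (-derivative c.S - C (τ * ν) * c.R + C (2 * α : ℂ) * X * c.S) +
    C (k * Complex.exp (-(Complex.I * (ω₁ - ω₀)))) * c.Q

theorem raising_plus {ψ : ℝ → C2} (hψ : ContDiff ℝ ∞ ψ) (x : ℝ) :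
    raising α k ω₀ ω₁ ψ x 0 + Complex.I * raising α k ω₀ ω₁ ψ x 1 =
      Complex.exp (Complex.I * ω₀) * (-(deriv ψ x 0 + Complex.I * deriv ψ x 1) +
        α * x * (ψ x 0 + Complex.I * ψ x 1)) +
      k * Complex.exp (-(Complex.I * ω₀)) *
        (Complex.exp (Complex.I * (gam α ω₀ * x ^ 2 + ω₁)) * (ψ x 0 - Complex.I * ψ x 1)) := by
  have h1 := darbouxF_act_plus α k ω₀ ω₁ x (act (rotation ω₀) (ψ x))
  have h2 := rotation_act_plus ω₀ (deriv ψ x)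
  rw [rotation_act_plus, rotation_act_minus] at h1
  rw [raising_apply α k ω₀ ω₁ hψ, PiLp.add_apply, PiLp.add_apply, PiLp.neg_apply, PiLp.neg_apply]
  linear_combination h1 - h2

theorem raising_minus {ψ : ℝ → C2} (hψ : ContDiff ℝ ∞ ψ) (x : ℝ) :
    raising α k ω₀ ω₁ ψ x 0 - Complex.I * raising α k ω₀ ω₁ ψ x 1 =
      Complex.exp (-(Complex.I * ω₀)) * (-(deriv ψ x 0 - Complex.I * deriv ψ x 1) +
        α * x * (ψ x 0 - Complex.I * ψ x 1)) +
      k * Complex.exp (Complex.I * ω₀) *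
        (Complex.exp (-(Complex.I * (gam α ω₀ * x ^ 2 + ω₁))) * (ψ x 0 + Complex.I * ψ x 1)) := by
  have h1 := darbouxF_act_minus α k ω₀ ω₁ x (act (rotation ω₀) (ψ x))
  have h2 := rotation_act_minus ω₀ (deriv ψ x)
  rw [rotation_act_plus, rotation_act_minus] at h1
  rw [raising_apply α k ω₀ ω₁ hψ, PiLp.add_apply, PiLp.add_apply, PiLp.neg_apply, PiLp.neg_apply]
  linear_combination h1 - h2

/-- The derivative of a wave function in Weber form. -/
theorem WeberCoeff.Represents.deriv {γ : ℝ} {u v : ℝ → ℂ} {c : WeberCoeff} {ψ : ℝ → C2}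
    (h : ∀ x, c.Represents α γ u v ψ x) {x : ℝ} {u' v' : ℂ} (hu : HasDerivAt u u' x)
    (hv : HasDerivAt v v' x) :
    HasDerivAt ψ (ofPlusMinus
      (Complex.exp ((-α + Complex.I * γ) * x ^ 2 / 2) *
        ((-α + Complex.I * γ) * x * (c.P.eval (x : ℂ) * u x + c.Q.eval (x : ℂ) * v x) +
          (c.P.derivative.eval (x : ℂ) * u x + c.P.eval (x : ℂ) * u' +
            (c.Q.derivative.eval (x : ℂ) * v x + c.Q.eval (x : ℂ) * v'))))
      (Complex.exp ((-α - Complex.I * γ) * x ^ 2 / 2) *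
        ((-α - Complex.I * γ) * x * (c.R.eval (x : ℂ) * u x + c.S.eval (x : ℂ) * v x) +
          (c.R.derivative.eval (x : ℂ) * u x + c.R.eval (x : ℂ) * u' +
            (c.S.derivative.eval (x : ℂ) * v x + c.S.eval (x : ℂ) * v'))))) x := by
  have hpoly (p : Polynomial ℂ) :
      HasDerivAt (fun y : ℝ => p.eval (y : ℂ)) (p.derivative.eval (x : ℂ)) x :=
    (p.hasDerivAt (x : ℂ)).comp_ofReal
  have hψ : ψ = fun x => ofPlusMinus (ψ x 0 + Complex.I * ψ x 1) (ψ x 0 - Complex.I * ψ x 1) := by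
    funext y
    exact C2_ext_plus_minus (ofPlusMinus_plus _ _).symm (ofPlusMinus_minus _ _).symm
  have hψ' : ψ = fun x : ℝ => ofPlusMinus
      (Complex.exp ((-α + Complex.I * γ) * x ^ 2 / 2) *
        (c.P.eval (x : ℂ) * u x + c.Q.eval (x : ℂ) * v x))
      (Complex.exp ((-α - Complex.I * γ) * x ^ 2 / 2) *
        (c.R.eval (x : ℂ) * u x + c.S.eval (x : ℂ) * v x)) := by
    rw [hψ]
    funext y
    rw [(h y).1, (h y).2]
  rw [hψ']
  exact hasDerivAt_ofPlusMinus
    (hasDerivAt_exp_mul _ (((hpoly c.P).mul hu).add ((hpoly c.Q).mul hv)))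
    (hasDerivAt_exp_mul _ (((hpoly c.R).mul hu).add ((hpoly c.S).mul hv)))

/-- If `c` represents `ψ`, then `c.raise` represents `Ā C ψ`. -/
theorem WeberCoeff.Represents.raising {ν τ : ℂ} {u v : ℝ → ℂ} {c : WeberCoeff} {ψ : ℝ → C2}
    (hu : ∀ x, HasDerivAt u (-(Complex.I * gam α ω₀ * x) * u x + τ * ν * v x) x)
    (hv : ∀ x, HasDerivAt v (Complex.I * gam α ω₀ * x * v x - τ * u x) x)
    (hψ : ContDiff ℝ ∞ ψ) (h : ∀ x, c.Represents α (gam α ω₀) u v ψ x) (x : ℝ) :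
    (c.raise α k ω₀ ω₁ ν τ).Represents α (gam α ω₀) u v
      (MatrixOscillator.raising α k ω₀ ω₁ ψ) x := by
  have hd := (WeberCoeff.Represents.deriv α h (hu x) (hv x)).deriv
  have e1 : Complex.exp (Complex.I * (ω₁ - ω₀)) =
      Complex.exp (-(Complex.I * ω₀)) * Complex.exp (Complex.I * ω₁) := by
    rw [← Complex.exp_add]
    congr 1
    ring
  have e2 : Complex.exp (-(Complex.I * (ω₁ - ω₀))) =
      Complex.exp (Complex.I * ω₀) * Complex.exp (-(Complex.I * ω₁)) := by
    rw [← Complex.exp_add]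
    congr 1
    ring
  constructor
  · rw [raising_plus α k ω₀ ω₁ hψ, hd, ofPlusMinus_plus, (h x).1, (h x).2, ← mul_assoc
      (Complex.exp (Complex.I * (gam α ω₀ * x ^ 2 + ω₁))), exp_mul_chirp]
    simp only [WeberCoeff.raise, Polynomial.eval_add, Polynomial.eval_sub, Polynomial.eval_neg,
      Polynomial.eval_mul, Polynomial.eval_C, Polynomial.eval_X, e1]
    ring
  · rw [raising_minus α k ω₀ ω₁ hψ, hd, ofPlusMinus_minus, (h x).1, (h x).2, ← mul_assoc
      (Complex.exp (-(Complex.I * (gam α ω₀ * x ^ 2 + ω₁)))), exp_neg_mul_chirp]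
    simp only [WeberCoeff.raise, Polynomial.eval_add, Polynomial.eval_sub, Polynomial.eval_neg,
      Polynomial.eval_mul, Polynomial.eval_C, Polynomial.eval_X, e2]
    ring

end Components

/-- The coefficients of the ground states: `ψ₁ + i ψ₂` is a multiple of `u`, and `ψ₁ - i ψ₂` is a
multiple of `v`. -/
def groundCoeff (k ω₁ : ℝ) (ν τ : ℂ) : WeberCoeff where
  P := 1
  Q := 0
  R := 0
  S := Polynomial.C (-(ν * τ / k) * Complex.exp (-(Complex.I * ω₁)))

section GroundWeber

variable {α k ω₀ ω₁ : ℝ} {ν τ : ℂ}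

theorem iterate_represents {u v : ℝ → ℂ} {c : WeberCoeff} {ψ : ℝ → C2}
    (hu : ∀ x, HasDerivAt u (-(Complex.I * gam α ω₀ * x) * u x + τ * ν * v x) x)
    (hv : ∀ x, HasDerivAt v (Complex.I * gam α ω₀ * x * v x - τ * u x) x)
    (hψ : ContDiff ℝ ∞ ψ) (h : ∀ x, c.Represents α (gam α ω₀) u v ψ x) (n : ℕ) (x : ℝ) :
    ((WeberCoeff.raise α k ω₀ ω₁ ν τ)^[n] c).Represents α (gam α ω₀) u v
      ((raising α k ω₀ ω₁)^[n] ψ) x := by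
  induction n generalizing x with
  | zero => exact h x
  | succ n ih =>
    rw [Function.iterate_succ_apply', Function.iterate_succ_apply']
    exact WeberCoeff.Represents.raising α k ω₀ ω₁ hu hv
      (contDiff_iterate_raising α k ω₀ ω₁ hψ n) ih x

/-- A wave function in the Weber form of level zero is a ground state. -/
theorem mem_groundStates_of_represents {u v : ℝ → ℂ} {ψ : ℝ → C2} (hk : k ≠ 0)
    (hντ : ν * τ ^ 2 = -k ^ 2)
    (hu : ∀ x, HasDerivAt u (-(Complex.I * gam α ω₀ * x) * u x + τ * ν * v x) x)
    (hv : ∀ x, HasDerivAt v (Complex.I * gam α ω₀ * x * v x - τ * u x) x)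
    (h : ∀ x, (groundCoeff k ω₁ ν τ).Represents α (gam α ω₀) u v ψ x) :
    ψ ∈ groundStates α k ω₀ ω₁ := by
  have hk' : (k : ℂ) ≠ 0 := by exact_mod_cast hk
  have hd : ∀ x, HasDerivAt ψ (-act (darbouxF α k ω₀ ω₁ x) (ψ x)) x := by
    intro x
    refine (WeberCoeff.Represents.deriv α h (hu x) (hv x)).congr_deriv ?_
    have h1 := darbouxF_act_plus α k ω₀ ω₁ x (ψ x)
    have h2 := darbouxF_act_minus α k ω₀ ω₁ x (ψ x)
    rw [(h x).1, (h x).2, mul_assoc (k : ℂ), ← mul_assoc (Complex.exp _), exp_mul_chirp] at h1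
    rw [(h x).1, (h x).2, mul_assoc (k : ℂ), ← mul_assoc (Complex.exp _), exp_neg_mul_chirp] at h2
    have he : Complex.exp (Complex.I * ω₁) * Complex.exp (-(Complex.I * ω₁)) = 1 := by
      rw [← Complex.exp_add, add_neg_cancel, Complex.exp_zero]
    have hS : (k : ℂ) * (ν * τ / k) = ν * τ := by field_simp
    have hS' : ν * τ / k * τ = -k := by
      rw [div_mul_eq_mul_div, div_eq_iff hk', mul_assoc, ← sq, hντ]
      ring
    refine C2_ext_plus_minus ?_ ?_
    · rw [ofPlusMinus_plus, PiLp.neg_apply, PiLp.neg_apply]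
      simp only [groundCoeff, Polynomial.eval_one, Polynomial.eval_zero, Polynomial.eval_C,
        Polynomial.derivative_one, Polynomial.derivative_zero] at h1 ⊢
      generalize Complex.exp ((-α + Complex.I * gam α ω₀) * x ^ 2 / 2) = E at h1 ⊢
      generalize Complex.exp (Complex.I * ω₁) = e, Complex.exp (-(Complex.I * ω₁)) = e' at h1 he ⊢
      linear_combination h1 - E * v x * k * (ν * τ / k) * he - E * v x * hS
    · rw [ofPlusMinus_minus, PiLp.neg_apply, PiLp.neg_apply]
      simp only [groundCoeff, Polynomial.eval_one, Polynomial.eval_zero, Polynomial.eval_C,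
        Polynomial.derivative_C, Polynomial.derivative_zero] at h2 ⊢
      generalize Complex.exp ((-α - Complex.I * gam α ω₀) * x ^ 2 / 2) = E at h2 ⊢
      generalize Complex.exp (-(Complex.I * ω₁)) = e' at h2 he ⊢
      linear_combination h2 + E * e' * u x * hS'
  refine ⟨contDiff_of_linear_ode (contDiff_actR (contDiff_darbouxF α k ω₀ ω₁)).neg
    (contDiff_const (c := (0 : C2))) fun x => ?_, fun x => ?_⟩
  · refine (hd x).congr_deriv ?_
    simp [actR_apply]
  · rw [darbouxA, (hd x).deriv, neg_add_cancel]

/-- The first order system of the Weber functions for `τ² = 2 i γ`. -/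
theorem hasDerivAt_weber_pair (hν : ν ≠ 0) (hτ : τ ^ 2 = 2 * Complex.I * gam α ω₀) (c₁ c₂ : ℂ)
    (x : ℝ) :
    HasDerivAt (weberComb ν τ c₁ c₂) (-(Complex.I * gam α ω₀ * x) * weberComb ν τ c₁ c₂ x +
        τ * ν * weberComb (ν - 1) τ c₁ (-c₂) x) x ∧
      HasDerivAt (weberComb (ν - 1) τ c₁ (-c₂)) (Complex.I * gam α ω₀ * x *
        weberComb (ν - 1) τ c₁ (-c₂) x - τ * weberComb ν τ c₁ c₂ x) x := by
  refine ⟨(hasDerivAt_weberComb hν τ c₁ c₂ x).congr_deriv ?_,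
    (hasDerivAt_weberComb_sub_one hν τ c₁ c₂ x).congr_deriv ?_⟩
  · rw [hτ]
    ring
  · rw [hτ]
    ring

/-- The ground states are exactly the functions of the Weber form of level zero: such a function is
a ground state, and `c₁`, `c₂` can be adapted to any value at the origin. -/
theorem mem_groundStates_iff_weber (hk : k ≠ 0) (hγ : gam α ω₀ ≠ 0)
    (hν : ν = Complex.I * k ^ 2 / (2 * gam α ω₀)) (hτ : τ ^ 2 = 2 * Complex.I * gam α ω₀)
    (ψ : ℝ → C2) :
    ψ ∈ groundStates α k ω₀ ω₁ ↔ ∃ c₁ c₂ : ℂ, ∀ x, (groundCoeff k ω₁ ν τ).Represents α (gam α ω₀)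
      (weberComb ν τ c₁ c₂) (weberComb (ν - 1) τ c₁ (-c₂)) ψ x := by
  have hk' : (k : ℂ) ≠ 0 := by exact_mod_cast hk
  have hγ' : (gam α ω₀ : ℂ) ≠ 0 := by exact_mod_cast hγ
  have hν0 : ν ≠ 0 := by
    rw [hν]
    exact div_ne_zero (mul_ne_zero Complex.I_ne_zero (pow_ne_zero 2 hk'))
      (mul_ne_zero two_ne_zero hγ')
  have hτ0 : τ ≠ 0 := by
    rintro rfl
    have : 2 * Complex.I * gam α ω₀ ≠ 0 :=
      mul_ne_zero (mul_ne_zero two_ne_zero Complex.I_ne_zero) hγ'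
    exact this (by rw [← hτ]; ring)
  have hντ : ν * τ ^ 2 = -k ^ 2 := by
    rw [hν, hτ]
    field_simp
    linear_combination Complex.I_sq
  have hmem (φ : ℝ → C2) (c₁ c₂ : ℂ) (h : ∀ x, (groundCoeff k ω₁ ν τ).Represents α (gam α ω₀)
      (weberComb ν τ c₁ c₂) (weberComb (ν - 1) τ c₁ (-c₂)) φ x) : φ ∈ groundStates α k ω₀ ω₁ :=
    mem_groundStates_of_represents hk hντ (fun x => (hasDerivAt_weber_pair hν0 hτ c₁ c₂ x).1)
      (fun x => (hasDerivAt_weber_pair hν0 hτ c₁ c₂ x).2) h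
  refine ⟨fun hψ => ?_, fun ⟨c₁, c₂, h⟩ => hmem ψ c₁ c₂ h⟩
  -- `ν` is purely imaginary, so the Gamma functions in `D_ν(0)` and `D_{ν - 1}(0)` have no poles
  have hre : ν.re = 0 := by
    have : ν = ((k ^ 2 / (2 * gam α ω₀) : ℝ) : ℂ) * Complex.I := by
      rw [hν]
      push_cast
      ring
    rw [this, Complex.re_ofReal_mul, Complex.I_re, mul_zero]
  have hD : weberD ν 0 ≠ 0 := by
    refine weberD_zero_ne_zero fun m hm => ?_
    have h1 : 1 - ν = -(2 * m) := by linear_combination 2 * hm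
    have h2 := congrArg Complex.re h1
    simp [hre] at h2
    linarith [Nat.cast_nonneg (α := ℝ) m]
  have hD' : weberD (ν - 1) 0 ≠ 0 := by
    refine weberD_zero_ne_zero fun m hm => ?_
    have h1 : 2 - ν = -(2 * m) := by linear_combination 2 * hm
    have h2 := congrArg Complex.re h1
    simp [hre] at h2
    linarith [Nat.cast_nonneg (α := ℝ) m]
  set s : ℂ := -(ν * τ / k) * Complex.exp (-(Complex.I * ω₁)) with hs
  have hs0 : s ≠ 0 := mul_ne_zero
    (neg_ne_zero.2 (div_ne_zero (mul_ne_zero hν0 hτ0) hk')) (Complex.exp_ne_zero _)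
  -- `u(0) = (c₁ + c₂) D_ν(0)` and `v(0) = (c₁ - c₂) D_{ν - 1}(0)` determine `c₁` and `c₂`
  set a : ℂ := (ψ 0 0 + Complex.I * ψ 0 1) / weberD ν 0 with ha
  set b : ℂ := (ψ 0 0 - Complex.I * ψ 0 1) / (s * weberD (ν - 1) 0) with hb
  set u := weberComb ν τ ((a + b) / 2) ((a - b) / 2) with hu
  set v := weberComb (ν - 1) τ ((a + b) / 2) (-((a - b) / 2)) with hv
  let φ : ℝ → C2 := fun x => ofPlusMinus
    (Complex.exp ((-α + Complex.I * gam α ω₀) * x ^ 2 / 2) * u x)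
    (Complex.exp ((-α - Complex.I * gam α ω₀) * x ^ 2 / 2) * (s * v x))
  have hφ : ∀ x, (groundCoeff k ω₁ ν τ).Represents α (gam α ω₀) u v φ x := by
    intro x
    constructor
    · simp only [φ, ofPlusMinus_plus, groundCoeff, Polynomial.eval_one, Polynomial.eval_zero]
      ring
    · simp only [φ, ofPlusMinus_minus, groundCoeff, Polynomial.eval_C, Polynomial.eval_zero]
      ring
  have hφ0 := hmem φ _ _ hφ
  have h0 : ψ 0 = φ 0 := by
    have hu0 : u 0 = a * weberD ν 0 := by
      rw [hu, weberComb_zero]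
      ring
    have hv0 : v 0 = b * weberD (ν - 1) 0 := by
      rw [hv, weberComb_zero]
      ring
    refine C2_ext_plus_minus ?_ ?_
    · simp only [φ, ofPlusMinus_plus, hu0, ha]
      field_simp
      simp
    · simp only [φ, ofPlusMinus_minus, hv0, hb]
      field_simp
      simp
  refine ⟨(a + b) / 2, (a - b) / 2, ?_⟩
  rw [groundState_unique α k ω₀ ω₁ hψ.1 hφ0.1 hψ.2 hφ0.2 h0]
  exact hφ

theorem WeberCoeff.Represents.unique {γ : ℝ} {u v : ℝ → ℂ} {c : WeberCoeff} {ψ φ : ℝ → C2} {x : ℝ}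
    (h1 : c.Represents α γ u v ψ x) (h2 : c.Represents α γ u v φ x) : ψ x = φ x :=
  C2_ext_plus_minus (h1.1.trans h2.1.symm) (h1.2.trans h2.2.symm)

theorem WeberCoeff.Represents.congr {γ : ℝ} {u v : ℝ → ℂ} {c : WeberCoeff} {ψ φ : ℝ → C2} {x : ℝ}
    (h : ψ x = φ x) (h2 : c.Represents α γ u v φ x) : c.Represents α γ u v ψ x := by
  unfold WeberCoeff.Represents
  rw [h]
  exact h2

/-- The Weber form of the functions `(Ā C)ⁿ ψ`, `A ψ = 0`. -/
theorem exists_groundState_iff_weber (hk : k ≠ 0) (hγ : gam α ω₀ ≠ 0)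
    (hν : ν = Complex.I * k ^ 2 / (2 * gam α ω₀)) (hτ : τ ^ 2 = 2 * Complex.I * gam α ω₀)
    (n : ℕ) (f : L2) :
    (∃ ψ : ℝ → C2, ContDiff ℝ ∞ ψ ∧ (∀ x, darbouxA α k ω₀ ω₁ ψ x = 0) ∧
        f =ᵐ[volume] (raising α k ω₀ ω₁)^[n] ψ) ↔
      ∃ c₁ c₂ : ℂ, ∀ᵐ x : ℝ, ((WeberCoeff.raise α k ω₀ ω₁ ν τ)^[n]
        (groundCoeff k ω₁ ν τ)).Represents α (gam α ω₀)
          (weberComb ν τ c₁ c₂) (weberComb (ν - 1) τ c₁ (-c₂)) f x := by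
  have hν0 : ν ≠ 0 := by
    rw [hν]
    exact div_ne_zero (mul_ne_zero Complex.I_ne_zero (pow_ne_zero 2 (by exact_mod_cast hk)))
      (mul_ne_zero two_ne_zero (by exact_mod_cast hγ))
  have hit {c₁ c₂ : ℂ} {ψ : ℝ → C2} (hψ : ContDiff ℝ ∞ ψ)
      (h : ∀ x, (groundCoeff k ω₁ ν τ).Represents α (gam α ω₀) (weberComb ν τ c₁ c₂) (weberComb (ν - 1) τ c₁ (-c₂)) ψ x) (x : ℝ) :=
    iterate_represents (k := k) (ω₁ := ω₁) (fun x => (hasDerivAt_weber_pair hν0 hτ c₁ c₂ x).1)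
      (fun x => (hasDerivAt_weber_pair hν0 hτ c₁ c₂ x).2) hψ h n x
  constructor
  · rintro ⟨ψ, h1, h2, hf⟩
    obtain ⟨c₁, c₂, h⟩ := (mem_groundStates_iff_weber (ω₁ := ω₁) hk hγ hν hτ ψ).1 ⟨h1, h2⟩
    refine ⟨c₁, c₂, ?_⟩
    filter_upwards [hf] with x hx
    exact WeberCoeff.Represents.congr hx (hit h1 h x)
  · rintro ⟨c₁, c₂, hf⟩
    let φ : ℝ → C2 := fun x => ofPlusMinus
      (Complex.exp ((-α + Complex.I * gam α ω₀) * x ^ 2 / 2) *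
        ((groundCoeff k ω₁ ν τ).P.eval (x : ℂ) * weberComb ν τ c₁ c₂ x +
          (groundCoeff k ω₁ ν τ).Q.eval (x : ℂ) * weberComb (ν - 1) τ c₁ (-c₂) x))
      (Complex.exp ((-α - Complex.I * gam α ω₀) * x ^ 2 / 2) *
        ((groundCoeff k ω₁ ν τ).R.eval (x : ℂ) * weberComb ν τ c₁ c₂ x +
          (groundCoeff k ω₁ ν τ).S.eval (x : ℂ) * weberComb (ν - 1) τ c₁ (-c₂) x))
    have hφ : ∀ x, (groundCoeff k ω₁ ν τ).Represents α (gam α ω₀)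
        (weberComb ν τ c₁ c₂) (weberComb (ν - 1) τ c₁ (-c₂)) φ x := fun x =>
      ⟨ofPlusMinus_plus _ _, ofPlusMinus_minus _ _⟩
    obtain ⟨h1, h2⟩ := (mem_groundStates_iff_weber (ω₁ := ω₁) hk hγ hν hτ φ).2 ⟨c₁, c₂, hφ⟩
    refine ⟨φ, h1, h2, ?_⟩
    filter_upwards [hf] with x hx
    exact hx.unique (hit h1 hφ x)

end GroundWeber

/-- The scalar oscillator is the case `k = 0` of the family. -/
theorem scalarPotential_eq_potential (α : ℝ) : scalarPotential α = potential α 0 0 0 := by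
  funext x
  simp [scalarPotential, potential]

end MatrixOscillator

end

theorem mainTheorem6 (α k ω₀ ω₁ : ℝ) (hα : 0 < α) (hω₀ : Real.cos ω₀ ≠ 0) :
    -- the operator is self-adjoint
    IsSelfAdjoint (MatrixOscillator.hamiltonian (MatrixOscillator.potential α k ω₀ ω₁)) ∧
    -- its spectrum is `{2 n α | n ≥ 0}`, which is that of the scalar harmonic oscillator
    MatrixOscillator.spectrumOf
        (MatrixOscillator.hamiltonian (MatrixOscillator.potential α k ω₀ ω₁)) =
      Set.range (fun n : ℕ => ((2 * n * α : ℝ) : ℂ)) ∧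
    MatrixOscillator.spectrumOf
        (MatrixOscillator.hamiltonian (MatrixOscillator.potential α k ω₀ ω₁)) =
      MatrixOscillator.spectrumOf
        (MatrixOscillator.hamiltonian (MatrixOscillator.scalarPotential α)) ∧
    -- all levels, in particular the ground state, are eigenvalues of multiplicity two
    (∀ n : ℕ, Module.finrank ℂ (MatrixOscillator.eigenspaceOf
      (MatrixOscillator.hamiltonian (MatrixOscillator.potential α k ω₀ ω₁))
      ((2 * n * α : ℝ) : ℂ)) = 2) ∧
    -- `Ā C` raises the energy of every solution by `2 α`
    (∀ (z : ℂ) (ψ : ℝ → MatrixOscillator.C2), ContDiff ℝ ∞ ψ →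
      (∀ x, MatrixOscillator.schrodinger (MatrixOscillator.potential α k ω₀ ω₁) ψ x = z • ψ x) →
      ∀ x, MatrixOscillator.schrodinger (MatrixOscillator.potential α k ω₀ ω₁)
          (MatrixOscillator.raising α k ω₀ ω₁ ψ) x =
        (z + 2 * α) • MatrixOscillator.raising α k ω₀ ω₁ ψ x) ∧
    -- the eigenfunctions of level `n` are the `(Ā C)ⁿ ψ` with `A ψ = 0`
    (∀ (n : ℕ) (f : MatrixOscillator.L2),
      f ∈ MatrixOscillator.eigenspaceOf
          (MatrixOscillator.hamiltonian (MatrixOscillator.potential α k ω₀ ω₁))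
          ((2 * n * α : ℝ) : ℂ) ↔
        ∃ ψ : ℝ → MatrixOscillator.C2, ContDiff ℝ ∞ ψ ∧
          (∀ x, MatrixOscillator.darbouxA α k ω₀ ω₁ ψ x = 0) ∧
          f =ᵐ[volume] (MatrixOscillator.raising α k ω₀ ω₁)^[n] ψ) ∧
    -- expression through Weber functions, with `ν = i k² / (2 γ)` and `τ² = 2 i γ`
    (k ≠ 0 → MatrixOscillator.gam α ω₀ ≠ 0 →
      ∀ ν τ : ℂ, ν = Complex.I * k ^ 2 / (2 * MatrixOscillator.gam α ω₀) →
        τ ^ 2 = 2 * Complex.I * MatrixOscillator.gam α ω₀ →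
      ∃ P Q R S : ℕ → Polynomial ℂ,
        (P 0 = 1 ∧ Q 0 = 0 ∧ R 0 = 0 ∧
          S 0 = Polynomial.C (-(ν * τ / k) * Complex.exp (-(Complex.I * ω₁)))) ∧
        ∀ (n : ℕ) (f : MatrixOscillator.L2),
          f ∈ MatrixOscillator.eigenspaceOf
              (MatrixOscillator.hamiltonian (MatrixOscillator.potential α k ω₀ ω₁))
              ((2 * n * α : ℝ) : ℂ) ↔
            ∃ c₁ c₂ : ℂ, ∀ᵐ x : ℝ,
              f x 0 + Complex.I * f x 1 =
                Complex.exp ((-α + Complex.I * MatrixOscillator.gam α ω₀) * x ^ 2 / 2) *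
                  ((P n).eval (x : ℂ) * MatrixOscillator.weberComb ν τ c₁ c₂ x +
                    (Q n).eval (x : ℂ) * MatrixOscillator.weberComb (ν - 1) τ c₁ (-c₂) x) ∧
              f x 0 - Complex.I * f x 1 =
                Complex.exp ((-α - Complex.I * MatrixOscillator.gam α ω₀) * x ^ 2 / 2) *
                  ((R n).eval (x : ℂ) * MatrixOscillator.weberComb ν τ c₁ c₂ x +
                    (S n).eval (x : ℂ) * MatrixOscillator.weberComb (ν - 1) τ c₁ (-c₂) x)) := by
  obtain ⟨h1, h2, h3⟩ :=
    MatrixOscillator.spectral_hamiltonian (k := k) (ω₁ := ω₁) hα hω₀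
  have h2s := (MatrixOscillator.spectral_hamiltonian (k := 0) (ω₀ := 0) (ω₁ := 0) hα
    (by simp)).2.1
  have hc (n : ℕ) : (2 * n * α : ℝ) = 2 * α * n := by ring
  have h6 (n : ℕ) (f : MatrixOscillator.L2) :
      f ∈ MatrixOscillator.eigenspaceOf
          (MatrixOscillator.hamiltonian (MatrixOscillator.potential α k ω₀ ω₁))
          ((2 * n * α : ℝ) : ℂ) ↔
        ∃ ψ : ℝ → MatrixOscillator.C2, ContDiff ℝ ∞ ψ ∧
          (∀ x, MatrixOscillator.darbouxA α k ω₀ ω₁ ψ x = 0) ∧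
          f =ᵐ[volume] (MatrixOscillator.raising α k ω₀ ω₁)^[n] ψ := by
    rw [hc, h3 n]
    constructor
    · rintro ⟨ψ, rfl⟩
      exact ⟨ψ, ψ.2.1, ψ.2.2, MatrixOscillator.coeFn_raisingLp hα hω₀ n ψ⟩
    · rintro ⟨ψ, hψ1, hψ2, hf⟩
      exact ⟨⟨ψ, hψ1, hψ2⟩, Lp.ext ((MatrixOscillator.coeFn_raisingLp hα hω₀ n _).trans hf.symm)⟩
  refine ⟨h1, ?_, ?_, fun n => ?_, fun z ψ hψ h x =>
    MatrixOscillator.schrodinger_raising α k ω₀ ω₁ hω₀ z hψ h x, h6, ?_⟩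
  · rw [h2]
    simp only [hc]
  · rw [h2, MatrixOscillator.scalarPotential_eq_potential, h2s]
  · rw [hc, h3 n, LinearMap.finrank_range_of_inj
      (MatrixOscillator.raisingLp_injective hα hω₀ n), MatrixOscillator.finrank_groundStates]
  · intro hk hγ ν τ hν hτ
    let c : ℕ → MatrixOscillator.WeberCoeff := fun n =>
      (MatrixOscillator.WeberCoeff.raise α k ω₀ ω₁ ν τ)^[n]
        (MatrixOscillator.groundCoeff k ω₁ ν τ)
    exact ⟨fun n => (c n).P, fun n => (c n).Q, fun n => (c n).R, fun n => (c n).S,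
      ⟨rfl, rfl, rfl, rfl⟩, fun n f => (h6 n f).trans
        (MatrixOscillator.exists_groundState_iff_weber hk hγ hν hτ n f)⟩
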